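/- Let $k$ be a commutative ring; all algebras are associative unital $k$-algebras and $\otimes=\otimes_k$. Let $\mathcal H$ be a quasitriangular Hopf algebra over $k$ with universal R-matrix $\mathcal R=\mathcal R_1\otimes\mathcal R_2\in\mathcal H\otimes\mathcal H$, so $\mathcal R$ is invertible, $\mathcal R\,\Delta(h)=\Delta^{op}(h)\,\mathcal R$, $(\Delta\otimes\mathrm{id})(\mathcal R)=\mathcal R_{13}\mathcal R_{23}$ and $(\mathrm{id}\otimes\Delta)(\mathcal R)=\mathcal R_{13}\mathcal R_{12}$. Let $\mathcal L$ be an $\mathcal H$-module algebra that is $\mathcal H$-commutative: $\lambda\mu=(\mathcal R_2\triangleright\mu)(\mathcal R_1\triangleright\lambda)$ for all $\lambda,\mu\in\mathcal L$. Let $\mathcal U$ be a Hopf algebra with a Hopf algebra map $\mathcal H\to\mathcal U$ (for instance $\mathcal H\subset\mathcal U$); images of elements of $\mathcal H$ in $\mathcal U$ are denoted by the same letters. *Bialgebroids.* An $\mathcal L$-bialgebroid is an algebra $\mathfrak B$ with an algebra map $s:\mathcal L\to\mathfrak B$ and an anti-algebra map $t:\mathcal L\to\mathfrak B$ with commuting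 images, which make $\mathfrak B$ an $\mathcal L$-bimodule by $\lambda\cdot a=s(\lambda)a$, $a\cdot\lambda=t(\lambda)a$; a coassociative bimodule map $\Delta:\mathfrak B\to\mathfrak B\otimes_{\mathcal L}\mathfrak B$ that is a unital algebra homomorphism into $\{z: z(t(\lambda)\otimes1)=z(1\otimes s(\lambda))\ \forall\lambda\in\mathcal L\}$; and a bimodule map $\varepsilon:\mathfrak B\to\mathcal L$ with $\varepsilon(1)=1$, $\varepsilon(a\,s(\varepsilon(b)))=\varepsilon(ab)=\varepsilon(a\,t(\varepsilon(b)))$ and $(\varepsilon\otimes_{\mathcal L}\mathrm{id})\Delta=\mathrm{id}=(\mathrm{id}\otimes_{\mathcal L}\varepsilon)\Delta$. Write $a\vdash\lambda=\varepsilon(a\,s(\lambda))$. An element $\Psi=\Psi_1\otimes_{\mathcal L}\Psi_2\in\mathfrak B\otimes_{\mathcal L}\mathfrak B$ is a twisting cocycle if $\Delta(\Psi_1)\Psi\otimes_{\mathcal L}\Psi_2=\Psi_1\otimes_{\mathcal L}\Delta(\Psi_2)\Psi$ and $(\varepsilon\otimes_{\mathcal L}\mathrm{id})(\Psi)=1=(\mathrm{id}\otimes_{\mathcal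 L}\varepsilon)(\Psi)$. *The bialgebroid $\mathcal U\otimes(\mathcal L_+\rtimes\mathcal H)$.* On $\mathcal L\rtimes\mathcal H$, with the smash product $(\lambda\otimes f)(\mu\otimes g)=\lambda(f^{(1)}\triangleright\mu)\otimes f^{(2)}g$, put $s(\lambda)=\lambda\otimes1$, $t(\lambda)=(\mathcal R_2\triangleright\lambda)\otimes\mathcal R_1$, $\Delta(\lambda\otimes h)=(\lambda\otimes h^{(1)})\otimes_{\mathcal L}(1\otimes h^{(2)})$, $\varepsilon(\lambda\otimes h)=\lambda\,\varepsilon(h)$. On $\mathfrak B=\mathcal U\otimes(\mathcal L_+\rtimes\mathcal H)$ the source and target maps are $1\otimes s$ and $1\otimes t$, again written $s$ and $t$, and $\Delta(u\otimes b)=(u^{(1)}\otimes b^{(1)})\otimes_{\mathcal L}(u^{(2)}\otimes b^{(2)})$, $\varepsilon(u\otimes b)=\varepsilon(u)\varepsilon(b)$. *Dynamical cocycles.* Let $\mathcal L_-$ be $\mathcal L$ with the coaction $\delta^-(\lambda)=\lambda^{(1)}\otimes\lambda^{[2]}=\mathcal R_2\otimes(\mathcal R_1\triangleright\lambda)$.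 A universal dynamical cocycle over $\mathcal L_-$ is an invertible $\mathcal F=\mathcal F_1\otimes\mathcal F_2\otimes\mathcal F_3\in\mathcal U\otimes\mathcal U\otimes\mathcal L$ such that $h^{(1)}\mathcal F_1\otimes h^{(2)}\mathcal F_2\otimes (h^{(3)}\triangleright\mathcal F_3)=\mathcal F_1h^{(1)}\otimes\mathcal F_2h^{(2)}\otimes\mathcal F_3$ for all $h\in\mathcal H$; such that $(\Delta\otimes\mathrm{id}\otimes\mathrm{id})(\mathcal F)\,(\mathcal F_1\otimes\mathcal F_2\otimes\mathcal F_3^{(1)}\otimes\mathcal F_3^{[2]})=(\mathrm{id}\otimes\Delta\otimes\mathrm{id})(\mathcal F)\,(1\otimes\mathcal F)$ in $\mathcal U\otimes\mathcal U\otimes\mathcal U\otimes\mathcal L$; and such that $(\varepsilon\otimes\mathrm{id}\otimes\mathrm{id})(\mathcal F)=1=(\mathrm{id}\otimes\varepsilon\otimes\mathrm{id})(\mathcal F)$. **Theorem.** Let $\mathcal F$ be a universal dynamical cocycle over $\mathcal L_-$. Then $\mathfrak B=\mathcal U\otimes(\mathcal L_+\rtimes\mathcal H)$ is an $\mathcal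 L$-bialgebroid, and $$\Psi=(\mathcal F_1\otimes\mathcal F_3\otimes\mathcal R_1)\otimes_{\mathcal L}(\mathcal F_2\mathcal R_2\otimes1\otimes1)\in\mathfrak B\otimes_{\mathcal L}\mathfrak B$$ is a twisting cocycle of $\mathfrak B$. The product $(\Psi_1\vdash\lambda)(\Psi_2\vdash\mu)$ is the given product $\lambda\mu$ of $\mathcal L$; the twisted source map $\tilde s(\lambda)=s(\Psi_1\vdash\lambda)\Psi_2$ is $\mathcal R_2\otimes(\mathcal R_1\triangleright\lambda)\otimes1$, and the twisted target map $\tilde t(\lambda)=t(\Psi_2\vdash\lambda)\Psi_1$ is $t(\lambda)$. Let $\mathfrak B\otimes_{\tilde{\mathcal L}}\mathfrak B$ be the tensor product over $\mathcal L$ formed with $\tilde s,\tilde t$. Then $\Psi$ is invertible: there is $\Psi^{-1}\in\mathfrak B\otimes_{\tilde{\mathcal L}}\mathfrak B$ such that $\Psi\Psi^{-1}=1\otimes_{\mathcal L}1$ and $\Psi^{-1}\Psi=1\otimes_{\tilde{\mathcal L}}1$. Finally $\mathfrak B$, with source map $\tilde s$, target map $\tilde t=t$, coproduct $\tilde\Delta(a)=\Psi^{-1}\Delta(a)\Psi\in\mathfrak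 B\otimes_{\tilde{\mathcal L}}\mathfrak B$ and the same counit $\varepsilon$, is an $\mathcal L$-bialgebroid. -/

import Mathlib

open scoped TensorProduct

noncomputable section

/-! ## Quasitriangular bialgebras and their module algebras -/

section Quasitriangular

variable {k H : Type*} [CommRing k] [Ring H] [Bialgebra k H]

/-- `x ⊗ y ↦ x ⊗ y ⊗ 1`. -/
def leg12 (R : H ⊗[k] H) : H ⊗[k] (H ⊗[k] H) :=
  LinearMap.lTensor H ((TensorProduct.mk k H H).flip 1) R

/-- `x ⊗ y ↦ x ⊗ 1 ⊗ y`. -/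
def leg13 (R : H ⊗[k] H) : H ⊗[k] (H ⊗[k] H) :=
  LinearMap.lTensor H (TensorProduct.mk k H H 1) R

/-- `x ⊗ y ↦ 1 ⊗ x ⊗ y`. -/
def leg23 (R : H ⊗[k] H) : H ⊗[k] (H ⊗[k] H) := 1 ⊗ₜ[k] R

/-- `R` is a universal R-matrix (quasitriangular structure) of `H`:
it is invertible, `R Δ(h) = Δᵒᵖ(h) R`, `(Δ ⊗ id)(R) = R₁₃ R₂₃` and `(id ⊗ Δ)(R) = R₁₃ R₁₂`. -/
structure IsUniversalRMatrix (R : H ⊗[k] H) : Prop where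
  isUnit : IsUnit R
  mul_comul : ∀ h : H,
    R * Coalgebra.comul h = TensorProduct.comm k H H (Coalgebra.comul h) * R
  comul_left :
    TensorProduct.assoc k H H H (LinearMap.rTensor H Coalgebra.comul R) = leg13 R * leg23 R
  comul_right : LinearMap.lTensor H Coalgebra.comul R = leg13 R * leg12 R

end Quasitriangular

section ModuleAlgebra

variable (k H L : Type*) [CommRing k] [Ring H] [Bialgebra k H] [Ring L] [Algebra k L]
  [Module H L] [IsScalarTower k H L]

/-- The action `h ↦ (l ↦ h ▷ l)` as a bilinear map. -/
def actMap : H →ₗ[k] L →ₗ[k] L := (Algebra.lsmul k k L : H →ₐ[k] Module.End k L).toLinearMap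

/-- The componentwise action of `H ⊗ H` on `L ⊗ L`. -/
def actMap₂ : H ⊗[k] H →ₗ[k] L ⊗[k] L →ₗ[k] L ⊗[k] L :=
  TensorProduct.map₂ (actMap k H L) (actMap k H L)

/-- `L` is an `H`-module algebra: `h ▷ 1 = ε(h) 1` and `h ▷ (a b) = (h₁ ▷ a) (h₂ ▷ b)`. -/
class IsModuleAlgebra : Prop where
  smul_one' : ∀ h : H, h • (1 : L) = algebraMap k L (Coalgebra.counit h)
  smul_mul' : ∀ (h : H) (a b : L),
    h • (a * b) = LinearMap.mul' k L (actMap₂ k H L (Coalgebra.comul h) (a ⊗ₜ[k] b))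

variable {k H L}

@[simp] theorem actMap_apply (h : H) (l : L) : actMap k H L h l = h • l := rfl

variable (L) in
/-- `L` is `H`-commutative with respect to `R`: `a b = (R₂ ▷ b) (R₁ ▷ a)`. -/
def IsQuasiCommutative (R : H ⊗[k] H) : Prop :=
  ∀ a b : L, a * b =
    LinearMap.mul' k L (actMap₂ k H L (TensorProduct.comm k H H R) (b ⊗ₜ[k] a))

variable (L) in
/-- The coaction `δ⁻(l) = R₂ ⊗ (R₁ ▷ l)`; it makes `L` the `H`-base algebra `L₋`. -/
def coactionMinus (R : H ⊗[k] H) : L →ₗ[k] H ⊗[k] L :=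
  (LinearMap.lTensorHom H ∘ₗ (actMap k H L).flip).flip (TensorProduct.comm k H H R)

theorem coactionMinus_tmul (x y : H) (l : L) :
    coactionMinus L (x ⊗ₜ[k] y) l = y ⊗ₜ[k] (x • l) := rfl

end ModuleAlgebra

/-! ## The smash product algebra -/

/-- The underlying `k`-module `L ⊗ H` of the smash product `L ⋊ H`. -/
def Smash (k H L : Type*) [CommRing k] [Ring H] [Bialgebra k H] [Ring L] [Algebra k L] :
    Type _ := L ⊗[k] H

namespace Smash

variable (k H L : Type*) [CommRing k] [Ring H] [Bialgebra k H] [Ring L] [Algebra k L]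

instance : AddCommGroup (Smash k H L) := inferInstanceAs (AddCommGroup (L ⊗[k] H))

instance : Module k (Smash k H L) := inferInstanceAs (Module k (L ⊗[k] H))

/-- The identification `L ⊗ H = L ⋊ H` of `k`-modules. -/
def of : L ⊗[k] H ≃ₗ[k] Smash k H L := LinearEquiv.refl k _

variable [Module H L] [IsScalarTower k H L]

/-- For a fixed `y`, the map `H ⊗ H → L ⊗ H`, `a ⊗ b ↦ (a ▷ y₁) ⊗ b y₂`. -/
def hAct : H ⊗[k] H →ₗ[k] L ⊗[k] H →ₗ[k] L ⊗[k] H :=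
  TensorProduct.map₂ (actMap k H L) (LinearMap.mul k H)

/-- The smash product multiplication `(l ⊗ f) (m ⊗ g) = l (f₁ ▷ m) ⊗ f₂ g`. -/
def mulMap : L ⊗[k] H →ₗ[k] L ⊗[k] H →ₗ[k] L ⊗[k] H :=
  TensorProduct.lift
    ((LinearMap.llcomp k (L ⊗[k] H) (L ⊗[k] H) (L ⊗[k] H)).compl₁₂
      (LinearMap.rTensorHom H ∘ₗ LinearMap.mul k L) (hAct k H L ∘ₗ Coalgebra.comul))

theorem mulMap_tmul (l m : L) (f g : H) :
    mulMap k H L (l ⊗ₜ f) (m ⊗ₜ g) =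
      TensorProduct.map (LinearMap.mulLeft k l ∘ₗ (actMap k H L).flip m)
        (LinearMap.mulRight k g) (Coalgebra.comul f) := by
  change LinearMap.rTensor H (LinearMap.mul k L l)
    (hAct k H L (Coalgebra.comul f) (m ⊗ₜ g)) = _
  induction (Coalgebra.comul f : H ⊗[k] H) using TensorProduct.induction_on with
  | zero => simp
  | add x y hx hy => simp only [map_add, LinearMap.add_apply, hx, hy]
  | tmul x y => rfl

variable [IsModuleAlgebra k H L]

theorem mulMap_one (x : L ⊗[k] H) : mulMap k H L x (1 ⊗ₜ 1) = x := by
  induction x using TensorProduct.induction_on with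
  | zero => simp
  | add x y hx hy => simp only [map_add, LinearMap.add_apply, hx, hy]
  | tmul l f =>
    have h : ∀ w : H ⊗[k] H, TensorProduct.map (LinearMap.mulLeft k l ∘ₗ (actMap k H L).flip 1)
        (LinearMap.mulRight k 1) w =
        LinearMap.rTensor H (LinearMap.toSpanSingleton k L l)
          (LinearMap.rTensor H Coalgebra.counit w) := by
      intro w
      induction w using TensorProduct.induction_on with
      | zero => simp
      | add x y hx hy => simp only [map_add, hx, hy]
      | tmul x y =>
        simp [IsModuleAlgebra.smul_one' (k := k), Algebra.algebraMap_eq_smul_one]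
    rw [mulMap_tmul, h, Coalgebra.rTensor_counit_comul]
    simp

set_option linter.unusedSectionVars false in
theorem one_mulMap (x : L ⊗[k] H) : mulMap k H L (1 ⊗ₜ 1) x = x := by
  induction x using TensorProduct.induction_on with
  | zero => simp
  | add x y hx hy => simp only [map_add, hx, hy]
  | tmul l f => simp [mulMap_tmul, Bialgebra.comul_one, Algebra.TensorProduct.one_def]

theorem mulMap_assoc (x y z : L ⊗[k] H) :
    mulMap k H L (mulMap k H L x y) z = mulMap k H L x (mulMap k H L y z) := by
  induction x using TensorProduct.induction_on with
  | zero => simp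
  | add x x' hx hx' => simp only [map_add, LinearMap.add_apply, hx, hx']
  | tmul l f =>
  induction y using TensorProduct.induction_on with
  | zero => simp
  | add x x' hx hx' => simp only [map_add, LinearMap.add_apply, hx, hx']
  | tmul m g =>
  induction z using TensorProduct.induction_on with
  | zero => simp
  | add x x' hx hx' => simp only [map_add, hx, hx']
  | tmul n h =>
    let Φ (a b : H) : H ⊗[k] (H ⊗[k] H) →ₗ[k] L ⊗[k] H :=
      LinearMap.rTensor H (LinearMap.mul' k L) ∘ₗ
        (TensorProduct.assoc k L L H).symm.toLinearMap ∘ₗ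
        TensorProduct.map (LinearMap.mulLeft k l ∘ₗ (actMap k H L).flip m)
          (TensorProduct.map ((actMap k H L).flip n ∘ₗ LinearMap.mulRight k a)
            (LinearMap.mulRight k (b * h)))
    have h1 : ∀ (a b : H) (v : H ⊗[k] H),
        TensorProduct.map (LinearMap.mulLeft k l ∘ₗ (actMap k H L).flip (m * a • n))
          (LinearMap.mulRight k (b * h)) v =
        Φ a b (TensorProduct.assoc k H H H (LinearMap.rTensor H Coalgebra.comul v)) := by
      intro a b v
      induction v using TensorProduct.induction_on with
      | zero => simp
      | add x y hx hy => simp only [map_add, hx, hy]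
      | tmul x y =>
        simp only [TensorProduct.map_tmul, LinearMap.comp_apply, LinearMap.flip_apply,
          actMap_apply, IsModuleAlgebra.smul_mul' (k := k), LinearMap.rTensor_tmul]
        generalize (Coalgebra.comul x : H ⊗[k] H) = w
        induction w using TensorProduct.induction_on with
        | zero => simp
        | add x y hx hy =>
          simp only [map_add, TensorProduct.add_tmul, LinearMap.add_apply, hx, hy]
        | tmul c d => simp [Φ, actMap₂, mul_assoc, mul_smul]
    let r := Coalgebra.Repr.arbitrary k g
    have h2 : ∀ v : H ⊗[k] H,
        mulMap k H L (TensorProduct.map (LinearMap.mulLeft k l ∘ₗ (actMap k H L).flip m)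
          (LinearMap.mulRight k g) v) (n ⊗ₜ h) =
        ∑ i ∈ r.index, Φ (r.left i) (r.right i) (LinearMap.lTensor H Coalgebra.comul v) := by
      intro v
      induction v using TensorProduct.induction_on with
      | zero => simp
      | add x y hx hy =>
        simp only [map_add, LinearMap.add_apply, hx, hy, Finset.sum_add_distrib]
      | tmul x y =>
        simp only [TensorProduct.map_tmul, mulMap_tmul, LinearMap.mulRight_apply,
          Bialgebra.comul_mul, LinearMap.lTensor_tmul, ← r.eq, Finset.mul_sum, map_sum]
        refine Finset.sum_congr rfl fun i _ => ?_
        generalize (Coalgebra.comul y : H ⊗[k] H) = w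
        induction w using TensorProduct.induction_on with
        | zero => simp
        | add x y hx hy => simp only [map_add, add_mul, TensorProduct.tmul_add, hx, hy]
        | tmul c d => simp [Φ, mul_assoc, mul_smul]
    rw [mulMap_tmul, h2, mulMap_tmul, ← r.eq]
    simp only [map_sum, TensorProduct.map_tmul, mulMap_tmul]
    refine Finset.sum_congr rfl fun i _ => ?_
    rw [← Coalgebra.coassoc_apply, ← h1]
    simp

instance : Mul (Smash k H L) := ⟨fun x y => mulMap k H L x y⟩

instance : One (Smash k H L) := ⟨(1 : L) ⊗ₜ[k] (1 : H)⟩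

instance : Ring (Smash k H L) where
  left_distrib := fun x y z => map_add (mulMap k H L x) y z
  right_distrib := fun x y z => LinearMap.map_add₂ (mulMap k H L) x y z
  zero_mul := fun x => LinearMap.map_zero₂ (mulMap k H L) x
  mul_zero := fun x => map_zero (mulMap k H L x)
  mul_assoc := mulMap_assoc k H L
  one_mul := one_mulMap k H L
  mul_one := mulMap_one k H L
  neg_add_cancel := neg_add_cancel
  zsmul := fun n x => n • x
  zsmul_zero' := SubNegMonoid.zsmul_zero'
  zsmul_succ' := SubNegMonoid.zsmul_succ'
  zsmul_neg' := SubNegMonoid.zsmul_neg'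
  sub_eq_add_neg := sub_eq_add_neg

instance : Algebra k (Smash k H L) :=
  Algebra.ofModule (fun r x y => LinearMap.map_smul₂ (mulMap k H L) r x y)
    (fun r x y => map_smul (mulMap k H L x) r y)

set_option linter.unusedSectionVars false in
theorem of_mul_of (l m : L) (f g : H) :
    of k H L (l ⊗ₜ f) * of k H L (m ⊗ₜ g) =
      of k H L (TensorProduct.map (LinearMap.mulLeft k l ∘ₗ (actMap k H L).flip m)
        (LinearMap.mulRight k g) (Coalgebra.comul f)) :=
  mulMap_tmul k H L l m f g

end Smash

/-! ## Bialgebroids -/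

section Balanced

variable {k L B : Type*} [CommRing k] [Ring L] [Algebra k L] [Ring B] [Algebra k B]

/-- The relations `t(l) a ⊗ b = a ⊗ s(l) b` defining `B ⊗_L B`, where `B` is the `L`-bimodule
`l · a = s(l) a`, `a · l = t(l) a`. -/
def balRel (s t : L →ₗ[k] B) : Submodule k (B ⊗[k] B) :=
  Submodule.span k {z | ∃ (l : L) (a b : B), z = (t l * a) ⊗ₜ[k] b - a ⊗ₜ[k] (s l * b)}

/-- The tensor product `B ⊗_L B`. -/
abbrev Bal (s t : L →ₗ[k] B) : Type _ := (B ⊗[k] B) ⧸ balRel s t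

/-- The class in `B ⊗_L B` of an element of `B ⊗ B`. -/
abbrev Bal.mk (s t : L →ₗ[k] B) : B ⊗[k] B →ₗ[k] Bal s t := (balRel s t).mkQ

/-- The relations defining `B ⊗_L B ⊗_L B`. -/
def balRel₃ (s t : L →ₗ[k] B) : Submodule k (B ⊗[k] (B ⊗[k] B)) :=
  Submodule.span k
    ({z | ∃ (l : L) (a b c : B),
        z = (t l * a) ⊗ₜ[k] (b ⊗ₜ[k] c) - a ⊗ₜ[k] ((s l * b) ⊗ₜ[k] c)} ∪
      {z | ∃ (l : L) (a b c : B),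
        z = a ⊗ₜ[k] ((t l * b) ⊗ₜ[k] c) - a ⊗ₜ[k] (b ⊗ₜ[k] (s l * c))})

/-- The tensor product `B ⊗_L B ⊗_L B`. -/
abbrev Bal₃ (s t : L →ₗ[k] B) : Type _ := (B ⊗[k] (B ⊗[k] B)) ⧸ balRel₃ s t

variable (s t : L →ₗ[k] B)

theorem balRel_mul_mem {z : B ⊗[k] B} (hz : z ∈ balRel s t) (w : B ⊗[k] B) :
    z * w ∈ balRel s t := by
  induction hz using Submodule.span_induction with
  | zero => simp
  | add x y _ _ hx hy => rw [add_mul]; exact add_mem hx hy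
  | smul r x _ hx => rw [smul_mul_assoc]; exact Submodule.smul_mem _ _ hx
  | mem x hx =>
    obtain ⟨l, a, b, rfl⟩ := hx
    induction w using TensorProduct.induction_on with
    | zero => simp
    | add x y hx hy => rw [mul_add]; exact add_mem hx hy
    | tmul x y =>
      refine Submodule.subset_span ⟨l, a * x, b * y, ?_⟩
      simp [sub_mul, mul_assoc]

/-- The right action of `B ⊗ B` on `B ⊗_L B`: `Bal.rmul w z = z w`, that is
`z (a ⊗ b) = z₁ a ⊗_L z₂ b`. -/
def Bal.rmul (w : B ⊗[k] B) : Bal s t →ₗ[k] Bal s t :=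
  (balRel s t).mapQ (balRel s t) (LinearMap.mulRight k w)
    (fun _ hz => balRel_mul_mem s t hz w)

/-- The map `(x ⊗_L y, c) ↦ x ⊗_L y ⊗_L c`. -/
def glueRight : Bal s t →ₗ[k] B →ₗ[k] Bal₃ s t :=
  (balRel s t).liftQ
    ((LinearMap.llcomp k B (B ⊗[k] (B ⊗[k] B)) (Bal₃ s t) (balRel₃ s t).mkQ) ∘ₗ
      TensorProduct.curry (TensorProduct.assoc k B B B).toLinearMap)
    (Submodule.span_le.2 (by
      rintro _ ⟨l, a, b, rfl⟩
      rw [SetLike.mem_coe, LinearMap.mem_ker]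
      ext c
      rw [map_sub, LinearMap.sub_apply, LinearMap.zero_apply, sub_eq_zero]
      exact (Submodule.Quotient.eq _).2
        (Submodule.subset_span (Or.inl ⟨l, a, b, c, rfl⟩))))

/-- The map `(y ⊗_L c, a) ↦ a ⊗_L y ⊗_L c`. -/
def glueLeft : Bal s t →ₗ[k] B →ₗ[k] Bal₃ s t :=
  (balRel s t).liftQ
    ((LinearMap.llcomp k B (B ⊗[k] (B ⊗[k] B)) (Bal₃ s t) (balRel₃ s t).mkQ) ∘ₗ
      (TensorProduct.mk k B (B ⊗[k] B)).flip)
    (Submodule.span_le.2 (by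
      rintro _ ⟨l, b, c, rfl⟩
      rw [SetLike.mem_coe, LinearMap.mem_ker]
      ext a
      rw [map_sub, LinearMap.sub_apply, LinearMap.zero_apply, sub_eq_zero]
      refine (Submodule.Quotient.eq _).2
        (Submodule.subset_span (Or.inr ⟨l, a, b, c, rfl⟩))))

variable {s t}

/-- For `f : B → B ⊗_L B`, the map `a ⊗ b ↦ f(a) ⊗_L b` on `B ⊗ B`. -/
def applyFst (f : B →ₗ[k] Bal s t) : B ⊗[k] B →ₗ[k] Bal₃ s t :=
  TensorProduct.lift (glueRight s t ∘ₗ f)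

/-- For `f : B → B ⊗_L B`, the map `a ⊗ b ↦ a ⊗_L f(b)` on `B ⊗ B`. -/
def applySnd (f : B →ₗ[k] Bal s t) : B ⊗[k] B →ₗ[k] Bal₃ s t :=
  TensorProduct.lift (glueLeft s t ∘ₗ f).flip

end Balanced

/-- The structure maps of an `L`-bialgebroid `B`: source, target, coproduct and counit. -/
structure BialgebroidData (k L B : Type*) [CommRing k] [Ring L] [Algebra k L]
    [Ring B] [Algebra k B] where
  /-- source map -/
  s : L →ₗ[k] B
  /-- target map -/
  t : L →ₗ[k] B
  /-- coproduct -/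
  Δ : B →ₗ[k] Bal s t
  /-- counit -/
  ε : B →ₗ[k] L

namespace BialgebroidData

variable {k L B : Type*} [CommRing k] [Ring L] [Algebra k L] [Ring B] [Algebra k B]
  (D : BialgebroidData k L B)

/-- The class in `B ⊗_L B` of an element of `B ⊗ B`. -/
abbrev cls : B ⊗[k] B →ₗ[k] Bal D.s D.t := Bal.mk D.s D.t

/-- `a ⊗ b ↦ s(ε(a)) b`, inducing `ε ⊗_L id : B ⊗_L B → L ⊗_L B = B`. -/
def counitFst : B ⊗[k] B →ₗ[k] B :=
  TensorProduct.lift ((LinearMap.mul k B) ∘ₗ D.s ∘ₗ D.ε)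

/-- `a ⊗ b ↦ t(ε(b)) a`, inducing `id ⊗_L ε : B ⊗_L B → B ⊗_L L = B`. -/
def counitSnd : B ⊗[k] B →ₗ[k] B :=
  TensorProduct.lift ((LinearMap.mul k B) ∘ₗ D.t ∘ₗ D.ε).flip

/-- The anchor action `a ⊢ l = ε(a s(l))` of `B` on `L`. -/
def anchor : B →ₗ[k] L →ₗ[k] L :=
  ((LinearMap.mul k B).compl₂ D.s).compr₂ D.ε

/-- The axioms of a (left) `L`-bialgebroid. An element of `B ⊗_L B` enters a formula through an
arbitrary representative `z`, `w` in `B ⊗ B`, as in Sweedler notation. -/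
structure IsBialgebroid : Prop where
  s_one : D.s 1 = 1
  s_mul : ∀ l m, D.s (l * m) = D.s l * D.s m
  t_one : D.t 1 = 1
  t_mul : ∀ l m, D.t (l * m) = D.t m * D.t l
  s_mul_t : ∀ l m, D.s l * D.t m = D.t m * D.s l
  /-- `Δ` is a bimodule map. -/
  Δ_s_mul : ∀ l a z, D.cls z = D.Δ a → D.Δ (D.s l * a) = D.cls ((D.s l ⊗ₜ[k] 1) * z)
  Δ_t_mul : ∀ l a z, D.cls z = D.Δ a → D.Δ (D.t l * a) = D.cls ((1 ⊗ₜ[k] D.t l) * z)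
  /-- Coassociativity. -/
  coassoc : ∀ a z, D.cls z = D.Δ a → applyFst D.Δ z = applySnd D.Δ z
  /-- `Δ(a) (t(l) ⊗ 1) = Δ(a) (1 ⊗ s(l))`. -/
  takeuchi : ∀ a l, Bal.rmul D.s D.t (D.t l ⊗ₜ[k] 1) (D.Δ a) =
    Bal.rmul D.s D.t (1 ⊗ₜ[k] D.s l) (D.Δ a)
  Δ_one : D.Δ 1 = D.cls 1
  /-- `Δ(a b) = Δ(a) Δ(b)`. -/
  Δ_mul : ∀ a b w, D.cls w = D.Δ b → D.Δ (a * b) = Bal.rmul D.s D.t w (D.Δ a)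
  /-- `ε` is a bimodule map. -/
  ε_s_mul : ∀ l a, D.ε (D.s l * a) = l * D.ε a
  ε_t_mul : ∀ l a, D.ε (D.t l * a) = D.ε a * l
  ε_one : D.ε 1 = 1
  ε_mul_s : ∀ a b, D.ε (a * D.s (D.ε b)) = D.ε (a * b)
  ε_mul_t : ∀ a b, D.ε (a * D.t (D.ε b)) = D.ε (a * b)
  /-- `(ε ⊗_L id) Δ = id`. -/
  counit_fst : ∀ a z, D.cls z = D.Δ a → D.counitFst z = a
  /-- `(id ⊗_L ε) Δ = id`. -/
  counit_snd : ∀ a z, D.cls z = D.Δ a → D.counitSnd z = a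

/-- `Ψ ∈ B ⊗_L B` is a twisting cocycle:
`Δ(Ψ₁) Ψ ⊗_L Ψ₂ = Ψ₁ ⊗_L Δ(Ψ₂) Ψ` in `B ⊗_L B ⊗_L B`, and
`(ε ⊗_L id)(Ψ) = 1 = (id ⊗_L ε)(Ψ)`. Representatives `z`, `w` of `Ψ` are arbitrary. -/
structure IsTwistingCocycle (Ψ : Bal D.s D.t) : Prop where
  cocycle : ∀ z w, D.cls z = Ψ → D.cls w = Ψ →
    applyFst (Bal.rmul D.s D.t w ∘ₗ D.Δ) z = applySnd (Bal.rmul D.s D.t w ∘ₗ D.Δ) z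
  counit_fst : ∀ z, D.cls z = Ψ → D.counitFst z = 1
  counit_snd : ∀ z, D.cls z = Ψ → D.counitSnd z = 1

/-- `Φ` is the inverse of `Ψ`, where `Ψ ∈ B ⊗_L B` is formed with source and target maps `s`, `t`
and `Φ ∈ B ⊗_L' B` with `s'`, `t'`: for all representatives `z` of `Ψ` and `w` of `Φ` one has
`Ψ w = 1 ⊗_L 1` and `Φ z = 1 ⊗_L' 1`. -/
def IsInverse {s t s' t' : L →ₗ[k] B} (Ψ : Bal s t) (Φ : Bal s' t') : Prop :=
  (∀ w, Bal.mk s' t' w = Φ → Bal.rmul s t w Ψ = Bal.mk s t 1) ∧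
  (∀ z, Bal.mk s t z = Ψ → Bal.rmul s' t' z Φ = Bal.mk s' t' 1)

/-- `D'` is the twist of `D` by `Ψ`, with `Φ` the inverse of `Ψ`. The new product
`l * m = (Ψ₁ ⊢ l) (Ψ₂ ⊢ m)` on `L`, which in general defines another base algebra, is required
here to be the given product of `L`. The other structure maps of the twist are
`s'(l) = s(Ψ₁ ⊢ l) Ψ₂`, `t'(l) = t(Ψ₂ ⊢ l) Ψ₁`, `Δ'(a) = Φ Δ(a) Ψ` and `ε' = ε`.
Representatives `z` of `Ψ` and `w` of `Δ(a)` are arbitrary. -/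
structure IsTwist (Ψ : Bal D.s D.t) (D' : BialgebroidData k L B) (Φ : Bal D'.s D'.t) :
    Prop where
  base : ∀ z, D.cls z = Ψ → ∀ l m,
    LinearMap.mul' k L (TensorProduct.map (D.anchor.flip l) (D.anchor.flip m) z) = l * m
  source : ∀ z, D.cls z = Ψ → ∀ l, D'.s l =
    TensorProduct.lift (LinearMap.mul k B ∘ₗ D.s ∘ₗ D.anchor.flip l) z
  target : ∀ z, D.cls z = Ψ → ∀ l, D'.t l =
    TensorProduct.lift (LinearMap.mul k B ∘ₗ D.t ∘ₗ D.anchor.flip l).flip z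
  inverse : IsInverse Ψ Φ
  coproduct : ∀ z, D.cls z = Ψ → ∀ a w, D.cls w = D.Δ a →
    D'.Δ a = Bal.rmul D'.s D'.t (w * z) Φ
  counit : D'.ε = D.ε

variable (U : Type*) [Ring U] [Bialgebra k U]

/-- The source (or target) map `l ↦ 1 ⊗ f(l)` of `U ⊗ B`. -/
abbrev tensorMap (f : L →ₗ[k] B) : L →ₗ[k] U ⊗[k] B := TensorProduct.mk k U B 1 ∘ₗ f

/-- The interchange map `(x ⊗_L y, u ⊗ v) ↦ (u ⊗ x) ⊗_L (v ⊗ y)`. -/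
def interchange (s t : L →ₗ[k] B) :
    Bal s t →ₗ[k] U ⊗[k] U →ₗ[k] Bal (tensorMap U s) (tensorMap U t) :=
  (balRel s t).liftQ
    ((LinearMap.llcomp k (U ⊗[k] U) ((U ⊗[k] B) ⊗[k] (U ⊗[k] B))
        (Bal (tensorMap U s) (tensorMap U t)) (Bal.mk _ _)) ∘ₗ
      (TensorProduct.curry (TensorProduct.tensorTensorTensorComm k U U B B).toLinearMap).flip)
    (Submodule.span_le.2 (by
      rintro _ ⟨l, a, b, rfl⟩
      rw [SetLike.mem_coe, LinearMap.mem_ker]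
      ext u v
      refine (Submodule.Quotient.mk_eq_zero _).2
        (Submodule.subset_span ⟨l, u ⊗ₜ a, v ⊗ₜ b, ?_⟩)
      simp))

/-- The tensor product of a bialgebra `U` (a bialgebroid over `k`) and a bialgebroid `B` over `L`,
as a bialgebroid over `L`:
`Δ(u ⊗ b) = (u₁ ⊗ b₁) ⊗_L (u₂ ⊗ b₂)` and `ε(u ⊗ b) = ε(u) ε(b)`. -/
def tensor : BialgebroidData k L (U ⊗[k] B) where
  s := tensorMap U D.s
  t := tensorMap U D.t
  Δ := TensorProduct.lift
    ((interchange U D.s D.t ∘ₗ D.Δ).flip ∘ₗ Coalgebra.comul)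
  ε := TensorProduct.lift
    ((LinearMap.lsmul k L).compl₁₂ Coalgebra.counit D.ε)

end BialgebroidData

/-! ## Dynamical cocycles -/

section Dynamical

variable {k H U L : Type*} [CommRing k] [Ring H] [Bialgebra k H] [Ring U] [Bialgebra k U]
  [Ring L] [Algebra k L] [Module H L] [IsScalarTower k H L]

/-- For `h₁ ⊗ h₂ ⊗ h₃` and `u ⊗ v ⊗ l`, the element `h₁ u ⊗ h₂ v ⊗ (h₃ ▷ l)`. -/
def leftAct₃ (L : Type*) [Ring L] [Algebra k L] [Module H L] [IsScalarTower k H L]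
    (ι : H →ₐc[k] U) :
    H ⊗[k] (H ⊗[k] H) →ₗ[k] U ⊗[k] (U ⊗[k] L) →ₗ[k] U ⊗[k] (U ⊗[k] L) :=
  TensorProduct.map₂ (LinearMap.mul k U ∘ₗ (ι : H →ₗ[k] U))
    (TensorProduct.map₂ (LinearMap.mul k U ∘ₗ (ι : H →ₗ[k] U)) (actMap k H L))

/-- For `h₁ ⊗ h₂`, the element `ι(h₁) ⊗ ι(h₂) ⊗ 1`. -/
def embed₂ (L : Type*) [Ring L] [Algebra k L] (ι : H →ₐc[k] U) :
    H ⊗[k] H →ₗ[k] U ⊗[k] (U ⊗[k] L) :=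
  TensorProduct.map (ι : H →ₗ[k] U)
    ((TensorProduct.mk k U L).flip 1 ∘ₗ (ι : H →ₗ[k] U))

variable (k U L) in
/-- `Δ ⊗ id : U ⊗ X → U ⊗ U ⊗ X`. -/
def comulFst (X : Type*) [AddCommGroup X] [Module k X] :
    U ⊗[k] X →ₗ[k] U ⊗[k] (U ⊗[k] X) :=
  (TensorProduct.assoc k U U X).toLinearMap ∘ₗ LinearMap.rTensor X Coalgebra.comul

variable (k U) in
/-- `ε ⊗ id : U ⊗ X → X`. -/
def counitFst (X : Type*) [AddCommGroup X] [Module k X] : U ⊗[k] X →ₗ[k] X :=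
  (TensorProduct.lid k X).toLinearMap ∘ₗ LinearMap.rTensor X Coalgebra.counit

/-- `F ∈ U ⊗ U ⊗ L` is a universal dynamical cocycle over the `H`-base algebra `L` with coaction
`δ : L → H ⊗ L`, where the Hopf algebra map `ι : H → U` is the inclusion. -/
structure IsDynamicalCocycle (ι : H →ₐc[k] U) (δ : L →ₗ[k] H ⊗[k] L)
    (F : U ⊗[k] (U ⊗[k] L)) : Prop where
  isUnit : IsUnit F
  /-- `h₁ F₁ ⊗ h₂ F₂ ⊗ (h₃ ▷ F₃) = F₁ h₁ ⊗ F₂ h₂ ⊗ F₃`. -/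
  invariant : ∀ h : H,
    leftAct₃ L ι (LinearMap.lTensor H Coalgebra.comul (Coalgebra.comul h)) F =
      F * embed₂ L ι (Coalgebra.comul h)
  /-- `(Δ ⊗ id ⊗ id)(F) (F₁ ⊗ F₂ ⊗ δ(F₃)) = (id ⊗ Δ ⊗ id)(F) (1 ⊗ F)` in `U ⊗ U ⊗ U ⊗ L`. -/
  cocycle :
    comulFst k U (U ⊗[k] L) F *
        LinearMap.lTensor U (LinearMap.lTensor U (LinearMap.rTensor L (ι : H →ₗ[k] U) ∘ₗ δ)) F =
      LinearMap.lTensor U (comulFst k U L) F * (1 : U) ⊗ₜ[k] F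
  counit_fst : counitFst k U (U ⊗[k] L) F = 1
  counit_snd : LinearMap.lTensor U (counitFst k U L) F = 1

end Dynamical

/-! ## The bialgebroid `U ⊗ (L₊ ⋊ H)` and its twist -/

section Twist

variable {k H U L : Type*} [CommRing k] [Ring H] [Bialgebra k H] [Ring U] [Bialgebra k U]
  [Ring L] [Algebra k L] [Module H L] [IsScalarTower k H L] [IsModuleAlgebra k H L]

variable (k H L) in
/-- The source map `s(l) = l ⊗ 1` of `L₊ ⋊ H`. -/
def smashSource : L →ₗ[k] Smash k H L :=
  (Smash.of k H L).toLinearMap ∘ₗ (TensorProduct.mk k L H).flip 1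

variable (L) in
/-- The target map `t⁺(l) = (R₂ ▷ l) ⊗ R₁` of `L₊ ⋊ H`. -/
def smashTarget (R : H ⊗[k] H) : L →ₗ[k] Smash k H L :=
  (Smash.of k H L).toLinearMap ∘ₗ
    (TensorProduct.comm k H L).toLinearMap ∘ₗ
      (LinearMap.lTensorHom H ∘ₗ (actMap k H L).flip).flip R

variable (k H L) in
/-- The map `l ⊗ h ↦ (l ⊗ h₁) ⊗ (1 ⊗ h₂)`. -/
def smashComul : Smash k H L →ₗ[k] Smash k H L ⊗[k] Smash k H L :=
  TensorProduct.map (Smash.of k H L).toLinearMap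
      ((Smash.of k H L).toLinearMap ∘ₗ TensorProduct.mk k L H 1) ∘ₗ
    (TensorProduct.assoc k L H H).symm.toLinearMap ∘ₗ LinearMap.lTensor L Coalgebra.comul ∘ₗ
    (Smash.of k H L).symm.toLinearMap

variable (k H L) in
/-- The counit `ε(l ⊗ h) = l ε(h)` of `L₊ ⋊ H`. -/
def smashCounit : Smash k H L →ₗ[k] L :=
  TensorProduct.lift ((LinearMap.lsmul k L).flip.compl₂ Coalgebra.counit) ∘ₗ
    (Smash.of k H L).symm.toLinearMap

variable (L) in
/-- The bialgebroid `L₊ ⋊ H`: `s(l) = l ⊗ 1`, `t(l) = (R₂ ▷ l) ⊗ R₁`,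
`Δ(l ⊗ h) = (l ⊗ h₁) ⊗_L (1 ⊗ h₂)`, `ε(l ⊗ h) = l ε(h)`. -/
def smashPlus (R : H ⊗[k] H) : BialgebroidData k L (Smash k H L) where
  s := smashSource k H L
  t := smashTarget L R
  Δ := Bal.mk _ _ ∘ₗ smashComul k H L
  ε := smashCounit k H L

variable (U L) in
/-- The tensor product bialgebroid `U ⊗ (L₊ ⋊ H)`. -/
def tensorSmash (R : H ⊗[k] H) : BialgebroidData k L (U ⊗[k] Smash k H L) :=
  (smashPlus L R).tensor U

/-- The representative `(F₁ ⊗ F₃ ⊗ R₁) ⊗ (F₂ R₂ ⊗ 1 ⊗ 1)` of the twist. -/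
def twistRep (ι : H →ₐc[k] U) (F : U ⊗[k] (U ⊗[k] L)) (R : H ⊗[k] H) :
    (U ⊗[k] Smash k H L) ⊗[k] (U ⊗[k] Smash k H L) :=
  TensorProduct.map₂
    ((TensorProduct.mk k (U ⊗[k] L) H).compr₂
      (LinearMap.lTensor U (Smash.of k H L).toLinearMap ∘ₗ
        (TensorProduct.assoc k U L H).toLinearMap))
    (((LinearMap.mul k U).compl₂ (ι : H →ₗ[k] U)).compr₂
      ((TensorProduct.mk k U (Smash k H L)).flip 1))
    ((TensorProduct.assoc k U L U).symm
      (LinearMap.lTensor U (TensorProduct.comm k U L).toLinearMap F)) R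

theorem twistRep_tmul (ι : H →ₐc[k] U) (u v : U) (l : L) (x y : H) :
    twistRep ι (u ⊗ₜ[k] (v ⊗ₜ[k] l)) (x ⊗ₜ[k] y) =
      (u ⊗ₜ[k] Smash.of k H L (l ⊗ₜ[k] x)) ⊗ₜ[k] ((v * ι y) ⊗ₜ[k] 1) := rfl

/-- The element `Ψ = (F₁ ⊗ F₃ ⊗ R₁) ⊗_L (F₂ R₂ ⊗ 1 ⊗ 1)`. -/
def twistElement (ι : H →ₐc[k] U) (F : U ⊗[k] (U ⊗[k] L)) (R : H ⊗[k] H) :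
    Bal (tensorSmash U L R).s (tensorSmash U L R).t :=
  (tensorSmash U L R).cls (twistRep ι F R)

/-- The source map `l ↦ R₂ ⊗ (R₁ ▷ l) ⊗ 1` of the twisted bialgebroid. -/
def twistedSource (ι : H →ₐc[k] U) (R : H ⊗[k] H) : L →ₗ[k] U ⊗[k] Smash k H L :=
  TensorProduct.map (ι : H →ₗ[k] U) (smashSource k H L) ∘ₗ coactionMinus L R

theorem smashTarget_tmul (x y : H) (l : L) :
    smashTarget L (x ⊗ₜ[k] y) l = Smash.of k H L ((y • l) ⊗ₜ[k] x) := rfl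

theorem smashComul_of (l : L) (h : H) :
    smashComul k H L (Smash.of k H L (l ⊗ₜ[k] h)) =
      TensorProduct.map ((Smash.of k H L).toLinearMap ∘ₗ TensorProduct.mk k L H l)
        ((Smash.of k H L).toLinearMap ∘ₗ TensorProduct.mk k L H 1) (Coalgebra.comul h) := by
  simp only [smashComul, LinearMap.comp_apply, LinearEquiv.coe_coe, LinearEquiv.symm_apply_apply,
    LinearMap.lTensor_tmul]
  induction (Coalgebra.comul h : H ⊗[k] H) using TensorProduct.induction_on with
  | zero => simp
  | add x y hx hy => simp only [map_add, TensorProduct.tmul_add, hx, hy]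
  | tmul x y => simp

theorem smashCounit_of (l : L) (h : H) :
    smashCounit k H L (Smash.of k H L (l ⊗ₜ[k] h)) = (Coalgebra.counit h : k) • l := rfl

theorem tensorSmash_Δ (R : H ⊗[k] H) (u : U) (b : Smash k H L) :
    (tensorSmash U L R).Δ (u ⊗ₜ[k] b) = (tensorSmash U L R).cls
      (TensorProduct.tensorTensorTensorComm k U U (Smash k H L) (Smash k H L)
        (Coalgebra.comul u ⊗ₜ[k] smashComul k H L b)) := rfl

theorem twistedSource_tmul (ι : H →ₐc[k] U) (x y : H) (l : L) :
    twistedSource ι (x ⊗ₜ[k] y) l = ι y ⊗ₜ[k] Smash.of k H L ((x • l) ⊗ₜ[k] 1) := rfl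

end Twist

end

/-! The space B ⊗_L B is only a right module over B ⊗ B, so a product such as Ψ⁻¹Δ(a)Ψ has no direct
meaning there. What makes the theorem work is that Ψ has a representative P that is invertible in
the ordinary algebra B ⊗ B. It is the product of the images of F and R under the algebra
homomorphisms u ⊗ v ⊗ l ↦ (u ⊗ l) ⊗ (v ⊗ 1) and x ⊗ y ↦ (1 ⊗ x) ⊗ (y ⊗ 1), and both F and R are
units. The coproduct of B also lifts to a linear map d : B → B ⊗ B. Hence the twisted coproduct is
the class of P⁻¹ d(a) P, the inverse of Ψ is the class of P⁻¹, and every axiom becomes a congruence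
in a tensor power of B modulo the relations of the balanced tensor product.

These relations form the right ideal generated by t(l) ⊗ 1 - 1 ⊗ s(l). It therefore suffices to see
that left multiplication by P carries the generators for s̃, t̃ into the ideal for s, t, and that
P⁻¹ does the converse. The general twisting argument is `twistLift_coassoc` and
`isLiftedBialgebroid_twist`; it needs only the conditions collected in `IsTwistLift`.

Those conditions are then verified for P. The formula for (Δ ⊗ id)(R) turns P(t(l) ⊗ 1 - 1 ⊗ s̃(l))
into a combination of the untwisted generators (`rMatrixHom_mul_gen`), and invertibility of R gives
the reverse inclusion. Equivariance of F together with H-commutativity of L gives d(s̃(l)) P =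
P(s̃(l) ⊗ 1) exactly (`d_sourceMap_mul`). For the cocycle identity (`IsSmashBialgebroid.cocycle`),
moving R₁₃ past F₁₂ produces the coaction δ⁻ on F₃, the dynamical cocycle equation applies, and what
remains is equivariance of F evaluated on (id ⊗ Δ)(R). Only this last step uses the relations of B
⊗_L B ⊗_L B, to carry F₃ from the second leg to the first through the target map.

Sweedler computations with several copies of R are done with independent elements S, T of H ⊗ H, by
linearity in each, and specialised to S = T = R at the end. The twist computations use only the
relations listed in `IsSmashBialgebroid`, so they take place in an arbitrary algebra A receiving L
and H. -/

noncomputable section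

/-! ### Balanced tensor products as quotients by right ideals -/

section Balanced

variable {k L B : Type*} [CommRing k] [Ring L] [Algebra k L] [Ring B] [Algebra k B]

/-- For `f : B → B ⊗ B`, the map `x ⊗ y ↦ f(x) ⊗ y` with values in `B ⊗ B ⊗ B`. -/
def lift₁ (f : B →ₗ[k] B ⊗[k] B) : B ⊗[k] B →ₗ[k] B ⊗[k] (B ⊗[k] B) :=
  (TensorProduct.assoc k B B B).toLinearMap ∘ₗ LinearMap.rTensor B f

/-- For `f : B → B ⊗ B`, the map `x ⊗ y ↦ x ⊗ f(y)`. -/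
def lift₂ (f : B →ₗ[k] B ⊗[k] B) : B ⊗[k] B →ₗ[k] B ⊗[k] (B ⊗[k] B) :=
  LinearMap.lTensor B f

/-- The algebra homomorphism `x ⊗ y ↦ x ⊗ y ⊗ 1`. -/
def inl₁₂ : B ⊗[k] B →ₐ[k] B ⊗[k] (B ⊗[k] B) :=
  (Algebra.TensorProduct.assoc k k k B B B).toAlgHom.comp Algebra.TensorProduct.includeLeft

/-- The algebra homomorphism `x ⊗ y ↦ 1 ⊗ x ⊗ y`. -/
def inr₂₃ : B ⊗[k] B →ₐ[k] B ⊗[k] (B ⊗[k] B) :=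
  Algebra.TensorProduct.includeRight

theorem inl₁₂_tmul (x y : B) : inl₁₂ (x ⊗ₜ[k] y) = x ⊗ₜ (y ⊗ₜ 1) := rfl

theorem inr₂₃_apply (x : B ⊗[k] B) : inr₂₃ x = 1 ⊗ₜ x := rfl

theorem lift₁_tmul (f : B →ₗ[k] B ⊗[k] B) (x y : B) :
    lift₁ f (x ⊗ₜ y) = inl₁₂ (f x) * (1 ⊗ₜ (1 ⊗ₜ y)) := by
  change TensorProduct.assoc k B B B (f x ⊗ₜ y) = _
  induction f x using TensorProduct.induction_on with
  | zero => simp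
  | add a b ha hb => simp only [map_add, TensorProduct.add_tmul, add_mul, ha, hb]
  | tmul a b => simp [inl₁₂_tmul]

theorem lift₂_tmul (f : B →ₗ[k] B ⊗[k] B) (x y : B) :
    lift₂ f (x ⊗ₜ y) = (x ⊗ₜ 1) * inr₂₃ (f y) := by
  simp [lift₂, inr₂₃_apply]

theorem inl₁₂_mul_comm (w : B ⊗[k] B) (y : B) :
    (1 ⊗ₜ (1 ⊗ₜ y)) * inl₁₂ w = inl₁₂ w * (1 ⊗ₜ (1 ⊗ₜ y) : B ⊗[k] (B ⊗[k] B)) := by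
  induction w using TensorProduct.induction_on with
  | zero => simp
  | add a b ha hb => simp only [map_add, add_mul, mul_add, ha, hb]
  | tmul a b => simp [inl₁₂_tmul]

theorem inr₂₃_mul_comm (w : B ⊗[k] B) (x : B) :
    inr₂₃ w * (x ⊗ₜ 1 : B ⊗[k] (B ⊗[k] B)) = (x ⊗ₜ 1) * inr₂₃ w := by
  simp [inr₂₃_apply]

theorem lift₁_mulLeft (f : B →ₗ[k] B ⊗[k] B) (p w : B ⊗[k] B) :
    lift₁ (LinearMap.mulLeft k p ∘ₗ f) w = inl₁₂ p * lift₁ f w := by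
  induction w using TensorProduct.induction_on with
  | zero => simp
  | add a b ha hb => simp only [map_add, mul_add, ha, hb]
  | tmul a b => simp [lift₁_tmul, mul_assoc]

theorem lift₁_mulRight (f : B →ₗ[k] B ⊗[k] B) (p w : B ⊗[k] B) :
    lift₁ (LinearMap.mulRight k p ∘ₗ f) w = lift₁ f w * inl₁₂ p := by
  induction w using TensorProduct.induction_on with
  | zero => simp
  | add a b ha hb => simp only [map_add, add_mul, ha, hb]
  | tmul a b => simp [lift₁_tmul, mul_assoc, inl₁₂_mul_comm]

theorem lift₂_mulLeft (f : B →ₗ[k] B ⊗[k] B) (p w : B ⊗[k] B) :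
    lift₂ (LinearMap.mulLeft k p ∘ₗ f) w = inr₂₃ p * lift₂ f w := by
  induction w using TensorProduct.induction_on with
  | zero => simp
  | add a b ha hb => simp only [map_add, mul_add, ha, hb]
  | tmul a b => simp only [lift₂_tmul, LinearMap.comp_apply, LinearMap.mulLeft_apply, map_mul,
      ← mul_assoc, inr₂₃_mul_comm]

theorem lift₂_mulRight (f : B →ₗ[k] B ⊗[k] B) (p w : B ⊗[k] B) :
    lift₂ (LinearMap.mulRight k p ∘ₗ f) w = lift₂ f w * inr₂₃ p := by
  induction w using TensorProduct.induction_on with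
  | zero => simp
  | add a b ha hb => simp only [map_add, add_mul, ha, hb]
  | tmul a b => simp [lift₂_tmul, mul_assoc]

variable {s t s' t' : L →ₗ[k] B}

theorem Bal.mk_eq_mk_iff {x y : B ⊗[k] B} :
    Bal.mk s t x = Bal.mk s t y ↔ x - y ∈ balRel s t := by
  simp only [Submodule.mkQ_apply, Submodule.Quotient.eq]

theorem Bal.rmul_mk (w z : B ⊗[k] B) : Bal.rmul s t w (Bal.mk s t z) = Bal.mk s t (z * w) := rfl

theorem balRel_gen_mem (s t : L →ₗ[k] B) (l : L) :
    (t l ⊗ₜ 1 - 1 ⊗ₜ s l : B ⊗[k] B) ∈ balRel s t :=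
  Submodule.subset_span ⟨l, 1, 1, by simp⟩

/-- The relations form the right ideal generated by the elements t(l) ⊗ 1 - 1 ⊗ s(l), so a left
multiplication need only be tested on these generators. -/
theorem mul_balRel_mem {x : B ⊗[k] B}
    (h : ∀ l, x * (t l ⊗ₜ 1 - 1 ⊗ₜ s l) ∈ balRel s' t') {z : B ⊗[k] B}
    (hz : z ∈ balRel s t) : x * z ∈ balRel s' t' := by
  induction hz using Submodule.span_induction with
  | zero => simp
  | add a b _ _ ha hb => rw [mul_add]; exact add_mem ha hb
  | smul r a _ ha => rw [mul_smul_comm]; exact Submodule.smul_mem _ _ ha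
  | mem z hz =>
    obtain ⟨l, a, b, rfl⟩ := hz
    have := balRel_mul_mem s' t' (h l) (a ⊗ₜ b)
    simpa [mul_assoc, sub_mul] using this

theorem inl₁₂_mem {z : B ⊗[k] B} (hz : z ∈ balRel s t) (y : B) :
    inl₁₂ z * (1 ⊗ₜ (1 ⊗ₜ y)) ∈ balRel₃ s t := by
  induction hz using Submodule.span_induction with
  | zero => simp
  | add a b _ _ ha hb => rw [map_add, add_mul]; exact add_mem ha hb
  | smul r a _ ha => rw [map_smul, smul_mul_assoc]; exact Submodule.smul_mem _ _ ha
  | mem z hz =>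
    obtain ⟨l, a, b, rfl⟩ := hz
    exact Submodule.subset_span (Or.inl ⟨l, a, b, y, by simp [inl₁₂_tmul, sub_mul]⟩)

theorem inr₂₃_mem {z : B ⊗[k] B} (hz : z ∈ balRel s t) (x : B) :
    (x ⊗ₜ 1) * inr₂₃ z ∈ balRel₃ s t := by
  induction hz using Submodule.span_induction with
  | zero => simp
  | add a b _ _ ha hb => rw [map_add, mul_add]; exact add_mem ha hb
  | smul r a _ ha => rw [map_smul, mul_smul_comm]; exact Submodule.smul_mem _ _ ha
  | mem z hz =>
    obtain ⟨l, a, b, rfl⟩ := hz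
    exact Submodule.subset_span
      (Or.inr ⟨l, x, a, b, by
        simp [inr₂₃_apply, TensorProduct.tmul_sub, mul_sub]⟩)

theorem balRel₃_mul_mem {z : B ⊗[k] (B ⊗[k] B)} (hz : z ∈ balRel₃ s t)
    (w : B ⊗[k] (B ⊗[k] B)) : z * w ∈ balRel₃ s t := by
  induction hz using Submodule.span_induction with
  | zero => simp
  | add x y _ _ hx hy => rw [add_mul]; exact add_mem hx hy
  | smul r x _ hx => rw [smul_mul_assoc]; exact Submodule.smul_mem _ _ hx
  | mem x hx =>
    induction w using TensorProduct.induction_on with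
    | zero => simp
    | add x y hx hy => rw [mul_add]; exact add_mem hx hy
    | tmul a' w =>
    induction w using TensorProduct.induction_on with
    | zero => simp
    | add x y hx hy => rw [TensorProduct.tmul_add, mul_add]; exact add_mem hx hy
    | tmul b' c' =>
      obtain ⟨l, a, b, c, rfl⟩ | ⟨l, a, b, c, rfl⟩ := hx
      · exact Submodule.subset_span (Or.inl ⟨l, a * a', b * b', c * c', by
          simp [sub_mul, mul_assoc]⟩)
      · exact Submodule.subset_span (Or.inr ⟨l, a * a', b * b', c * c', by
          simp [sub_mul, mul_assoc]⟩)

theorem mul_balRel₃_mem {x : B ⊗[k] (B ⊗[k] B)}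
    (h₁ : ∀ l, x * inl₁₂ (t l ⊗ₜ 1 - 1 ⊗ₜ s l) ∈ balRel₃ s' t')
    (h₂ : ∀ l, x * inr₂₃ (t l ⊗ₜ 1 - 1 ⊗ₜ s l) ∈ balRel₃ s' t') {z : B ⊗[k] (B ⊗[k] B)}
    (hz : z ∈ balRel₃ s t) : x * z ∈ balRel₃ s' t' := by
  induction hz using Submodule.span_induction with
  | zero => simp
  | add a b _ _ ha hb => rw [mul_add]; exact add_mem ha hb
  | smul r a _ ha => rw [mul_smul_comm]; exact Submodule.smul_mem _ _ ha
  | mem z hz =>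
    obtain ⟨l, a, b, c, rfl⟩ | ⟨l, a, b, c, rfl⟩ := hz
    · have := balRel₃_mul_mem (h₁ l) (a ⊗ₜ (b ⊗ₜ c))
      simpa [mul_assoc, sub_mul, inl₁₂_tmul, Algebra.TensorProduct.one_def] using this
    · have := balRel₃_mul_mem (h₂ l) (a ⊗ₜ (b ⊗ₜ c))
      simpa [mul_assoc, sub_mul, inr₂₃_apply, TensorProduct.tmul_sub] using this

theorem lift₁_mem {f : B →ₗ[k] B ⊗[k] B} (hf : ∀ x, f x ∈ balRel s t) (w : B ⊗[k] B) :
    lift₁ f w ∈ balRel₃ s t := by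
  induction w using TensorProduct.induction_on with
  | zero => simp
  | add a b ha hb => rw [map_add]; exact add_mem ha hb
  | tmul a b => rw [lift₁_tmul]; exact inl₁₂_mem (hf a) b

/-- `lift₁ f` is compatible with products when `f` is, up to the relations of `B ⊗_L B`. -/
theorem lift₁_mul_sub_mem {f g h : B →ₗ[k] B ⊗[k] B}
    (H : ∀ x y, f (x * y) - g x * h y ∈ balRel s t) (z w : B ⊗[k] B) :
    lift₁ f (z * w) - lift₁ g z * lift₁ h w ∈ balRel₃ s t := by
  induction z using TensorProduct.induction_on with
  | zero => simp
  | add a b ha hb =>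
    simp only [map_add, add_mul]; rw [add_sub_add_comm]; exact add_mem ha hb
  | tmul a b =>
  induction w using TensorProduct.induction_on with
  | zero => simp
  | add a b ha hb =>
    simp only [map_add, mul_add]; rw [add_sub_add_comm]; exact add_mem ha hb
  | tmul c d =>
    have := inl₁₂_mem (H a c) (b * d)
    have e : (1 ⊗ₜ (1 ⊗ₜ (b * d)) : B ⊗[k] (B ⊗[k] B)) = (1 ⊗ₜ (1 ⊗ₜ b)) * (1 ⊗ₜ (1 ⊗ₜ d)) := by
      simp
    rw [Algebra.TensorProduct.tmul_mul_tmul, lift₁_tmul, lift₁_tmul, lift₁_tmul, mul_assoc,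
      ← mul_assoc (1 ⊗ₜ (1 ⊗ₜ b)), inl₁₂_mul_comm, mul_assoc, ← e, ← mul_assoc, ← map_mul,
      ← sub_mul, ← map_sub]
    exact this

theorem lift₂_mul_sub_mem {f g h : B →ₗ[k] B ⊗[k] B}
    (H : ∀ x y, f (x * y) - g x * h y ∈ balRel s t) (z w : B ⊗[k] B) :
    lift₂ f (z * w) - lift₂ g z * lift₂ h w ∈ balRel₃ s t := by
  induction z using TensorProduct.induction_on with
  | zero => simp
  | add a b ha hb =>
    simp only [map_add, add_mul]; rw [add_sub_add_comm]; exact add_mem ha hb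
  | tmul a b =>
  induction w using TensorProduct.induction_on with
  | zero => simp
  | add a b ha hb =>
    simp only [map_add, mul_add]; rw [add_sub_add_comm]; exact add_mem ha hb
  | tmul c d =>
    have := inr₂₃_mem (H b d) (a * c)
    rw [Algebra.TensorProduct.tmul_mul_tmul, lift₂_tmul, lift₂_tmul, lift₂_tmul, mul_assoc,
      ← mul_assoc (inr₂₃ _), inr₂₃_mul_comm, mul_assoc, ← map_mul, ← mul_assoc,
      Algebra.TensorProduct.tmul_mul_tmul, one_mul, ← mul_sub, ← map_sub]
    exact this

/-- Modulo relations, f(t(l)a) ⊗ b becomes (1 ⊗ t(l)) f(a) ⊗ b; the relation between the second and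
third legs then moves t(l) across as s(l), giving f(a) ⊗ s(l)b. This makes f ⊗ id well defined on B
⊗_L B. -/
theorem lift₁_balRel_mem {f : B →ₗ[k] B ⊗[k] B}
    (H : ∀ l a, f (t l * a) - (1 ⊗ₜ t l) * f a ∈ balRel s t) {z : B ⊗[k] B}
    (hz : z ∈ balRel s t) : lift₁ f z ∈ balRel₃ s t := by
  induction hz using Submodule.span_induction with
  | zero => simp
  | add a b _ _ ha hb => rw [map_add]; exact add_mem ha hb
  | smul r a _ ha => rw [map_smul]; exact Submodule.smul_mem _ _ ha
  | mem z hz =>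
    obtain ⟨l, a, b, rfl⟩ := hz
    have h1 := inl₁₂_mem (H l a) b
    have h2 : inr₂₃ (t l ⊗ₜ 1 - 1 ⊗ₜ s l) * (inl₁₂ (f a) * (1 ⊗ₜ (1 ⊗ₜ b))) ∈ balRel₃ s t := by
      refine balRel₃_mul_mem ?_ _
      simpa [Algebra.TensorProduct.one_def.symm] using inr₂₃_mem (balRel_gen_mem s t l) 1
    have h3 := add_mem h1 h2
    have e1 : inr₂₃ (t l ⊗ₜ 1) = inl₁₂ (1 ⊗ₜ[k] t l) := rfl
    have e2 : inr₂₃ (1 ⊗ₜ s l) * (inl₁₂ (f a) * (1 ⊗ₜ (1 ⊗ₜ b))) =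
        inl₁₂ (f a) * (1 ⊗ₜ[k] (1 ⊗ₜ[k] (s l * b))) := by
      rw [inr₂₃_apply, ← mul_assoc, inl₁₂_mul_comm, mul_assoc]; simp
    rw [map_sub inr₂₃, sub_mul _ _ (inl₁₂ (f a) * _), e1, e2, map_sub inl₁₂, map_mul inl₁₂,
      sub_mul] at h3
    rw [map_sub, lift₁_tmul, lift₁_tmul]
    convert h3 using 1
    noncomm_ring

theorem lift₂_balRel_mem {f : B →ₗ[k] B ⊗[k] B}
    (H : ∀ l a, f (s l * a) - (s l ⊗ₜ 1) * f a ∈ balRel s t) {z : B ⊗[k] B}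
    (hz : z ∈ balRel s t) : lift₂ f z ∈ balRel₃ s t := by
  induction hz using Submodule.span_induction with
  | zero => simp
  | add a b _ _ ha hb => rw [map_add]; exact add_mem ha hb
  | smul r a _ ha => rw [map_smul]; exact Submodule.smul_mem _ _ ha
  | mem z hz =>
    obtain ⟨l, a, b, rfl⟩ := hz
    have h1 := inr₂₃_mem (H l b) a
    have h2 : inl₁₂ (t l ⊗ₜ 1 - 1 ⊗ₜ s l) * ((a ⊗ₜ 1) * inr₂₃ (f b)) ∈ balRel₃ s t := by
      refine balRel₃_mul_mem ?_ _
      simpa [Algebra.TensorProduct.one_def.symm] using inl₁₂_mem (balRel_gen_mem s t l) 1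
    have h3 := sub_mem h2 h1
    have e1 : inl₁₂ (1 ⊗ₜ[k] s l) = inr₂₃ (s l ⊗ₜ 1) := rfl
    have e2 : inl₁₂ (t l ⊗ₜ 1) * ((a ⊗ₜ 1) * inr₂₃ (f b)) =
        ((t l * a) ⊗ₜ[k] 1) * inr₂₃ (f b) := by
      rw [inl₁₂_tmul, ← mul_assoc, Algebra.TensorProduct.tmul_mul_tmul, mul_one]; rfl
    have e3 : inr₂₃ (s l ⊗ₜ 1) * ((a ⊗ₜ 1) * inr₂₃ (f b)) =
        (a ⊗ₜ[k] 1) * (inr₂₃ (s l ⊗ₜ 1) * inr₂₃ (f b)) := by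
      rw [← mul_assoc, inr₂₃_mul_comm, mul_assoc]
    rw [map_sub inl₁₂, sub_mul, e1, e2, e3, map_sub inr₂₃, mul_sub,
      map_mul inr₂₃ (s l ⊗ₜ 1)] at h3
    rw [map_sub, lift₂_tmul, lift₂_tmul]
    convert h3 using 1
    noncomm_ring

/-- If left multiplication by `f(x)` respects the relations of `B ⊗_L B`, `f` is right linear
and `w` satisfies the Takeuchi condition up to `f`, then left multiplication by `(f ⊗ id)(w)`
respects the relations of `B ⊗_L B ⊗_L B`. -/
theorem lift₁_mul_mem {f : B →ₗ[k] B ⊗[k] B} {w : B ⊗[k] B}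
    (h₁ : ∀ x l, f x * (t l ⊗ₜ 1 - 1 ⊗ₜ s l) ∈ balRel s' t')
    (h₂ : ∀ x l, f (x * t l) - f x * (1 ⊗ₜ t l) ∈ balRel s' t')
    (h₃ : ∀ l, lift₁ f (w * (t l ⊗ₜ 1 - 1 ⊗ₜ s l)) ∈ balRel₃ s' t')
    {x : B ⊗[k] (B ⊗[k] B)} (hx : x ∈ balRel₃ s t) : lift₁ f w * x ∈ balRel₃ s' t' := by
  refine mul_balRel₃_mem (fun l => ?_) (fun l => ?_) hx
  · rw [← lift₁_mulRight]
    exact lift₁_mem (fun y => h₁ y l) w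
  -- A generator in legs 2 and 3 can be absorbed into w: by the right linearity of f, the factor
  -- t(l) in leg 2 of the result comes from right multiplication by t(l) in leg 1 of w. The error is
  -- `lift₁` of a map with values in the relations.
  · have e : ∀ w : B ⊗[k] B, lift₁ f (w * (t l ⊗ₜ 1 - 1 ⊗ₜ s l)) -
        lift₁ (f ∘ₗ LinearMap.mulRight k (t l) - LinearMap.mulRight k (1 ⊗ₜ t l) ∘ₗ f) w =
        lift₁ f w * inr₂₃ (t l ⊗ₜ 1 - 1 ⊗ₜ s l) := by
      intro w
      induction w using TensorProduct.induction_on with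
      | zero => simp
      | add a b ha hb =>
        simp only [add_mul, map_add, ← ha, ← hb]
        abel
      | tmul a b =>
        have e1 : inr₂₃ (t l ⊗ₜ 1) = inl₁₂ (1 ⊗ₜ[k] t l) := rfl
        have e2 : (1 ⊗ₜ (1 ⊗ₜ b)) * inr₂₃ (1 ⊗ₜ s l) = (1 ⊗ₜ[k] (1 ⊗ₜ[k] (b * s l))) := by
          simp [inr₂₃_apply]
        rw [map_sub inr₂₃, mul_sub, mul_sub, map_sub, lift₁_tmul f a b, mul_assoc, mul_assoc, e2,
          e1, inl₁₂_mul_comm, lift₁_tmul]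
        simp only [Algebra.TensorProduct.tmul_mul_tmul, mul_one, lift₁_tmul, LinearMap.sub_apply,
          LinearMap.comp_apply, LinearMap.mulRight_apply, map_sub, map_mul, sub_mul, mul_assoc]
        abel
    rw [← e]
    exact sub_mem (h₃ l) (lift₁_mem (fun y => h₂ y l) w)

theorem applyFst_mk (f : B →ₗ[k] B ⊗[k] B) (z : B ⊗[k] B) :
    applyFst (Bal.mk s t ∘ₗ f) z = (balRel₃ s t).mkQ (lift₁ f z) := by
  induction z using TensorProduct.induction_on with
  | zero => simp
  | add a b ha hb => simp only [map_add, ha, hb]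
  | tmul a b => rfl

theorem applySnd_mk (f : B →ₗ[k] B ⊗[k] B) (z : B ⊗[k] B) :
    applySnd (Bal.mk s t ∘ₗ f) z = (balRel₃ s t).mkQ (lift₂ f z) := by
  induction z using TensorProduct.induction_on with
  | zero => simp
  | add a b ha hb => simp only [map_add, ha, hb]
  | tmul a b => rfl

end Balanced

/-! ### Bialgebroids whose coproduct has a linear lift -/

namespace BialgebroidData

variable {k L B : Type*} [CommRing k] [Ring L] [Algebra k L] [Ring B] [Algebra k B]

/-- The bialgebroid axioms for `D`, expressed through a linear lift `d : B → B ⊗ B` of the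
coproduct. -/
structure IsLiftedBialgebroid (D : BialgebroidData k L B) (d : B →ₗ[k] B ⊗[k] B) : Prop where
  Δ_eq : D.Δ = D.cls ∘ₗ d
  s_one : D.s 1 = 1
  s_mul : ∀ l m, D.s (l * m) = D.s l * D.s m
  t_one : D.t 1 = 1
  t_mul : ∀ l m, D.t (l * m) = D.t m * D.t l
  s_mul_t : ∀ l m, D.s l * D.t m = D.t m * D.s l
  d_s_mul : ∀ l a, d (D.s l * a) - (D.s l ⊗ₜ 1) * d a ∈ balRel D.s D.t
  d_t_mul : ∀ l a, d (D.t l * a) - (1 ⊗ₜ D.t l) * d a ∈ balRel D.s D.t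
  coassoc : ∀ a, lift₁ d (d a) - lift₂ d (d a) ∈ balRel₃ D.s D.t
  takeuchi : ∀ a l, d a * (D.t l ⊗ₜ 1 - 1 ⊗ₜ D.s l) ∈ balRel D.s D.t
  d_one : d 1 - 1 ∈ balRel D.s D.t
  d_mul : ∀ a b, d (a * b) - d a * d b ∈ balRel D.s D.t
  ε_s_mul : ∀ l a, D.ε (D.s l * a) = l * D.ε a
  ε_t_mul : ∀ l a, D.ε (D.t l * a) = D.ε a * l
  ε_one : D.ε 1 = 1
  ε_mul_s : ∀ a b, D.ε (a * D.s (D.ε b)) = D.ε (a * b)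
  ε_mul_t : ∀ a b, D.ε (a * D.t (D.ε b)) = D.ε (a * b)
  counit_fst : ∀ a, D.counitFst (d a) = a
  counit_snd : ∀ a, D.counitSnd (d a) = a

variable {D : BialgebroidData k L B} {d : B →ₗ[k] B ⊗[k] B}

theorem counitFst_tmul (D : BialgebroidData k L B) (a b : B) :
    D.counitFst (a ⊗ₜ b) = D.s (D.ε a) * b := rfl

theorem counitSnd_tmul (D : BialgebroidData k L B) (a b : B) :
    D.counitSnd (a ⊗ₜ b) = D.t (D.ε b) * a := rfl

theorem anchor_apply (D : BialgebroidData k L B) (a : B) (l : L) :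
    D.anchor a l = D.ε (a * D.s l) := rfl

/-- A linear map that vanishes on the relations of `B ⊗_L B` is independent of representatives. -/
theorem apply_eq_of_cls_eq {M : Type*} [AddCommGroup M] [Module k M] {s t : L →ₗ[k] B}
    {f : B ⊗[k] B →ₗ[k] M}
    (hf : ∀ l a b, f ((t l * a) ⊗ₜ b) = f (a ⊗ₜ (s l * b))) {z w : B ⊗[k] B}
    (h : Bal.mk s t z = Bal.mk s t w) : f z = f w := by
  have hz := Bal.mk_eq_mk_iff.1 h
  rw [← sub_eq_zero, ← map_sub]
  have : balRel s t ≤ LinearMap.ker f := Submodule.span_le.2 (by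
    rintro _ ⟨l, a, b, rfl⟩
    simp [hf])
  exact this hz

namespace IsLiftedBialgebroid

section

variable (h : D.IsLiftedBialgebroid d)
include h

/-- The Takeuchi condition is exactly what makes the class of d(a)x depend only on the class of x.
-/
theorem mul_mem (a : B) {x : B ⊗[k] B} (hx : x ∈ balRel D.s D.t) :
    d a * x ∈ balRel D.s D.t :=
  mul_balRel_mem (h.takeuchi a) hx

theorem left_mul_s_mem (l : L) {x : B ⊗[k] B} (hx : x ∈ balRel D.s D.t) :
    (D.s l ⊗ₜ 1) * x ∈ balRel D.s D.t := by
  refine mul_balRel_mem (s := D.s) (t := D.t) (fun m => ?_) hx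
  have : (D.s l ⊗ₜ 1 : B ⊗[k] B) * (D.t m ⊗ₜ 1 - 1 ⊗ₜ D.s m) =
      (D.t m ⊗ₜ 1 - 1 ⊗ₜ D.s m) * (D.s l ⊗ₜ 1) := by
    simp [mul_sub, sub_mul, h.s_mul_t]
  rw [this]
  exact balRel_mul_mem _ _ (balRel_gen_mem _ _ m) _

theorem left_mul_t_mem (l : L) {x : B ⊗[k] B} (hx : x ∈ balRel D.s D.t) :
    (1 ⊗ₜ D.t l) * x ∈ balRel D.s D.t := by
  refine mul_balRel_mem (s := D.s) (t := D.t) (fun m => ?_) hx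
  have : (1 ⊗ₜ D.t l : B ⊗[k] B) * (D.t m ⊗ₜ 1 - 1 ⊗ₜ D.s m) =
      (D.t m ⊗ₜ 1 - 1 ⊗ₜ D.s m) * (1 ⊗ₜ D.t l) := by
    simp [mul_sub, sub_mul, h.s_mul_t]
  rw [this]
  exact balRel_mul_mem _ _ (balRel_gen_mem _ _ m) _

theorem d_s (l : L) : d (D.s l) - D.s l ⊗ₜ 1 ∈ balRel D.s D.t := by
  have h1 := h.d_s_mul l 1
  have h2 := h.left_mul_s_mem l h.d_one
  have h3 := add_mem h1 h2
  rw [mul_one, mul_sub, mul_one] at h3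
  simpa using h3

theorem d_t (l : L) : d (D.t l) - 1 ⊗ₜ D.t l ∈ balRel D.s D.t := by
  have h1 := h.d_t_mul l 1
  have h2 := h.left_mul_t_mem l h.d_one
  have h3 := add_mem h1 h2
  rw [mul_one, mul_sub, mul_one] at h3
  simpa using h3

theorem d_mul_s (a : B) (l : L) : d (a * D.s l) - d a * (D.s l ⊗ₜ 1) ∈ balRel D.s D.t := by
  have := add_mem (h.d_mul a (D.s l)) (h.mul_mem a (h.d_s l))
  rwa [mul_sub, sub_add_sub_cancel] at this

theorem d_mul_t (a : B) (l : L) : d (a * D.t l) - d a * (1 ⊗ₜ D.t l) ∈ balRel D.s D.t := by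
  have := add_mem (h.d_mul a (D.t l)) (h.mul_mem a (h.d_t l))
  rwa [mul_sub, sub_add_sub_cancel] at this

theorem counitFst_eq {z w : B ⊗[k] B} (hz : D.cls z = D.cls w) :
    D.counitFst z = D.counitFst w :=
  apply_eq_of_cls_eq (fun l a b => by
    simp only [counitFst_tmul, h.ε_t_mul, h.s_mul, mul_assoc]) hz

theorem counitSnd_eq {z w : B ⊗[k] B} (hz : D.cls z = D.cls w) :
    D.counitSnd z = D.counitSnd w :=
  apply_eq_of_cls_eq (fun l a b => by
    simp only [counitSnd_tmul, h.ε_s_mul, h.t_mul, mul_assoc]) hz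

theorem Δ_apply (a : B) : D.Δ a = D.cls (d a) := by rw [h.Δ_eq]; rfl

theorem mk_lift₁_eq {z w : B ⊗[k] B} (hz : D.cls z = D.cls w) :
    (balRel₃ D.s D.t).mkQ (lift₁ d z) = (balRel₃ D.s D.t).mkQ (lift₁ d w) := by
  rw [Submodule.mkQ_apply, Submodule.mkQ_apply, Submodule.Quotient.eq, ← map_sub]
  exact lift₁_balRel_mem h.d_t_mul (Bal.mk_eq_mk_iff.1 hz)

theorem mk_lift₂_eq {z w : B ⊗[k] B} (hz : D.cls z = D.cls w) :
    (balRel₃ D.s D.t).mkQ (lift₂ d z) = (balRel₃ D.s D.t).mkQ (lift₂ d w) := by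
  rw [Submodule.mkQ_apply, Submodule.mkQ_apply, Submodule.Quotient.eq, ← map_sub]
  exact lift₂_balRel_mem h.d_s_mul (Bal.mk_eq_mk_iff.1 hz)

theorem isBialgebroid : D.IsBialgebroid where
  s_one := h.s_one
  s_mul := h.s_mul
  t_one := h.t_one
  t_mul := h.t_mul
  s_mul_t := h.s_mul_t
  Δ_s_mul l a z hz := by
    rw [h.Δ_apply] at hz ⊢
    have h1 := add_mem (h.d_s_mul l a)
      (h.left_mul_s_mem l (Bal.mk_eq_mk_iff.1 hz.symm))
    rw [Bal.mk_eq_mk_iff]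
    rwa [mul_sub, sub_add_sub_cancel] at h1
  Δ_t_mul l a z hz := by
    rw [h.Δ_apply] at hz ⊢
    have h1 := add_mem (h.d_t_mul l a)
      (h.left_mul_t_mem l (Bal.mk_eq_mk_iff.1 hz.symm))
    rw [Bal.mk_eq_mk_iff]
    rwa [mul_sub, sub_add_sub_cancel] at h1
  coassoc a z hz := by
    rw [h.Δ_apply] at hz
    rw [h.Δ_eq, applyFst_mk, applySnd_mk, h.mk_lift₁_eq hz, h.mk_lift₂_eq hz,
      Submodule.mkQ_apply, Submodule.mkQ_apply, Submodule.Quotient.eq]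
    exact h.coassoc a
  takeuchi a l := by
    rw [h.Δ_apply, Bal.rmul_mk, Bal.rmul_mk, Bal.mk_eq_mk_iff, ← mul_sub]
    exact h.takeuchi a l
  Δ_one := by
    rw [h.Δ_apply, Bal.mk_eq_mk_iff]
    exact h.d_one
  Δ_mul a b w hw := by
    rw [h.Δ_apply] at hw
    rw [h.Δ_apply, h.Δ_apply, Bal.rmul_mk, Bal.mk_eq_mk_iff]
    have h1 := add_mem (h.d_mul a b) (h.mul_mem a (Bal.mk_eq_mk_iff.1 hw.symm))
    rwa [mul_sub, sub_add_sub_cancel] at h1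
  ε_s_mul := h.ε_s_mul
  ε_t_mul := h.ε_t_mul
  ε_one := h.ε_one
  ε_mul_s := h.ε_mul_s
  ε_mul_t := h.ε_mul_t
  counit_fst a z hz := by
    rw [h.Δ_apply] at hz
    rw [h.counitFst_eq hz, h.counit_fst]
  counit_snd a z hz := by
    rw [h.Δ_apply] at hz
    rw [h.counitSnd_eq hz, h.counit_snd]

/-- `(ε ⊗ id)(Δ(a) z) = a (ε ⊗ id)(z)`. -/
theorem counitFst_mul (a : B) (z : B ⊗[k] B) :
    D.counitFst (d a * z) = a * D.counitFst z := by
  induction z using TensorProduct.induction_on with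
  | zero => simp
  | add x y hx hy => simp only [map_add, mul_add, hx, hy]
  | tmul x y =>
    -- Since ε(ux) = ε(u s(ε(x))), the factor x may be replaced by s(ε(x)). That source element is
    -- then absorbed into a, because Δ(a s(l)) ≡ Δ(a)(s(l) ⊗ 1), and the counit axiom applies to a
    -- s(l).
    have h1 : ∀ w : B ⊗[k] B, D.counitFst (w * (x ⊗ₜ y)) =
        D.counitFst (w * (D.s (D.ε x) ⊗ₜ 1)) * y := by
      intro w
      induction w using TensorProduct.induction_on with
      | zero => simp
      | add x y hx hy => simp only [map_add, add_mul, hx, hy]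
      | tmul u v => simp [counitFst_tmul, h.ε_mul_s, mul_assoc]
    rw [h1, ← h.counitFst_eq (Bal.mk_eq_mk_iff.2 (h.d_mul_s a _)), h.counit_fst, counitFst_tmul,
      mul_assoc]

/-- `(id ⊗ ε)(Δ(a) z) = a (id ⊗ ε)(z)`. -/
theorem counitSnd_mul (a : B) (z : B ⊗[k] B) :
    D.counitSnd (d a * z) = a * D.counitSnd z := by
  induction z using TensorProduct.induction_on with
  | zero => simp
  | add x y hx hy => simp only [map_add, mul_add, hx, hy]
  | tmul x y =>
    have h1 : ∀ w : B ⊗[k] B, D.counitSnd (w * (x ⊗ₜ y)) =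
        D.counitSnd (w * (1 ⊗ₜ D.t (D.ε y))) * x := by
      intro w
      induction w using TensorProduct.induction_on with
      | zero => simp
      | add x y hx hy => simp only [map_add, add_mul, hx, hy]
      | tmul u v => simp [counitSnd_tmul, h.ε_mul_t, mul_assoc]
    rw [h1, ← h.counitSnd_eq (Bal.mk_eq_mk_iff.2 (h.d_mul_t a _)), h.counit_snd, counitSnd_tmul,
      mul_assoc]

end

end IsLiftedBialgebroid

/-! ### Twisting by an invertible element of B ⊗ B -/

/-- Conditions on an invertible `P ∈ B ⊗ B` and on maps `s', t' : L → B` under which the class of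
`P` in `B ⊗_L B` is a twist of `D` with source map `s'` and target map `t'`. -/
structure IsTwistLift (D : BialgebroidData k L B) (d : B →ₗ[k] B ⊗[k] B) (P : (B ⊗[k] B)ˣ)
    (s' t' : L →ₗ[k] B) : Prop where
  s_one : s' 1 = 1
  s_mul : ∀ l m, s' (l * m) = s' l * s' m
  t_one : t' 1 = 1
  t_mul : ∀ l m, t' (l * m) = t' m * t' l
  s_mul_t : ∀ l m, s' l * t' m = t' m * s' l
  mul_mem : ∀ l, P.val * (t' l ⊗ₜ 1 - 1 ⊗ₜ s' l) ∈ balRel D.s D.t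
  inv_mul_mem : ∀ l, P⁻¹.val * (D.t l ⊗ₜ 1 - 1 ⊗ₜ D.s l) ∈ balRel s' t'
  d_s_mul : ∀ l, d (s' l) * P.val - P.val * (s' l ⊗ₜ 1) ∈ balRel D.s D.t
  d_t_mul : ∀ l, d (t' l) * P.val - P.val * (1 ⊗ₜ t' l) ∈ balRel D.s D.t
  cocycle : lift₁ d P.val * inl₁₂ P.val - lift₂ d P.val * inr₂₃ P.val ∈ balRel₃ D.s D.t
  counit_fst : D.counitFst P.val = 1
  counit_snd : D.counitSnd P.val = 1
  base : ∀ l m, LinearMap.mul' k L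
    (TensorProduct.map (D.anchor.flip l) (D.anchor.flip m) P.val) = l * m
  source : ∀ l, s' l = TensorProduct.lift (LinearMap.mul k B ∘ₗ D.s ∘ₗ D.anchor.flip l) P.val
  target : ∀ l, t' l =
    TensorProduct.lift (LinearMap.mul k B ∘ₗ D.t ∘ₗ D.anchor.flip l).flip P.val
  ε_s_mul : ∀ l a, D.ε (s' l * a) = l * D.ε a
  ε_t_mul : ∀ l a, D.ε (t' l * a) = D.ε a * l
  ε_mul_s : ∀ a l, D.ε (a * s' l) = D.ε (a * D.s l)
  ε_mul_t : ∀ a l, D.ε (a * t' l) = D.ε (a * D.t l)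

/-- The lift `a ↦ P⁻¹ Δ(a) P` of the twisted coproduct. -/
def twistLift (d : B →ₗ[k] B ⊗[k] B) (P : (B ⊗[k] B)ˣ) : B →ₗ[k] B ⊗[k] B :=
  LinearMap.mulLeft k P⁻¹.val ∘ₗ LinearMap.mulRight k P.val ∘ₗ d

theorem twistLift_apply (P : (B ⊗[k] B)ˣ) (a : B) :
    twistLift d P a = P⁻¹.val * (d a * P.val) := rfl

/-- The twisted structure maps. -/
def twist (D : BialgebroidData k L B) (d : B →ₗ[k] B ⊗[k] B) (P : (B ⊗[k] B)ˣ)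
    (s' t' : L →ₗ[k] B) : BialgebroidData k L B where
  s := s'
  t := t'
  Δ := Bal.mk s' t' ∘ₗ twistLift d P
  ε := D.ε

namespace IsTwistLift

variable {P : (B ⊗[k] B)ˣ} {s' t' : L →ₗ[k] B}
variable (h : D.IsLiftedBialgebroid d) (hP : D.IsTwistLift d P s' t')
include h hP

omit h in
theorem unit_mul_mem {x : B ⊗[k] B} (hx : x ∈ balRel s' t') : P.val * x ∈ balRel D.s D.t :=
  mul_balRel_mem hP.mul_mem hx

omit h in
theorem unit_inv_mul_mem {x : B ⊗[k] B} (hx : x ∈ balRel D.s D.t) :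
    P⁻¹.val * x ∈ balRel s' t' :=
  mul_balRel_mem hP.inv_mul_mem hx

theorem twistLift_s_mul (l : L) (a : B) :
    twistLift d P (s' l * a) - (s' l ⊗ₜ 1) * twistLift d P a ∈ balRel s' t' := by
  have h1 := balRel_mul_mem _ _ (h.d_mul (s' l) a) P.val
  have h2 := balRel_mul_mem _ _ (hP.d_s_mul l) (P⁻¹.val * (d a * P.val))
  have h3 := hP.unit_inv_mul_mem (add_mem h1 h2)
  convert h3 using 1
  simp only [twistLift_apply, mul_sub, sub_mul, mul_assoc, Units.inv_mul_cancel_left,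
    Units.mul_inv_cancel_left, sub_add_sub_cancel]

theorem twistLift_t_mul (l : L) (a : B) :
    twistLift d P (t' l * a) - (1 ⊗ₜ t' l) * twistLift d P a ∈ balRel s' t' := by
  have h1 := balRel_mul_mem _ _ (h.d_mul (t' l) a) P.val
  have h2 := balRel_mul_mem _ _ (hP.d_t_mul l) (P⁻¹.val * (d a * P.val))
  have h3 := hP.unit_inv_mul_mem (add_mem h1 h2)
  convert h3 using 1
  simp only [twistLift_apply, mul_sub, sub_mul, mul_assoc, Units.inv_mul_cancel_left,
    Units.mul_inv_cancel_left, sub_add_sub_cancel]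

theorem inv_mul_d_t_mul (l : L) (a : B) :
    P⁻¹.val * d (t' l * a) - (1 ⊗ₜ t' l) * (P⁻¹.val * d a) ∈ balRel s' t' := by
  have := balRel_mul_mem _ _ (twistLift_t_mul h hP l a) P⁻¹.val
  simpa only [twistLift_apply, sub_mul, mul_assoc, Units.mul_inv, mul_one] using this

/-- Left multiplication by `P₁₂⁻¹ (Δ ⊗ id)(P⁻¹)` maps the relations of `B ⊗_L B ⊗_L B` to those
formed with the twisted source and target maps. -/
theorem inv_mul_lift₁_mem {x : B ⊗[k] (B ⊗[k] B)} (hx : x ∈ balRel₃ D.s D.t) :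
    inl₁₂ P⁻¹.val * lift₁ d P⁻¹.val * x ∈ balRel₃ s' t' := by
  rw [← lift₁_mulLeft]
  refine lift₁_mul_mem (fun y l => ?_) (fun y l => ?_) (fun l => ?_) hx
  · simp only [LinearMap.comp_apply, LinearMap.mulLeft_apply, mul_assoc]
    exact hP.unit_inv_mul_mem (h.takeuchi y l)
  · simp only [LinearMap.comp_apply, LinearMap.mulLeft_apply, mul_assoc, ← mul_sub]
    exact hP.unit_inv_mul_mem (h.d_mul_t y l)
  · exact lift₁_balRel_mem (f := LinearMap.mulLeft k P⁻¹.val ∘ₗ d)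
      (inv_mul_d_t_mul h hP) (hP.inv_mul_mem l)

/-- The map d need not be multiplicative before passing to classes, so (Δ ⊗ id)(P) and (Δ ⊗ id)(P⁻¹)
are inverse only modulo relations. The proof uses P⁻¹d(xy)P ≡ (P⁻¹d(x))(d(y)P), applied along the
factorisation 1 = P⁻¹P, together with P⁻¹d(1)P ≡ 1. -/
theorem inv_mul_lift₁_mul_sub_mem :
    1 - inl₁₂ P⁻¹.val * lift₁ d P⁻¹.val * (lift₁ d P.val * inl₁₂ P.val) ∈ balRel₃ s' t' := by
  have h1 : lift₁ (twistLift d P) (P⁻¹.val * P.val) -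
      lift₁ (LinearMap.mulLeft k P⁻¹.val ∘ₗ d) P⁻¹.val *
        lift₁ (LinearMap.mulRight k P.val ∘ₗ d) P.val ∈ balRel₃ s' t' := by
    refine lift₁_mul_sub_mem (fun x y => ?_) _ _
    have := hP.unit_inv_mul_mem (balRel_mul_mem _ _ (h.d_mul x y) P.val)
    simpa only [twistLift_apply, LinearMap.comp_apply, LinearMap.mulLeft_apply,
      LinearMap.mulRight_apply, sub_mul, mul_sub, mul_assoc] using this
  have h2 : twistLift d P 1 - 1 ∈ balRel s' t' := by
    have := hP.unit_inv_mul_mem (balRel_mul_mem _ _ h.d_one P.val)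
    simpa only [twistLift_apply, sub_mul, mul_sub, one_mul, Units.inv_mul] using this
  have h3 := inl₁₂_mem h2 1
  rw [Units.inv_mul, Algebra.TensorProduct.one_def, lift₁_tmul, lift₁_mulLeft,
    lift₁_mulRight] at h1
  have h4 := sub_mem h1 h3
  simp only [← Algebra.TensorProduct.one_def, mul_one, map_sub, map_one] at h4
  convert h4 using 1
  abel

omit hP in
theorem lift₁_d_mul_mem (a : B) {x : B ⊗[k] (B ⊗[k] B)} (hx : x ∈ balRel₃ D.s D.t) :
    lift₁ d (d a) * x ∈ balRel₃ D.s D.t :=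
  lift₁_mul_mem h.takeuchi h.d_mul_t
    (fun l => lift₁_balRel_mem h.d_t_mul (h.takeuchi a l)) hx

/-- Put W = (Δ ⊗ id)(P) P₁₂ and z = P⁻¹d(a)P, so that Pz = d(a)P. Modulo the untwisted relations,
W(Δ̃ ⊗ id)(z) ≡ (Δ ⊗ id)(d(a)) W. The cocycle identity for P replaces W by (id ⊗ Δ)(P) P₂₃,
coassociativity of Δ changes the other factor to (id ⊗ Δ)(d(a)), and the same steps in reverse lead
to W(id ⊗ Δ̃)(z). Finally W is cancelled. -/
theorem twistLift_coassoc (a : B) :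
    lift₁ (twistLift d P) (twistLift d P a) - lift₂ (twistLift d P) (twistLift d P a) ∈
      balRel₃ s' t' := by
  have e0 : P.val * twistLift d P a = d a * P.val := by
    rw [twistLift_apply, Units.mul_inv_cancel_left]
  set z := twistLift d P a with hz
  have e1 : lift₁ (twistLift d P) z = inl₁₂ P⁻¹.val * (lift₁ d z * inl₁₂ P.val) := by
    rw [twistLift, lift₁_mulLeft, lift₁_mulRight]
  have e2 : lift₂ (twistLift d P) z = inr₂₃ P⁻¹.val * (lift₂ d z * inr₂₃ P.val) := by
    rw [twistLift, lift₂_mulLeft, lift₂_mulRight]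
  have i1 : inl₁₂ P.val * inl₁₂ P⁻¹.val = 1 := by rw [← map_mul, Units.mul_inv, map_one]
  have i2 : inr₂₃ P.val * inr₂₃ P⁻¹.val = 1 := by rw [← map_mul, Units.mul_inv, map_one]
  have a1 := balRel₃_mul_mem (lift₁_mul_sub_mem h.d_mul P.val z) (inl₁₂ P.val)
  have a2 := balRel₃_mul_mem (lift₁_mul_sub_mem h.d_mul (d a) P.val) (inl₁₂ P.val)
  have b1 := balRel₃_mul_mem (lift₂_mul_sub_mem h.d_mul P.val z) (inr₂₃ P.val)
  have b2 := balRel₃_mul_mem (lift₂_mul_sub_mem h.d_mul (d a) P.val) (inr₂₃ P.val)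
  rw [e0] at a1 b1
  have c1 := lift₁_d_mul_mem h a hP.cocycle
  have c2 := balRel₃_mul_mem (h.coassoc a) (lift₂ d P.val * inr₂₃ P.val)
  have c3 := balRel₃_mul_mem hP.cocycle (lift₂ (twistLift d P) z)
  -- The chain of congruences: `a1`, `a2`, `b1`, `b2` are multiplicativity of Δ in each form, `c1`
  -- and `c3` are the cocycle identity, and `c2` is coassociativity of the untwisted coproduct.
  have key : lift₁ d P.val * inl₁₂ P.val *
      (lift₁ (twistLift d P) z - lift₂ (twistLift d P) z) ∈ balRel₃ D.s D.t := by
    have := sub_mem (add_mem (add_mem (sub_mem a2 a1) (sub_mem b1 b2)) (add_mem c1 c2)) c3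
    have f1 : lift₁ d P.val * inl₁₂ P.val * lift₁ (twistLift d P) z =
        lift₁ d P.val * lift₁ d z * inl₁₂ P.val := by
      rw [e1, mul_assoc, ← mul_assoc (inl₁₂ P.val), i1, one_mul, mul_assoc]
    have f2 : lift₂ d P.val * inr₂₃ P.val * lift₂ (twistLift d P) z =
        lift₂ d P.val * lift₂ d z * inr₂₃ P.val := by
      rw [e2, mul_assoc, ← mul_assoc (inr₂₃ P.val), i2, one_mul, mul_assoc]
    rw [mul_sub, f1]
    rw [sub_mul _ _ (lift₂ (twistLift d P) z), f2] at this
    convert this using 1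
    simp only [mul_sub, sub_mul, mul_assoc]
    abel
  -- W is cancelled by P₁₂⁻¹ (Δ ⊗ id)(P⁻¹), which carries untwisted relations to twisted ones and is
  -- a left inverse of W modulo the latter.
  have k1 := inv_mul_lift₁_mem h hP key
  have k2 := balRel₃_mul_mem (inv_mul_lift₁_mul_sub_mem h hP)
    (lift₁ (twistLift d P) z - lift₂ (twistLift d P) z)
  have k3 := add_mem k1 k2
  rwa [sub_mul, one_mul, mul_assoc (inl₁₂ P⁻¹.val * _), add_sub_cancel] at k3

/-- By definition s̃(ε(x)) = s(Ψ₁ ⊢ ε(x))Ψ₂, and Ψ₁ ⊢ ε(x) = ε(Ψ₁x). Hence the twisted counit axiom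
for P⁻¹d(a)P reduces to the counit of d(a)P, which is a times the counit of P. -/
theorem twist_counitFst (z : B ⊗[k] B) :
    (D.twist d P s' t').counitFst z = D.counitFst (P.val * z) := by
  induction z using TensorProduct.induction_on with
  | zero => simp
  | add x y hx hy => simp only [map_add, mul_add, hx, hy]
  | tmul x y =>
    have : ∀ p : B ⊗[k] B, TensorProduct.lift (LinearMap.mul k B ∘ₗ D.s ∘ₗ
        D.anchor.flip (D.ε x)) p * y = D.counitFst (p * (x ⊗ₜ y)) := by
      intro p
      induction p using TensorProduct.induction_on with
      | zero => simp
      | add x y hx hy => simp only [map_add, add_mul, hx, hy]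
      | tmul u v => simp [counitFst_tmul, anchor_apply, h.ε_mul_s, mul_assoc]
    rw [← this, ← hP.source]
    rfl

theorem twist_counitSnd (z : B ⊗[k] B) :
    (D.twist d P s' t').counitSnd z = D.counitSnd (P.val * z) := by
  induction z using TensorProduct.induction_on with
  | zero => simp
  | add x y hx hy => simp only [map_add, mul_add, hx, hy]
  | tmul x y =>
    have : ∀ p : B ⊗[k] B, TensorProduct.lift (LinearMap.mul k B ∘ₗ D.t ∘ₗ
        D.anchor.flip (D.ε y)).flip p * x = D.counitSnd (p * (x ⊗ₜ y)) := by
      intro p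
      induction p using TensorProduct.induction_on with
      | zero => simp
      | add x y hx hy => simp only [map_add, add_mul, hx, hy]
      | tmul u v => simp [counitSnd_tmul, anchor_apply, h.ε_mul_s, mul_assoc]
    rw [← this, ← hP.target]
    rfl

theorem isLiftedBialgebroid_twist :
    (D.twist d P s' t').IsLiftedBialgebroid (twistLift d P) where
  Δ_eq := rfl
  s_one := hP.s_one
  s_mul := hP.s_mul
  t_one := hP.t_one
  t_mul := hP.t_mul
  s_mul_t := hP.s_mul_t
  d_s_mul := twistLift_s_mul h hP
  d_t_mul := twistLift_t_mul h hP
  coassoc := twistLift_coassoc h hP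
  takeuchi a l := by
    change twistLift d P a * (t' l ⊗ₜ 1 - 1 ⊗ₜ s' l) ∈ balRel s' t'
    have := hP.unit_inv_mul_mem (h.mul_mem a (hP.mul_mem l))
    simpa only [twistLift_apply, mul_assoc] using this
  d_one := by
    change _ ∈ balRel s' t'
    have := hP.unit_inv_mul_mem (balRel_mul_mem _ _ h.d_one P.val)
    simpa only [twistLift_apply, sub_mul, mul_sub, one_mul, Units.inv_mul] using this
  d_mul a b := by
    change _ ∈ balRel s' t'
    have := hP.unit_inv_mul_mem (balRel_mul_mem _ _ (h.d_mul a b) P.val)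
    simpa only [twistLift_apply, sub_mul, mul_sub, mul_assoc, Units.mul_inv_cancel_left]
      using this
  ε_s_mul := hP.ε_s_mul
  ε_t_mul := hP.ε_t_mul
  ε_one := h.ε_one
  ε_mul_s a b := (hP.ε_mul_s a _).trans (h.ε_mul_s a b)
  ε_mul_t a b := (hP.ε_mul_t a _).trans (h.ε_mul_t a b)
  counit_fst a := by
    rw [twist_counitFst h hP, twistLift_apply, Units.mul_inv_cancel_left, h.counitFst_mul,
      hP.counit_fst, mul_one]
  counit_snd a := by
    rw [twist_counitSnd h hP, twistLift_apply, Units.mul_inv_cancel_left, h.counitSnd_mul,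
      hP.counit_snd, mul_one]

omit hP in
theorem rmul_comp_Δ {z w : B ⊗[k] B} (hz : D.cls z = D.cls w) :
    Bal.rmul D.s D.t z ∘ₗ D.Δ = D.cls ∘ₗ LinearMap.mulRight k w ∘ₗ d := by
  ext a
  rw [LinearMap.comp_apply, h.Δ_apply, Bal.rmul_mk]
  refine Bal.mk_eq_mk_iff.2 ?_
  rw [LinearMap.comp_apply, LinearMap.mulRight_apply, ← mul_sub]
  exact h.mul_mem a (Bal.mk_eq_mk_iff.1 hz)

theorem isTwistingCocycle : D.IsTwistingCocycle (D.cls P.val) where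
  cocycle z w hz hw := by
    have c := hP.cocycle
    have a1 := balRel₃_mul_mem (lift₁_balRel_mem h.d_t_mul (Bal.mk_eq_mk_iff.1 hz))
      (inl₁₂ P.val)
    have a2 := balRel₃_mul_mem (lift₂_balRel_mem h.d_s_mul (Bal.mk_eq_mk_iff.1 hz))
      (inr₂₃ P.val)
    rw [rmul_comp_Δ h hw, applyFst_mk, applySnd_mk, lift₁_mulRight, lift₂_mulRight,
      Submodule.mkQ_apply, Submodule.mkQ_apply, Submodule.Quotient.eq]
    have := add_mem c (sub_mem a1 a2)
    convert this using 1
    simp only [map_sub, sub_mul]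
    abel
  counit_fst z hz := by rw [h.counitFst_eq hz, hP.counit_fst]
  counit_snd z hz := by rw [h.counitSnd_eq hz, hP.counit_snd]

theorem isTwist :
    D.IsTwist (D.cls P.val) (D.twist d P s' t') (Bal.mk s' t' P⁻¹.val) where
  base z hz l m := by
    rw [← hP.base l m]
    refine apply_eq_of_cls_eq (f := LinearMap.mul' k L ∘ₗ
      TensorProduct.map (D.anchor.flip l) (D.anchor.flip m)) (fun n a b => ?_) hz
    simp [anchor_apply, mul_assoc, h.ε_s_mul, h.ε_t_mul]
  source z hz l := by
    refine (hP.source l).trans (apply_eq_of_cls_eq (fun n a b => ?_) hz.symm)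
    simp [anchor_apply, mul_assoc, h.ε_t_mul, h.s_mul]
  target z hz l := by
    refine (hP.target l).trans (apply_eq_of_cls_eq (fun n a b => ?_) hz.symm)
    simp [anchor_apply, mul_assoc, h.ε_s_mul, h.t_mul]
  inverse := by
    refine ⟨fun w hw => ?_, fun z hz => ?_⟩
    · have := hP.unit_mul_mem (Bal.mk_eq_mk_iff.1 hw)
      rw [Bal.rmul_mk, Bal.mk_eq_mk_iff]
      rwa [mul_sub, Units.mul_inv] at this
    · have := hP.unit_inv_mul_mem (Bal.mk_eq_mk_iff.1 hz)
      refine Bal.mk_eq_mk_iff.2 ?_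
      rwa [mul_sub, Units.inv_mul] at this
  coproduct z hz a w hw := by
    rw [h.Δ_apply] at hw
    have h1 := hP.unit_inv_mul_mem (h.mul_mem a (Bal.mk_eq_mk_iff.1 hz))
    have h2 := hP.unit_inv_mul_mem (balRel_mul_mem _ _ (Bal.mk_eq_mk_iff.1 hw) z)
    refine Bal.mk_eq_mk_iff.2 ?_
    have h3 := neg_mem (add_mem h1 h2)
    convert h3 using 1
    simp only [twistLift_apply, LinearMap.mulRight_apply, mul_sub, sub_mul]
    abel
  counit := rfl

end IsTwistLift

end BialgebroidData

/-! ### The tensor product of a bialgebra and a bialgebroid -/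

namespace BialgebroidData

variable {k L B : Type*} [CommRing k] [Ring L] [Algebra k L] [Ring B] [Algebra k B]
  (U : Type*) [Ring U] [Bialgebra k U]

variable (k B) in
/-- The interchange isomorphism `(u ⊗ v) ⊗ (a ⊗ b) ↦ (u ⊗ a) ⊗ (v ⊗ b)`. -/
abbrev shuffle : (U ⊗[k] U) ⊗[k] (B ⊗[k] B) ≃ₐ[k] (U ⊗[k] B) ⊗[k] (U ⊗[k] B) :=
  Algebra.TensorProduct.tensorTensorTensorComm k k k k U U B B

variable (k B) in
/-- The map `(u ⊗ v ⊗ w) ⊗ (a ⊗ b ⊗ c) ↦ (u ⊗ a) ⊗ (v ⊗ b) ⊗ (w ⊗ c)`. -/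
def shuffle₃ : (U ⊗[k] (U ⊗[k] U)) ⊗[k] (B ⊗[k] (B ⊗[k] B)) →ₗ[k]
    (U ⊗[k] B) ⊗[k] ((U ⊗[k] B) ⊗[k] (U ⊗[k] B)) :=
  LinearMap.lTensor (U ⊗[k] B) (shuffle k B U).toLinearMap ∘ₗ
    (TensorProduct.tensorTensorTensorComm k U (U ⊗[k] U) B (B ⊗[k] B)).toLinearMap

theorem shuffle_mem {s t : L →ₗ[k] B} (w : U ⊗[k] U) {z : B ⊗[k] B} (hz : z ∈ balRel s t) :
    shuffle k B U (w ⊗ₜ z) ∈ balRel (tensorMap U s) (tensorMap U t) := by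
  induction w using TensorProduct.induction_on with
  | zero => simp
  | add x y hx hy => rw [TensorProduct.add_tmul, map_add]; exact add_mem hx hy
  | tmul u v =>
  induction hz using Submodule.span_induction with
  | zero => simp
  | add a b _ _ ha hb => rw [TensorProduct.tmul_add, map_add]; exact add_mem ha hb
  | smul r a _ ha => rw [TensorProduct.tmul_smul, map_smul]; exact Submodule.smul_mem _ _ ha
  | mem z hz =>
    obtain ⟨l, a, b, rfl⟩ := hz
    exact Submodule.subset_span ⟨l, u ⊗ₜ a, v ⊗ₜ b, by simp [TensorProduct.tmul_sub]⟩

theorem shuffle₃_mem {s t : L →ₗ[k] B} (w : U ⊗[k] (U ⊗[k] U)) {z : B ⊗[k] (B ⊗[k] B)}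
    (hz : z ∈ balRel₃ s t) :
    shuffle₃ k B U (w ⊗ₜ z) ∈ balRel₃ (tensorMap U s) (tensorMap U t) := by
  induction w using TensorProduct.induction_on with
  | zero => simp
  | add x y hx hy => rw [TensorProduct.add_tmul, map_add]; exact add_mem hx hy
  | tmul u w =>
  induction w using TensorProduct.induction_on with
  | zero => simp
  | add x y hx hy =>
    rw [TensorProduct.tmul_add, TensorProduct.add_tmul, map_add]; exact add_mem hx hy
  | tmul v w =>
  induction hz using Submodule.span_induction with
  | zero => simp
  | add a b _ _ ha hb => rw [TensorProduct.tmul_add, map_add]; exact add_mem ha hb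
  | smul r a _ ha => rw [TensorProduct.tmul_smul, map_smul]; exact Submodule.smul_mem _ _ ha
  | mem z hz =>
    obtain ⟨l, a, b, c, rfl⟩ | ⟨l, a, b, c, rfl⟩ := hz
    · exact Submodule.subset_span (Or.inl ⟨l, u ⊗ₜ a, v ⊗ₜ b, w ⊗ₜ c, by
        simp [TensorProduct.tmul_sub, shuffle₃]⟩)
    · exact Submodule.subset_span (Or.inr ⟨l, u ⊗ₜ a, v ⊗ₜ b, w ⊗ₜ c, by
        simp [TensorProduct.tmul_sub, shuffle₃]⟩)

/-- The lift `u ⊗ b ↦ (u₁ ⊗ b₁) ⊗ (u₂ ⊗ b₂)` of the coproduct of `U ⊗ B`. -/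
def tensorLift (d : B →ₗ[k] B ⊗[k] B) : U ⊗[k] B →ₗ[k] (U ⊗[k] B) ⊗[k] (U ⊗[k] B) :=
  (shuffle k B U).toLinearMap ∘ₗ TensorProduct.map Coalgebra.comul d

theorem tensorLift_tmul (d : B →ₗ[k] B ⊗[k] B) (u : U) (b : B) :
    tensorLift U d (u ⊗ₜ b) = shuffle k B U (Coalgebra.comul u ⊗ₜ d b) := rfl

theorem lift₁_shuffle (d : B →ₗ[k] B ⊗[k] B) (w : U ⊗[k] U) (z : B ⊗[k] B) :
    lift₁ (tensorLift U d) (shuffle k B U (w ⊗ₜ z)) =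
      shuffle₃ k B U (TensorProduct.assoc k U U U (LinearMap.rTensor U Coalgebra.comul w) ⊗ₜ
        lift₁ d z) := by
  induction w using TensorProduct.induction_on with
  | zero => simp
  | add x y hx hy => simp only [TensorProduct.add_tmul, map_add, hx, hy]
  | tmul u v =>
  induction z using TensorProduct.induction_on with
  | zero => simp
  | add x y hx hy => simp only [TensorProduct.tmul_add, map_add, hx, hy]
  | tmul a b =>
    rw [Algebra.TensorProduct.tensorTensorTensorComm_tmul, lift₁_tmul, tensorLift_tmul,
      lift₁_tmul, LinearMap.rTensor_tmul]
    generalize (Coalgebra.comul u : U ⊗[k] U) = w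
    generalize d a = z
    induction w using TensorProduct.induction_on with
    | zero => simp
    | add x y hx hy => simp only [TensorProduct.add_tmul, map_add, add_mul, hx, hy]
    | tmul u₁ u₂ =>
    induction z using TensorProduct.induction_on with
    | zero => simp
    | add x y hx hy => simp only [TensorProduct.tmul_add, map_add, add_mul, hx, hy]
    | tmul a₁ a₂ => simp [inl₁₂_tmul, shuffle₃]

theorem lift₂_shuffle (d : B →ₗ[k] B ⊗[k] B) (w : U ⊗[k] U) (z : B ⊗[k] B) :
    lift₂ (tensorLift U d) (shuffle k B U (w ⊗ₜ z)) =
      shuffle₃ k B U (LinearMap.lTensor U Coalgebra.comul w ⊗ₜ lift₂ d z) := by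
  induction w using TensorProduct.induction_on with
  | zero => simp
  | add x y hx hy => simp only [TensorProduct.add_tmul, map_add, hx, hy]
  | tmul u v =>
  induction z using TensorProduct.induction_on with
  | zero => simp
  | add x y hx hy => simp only [TensorProduct.tmul_add, map_add, hx, hy]
  | tmul a b => simp [lift₂, tensorLift_tmul, shuffle₃]

variable {U} in
/-- An identity between linear maps on `U ⊗ B` modulo a submodule may be checked on pure
tensors. -/
theorem map_mem_of_tmul {M : Type*} [AddCommGroup M] [Module k M] {J : Submodule k M}
    (f : U ⊗[k] B →ₗ[k] M) (hf : ∀ u b, f (u ⊗ₜ b) ∈ J) (x : U ⊗[k] B) : f x ∈ J := by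
  induction x using TensorProduct.induction_on with
  | zero => simp
  | add x y hx hy => rw [map_add]; exact add_mem hx hy
  | tmul u b => exact hf u b

variable {D : BialgebroidData k L B} {d : B →ₗ[k] B ⊗[k] B}

theorem tensor_ε_tmul (D : BialgebroidData k L B) (u : U) (b : B) :
    (D.tensor U).ε (u ⊗ₜ b) = (Coalgebra.counit u : k) • D.ε b := rfl

theorem tensor_counitFst_shuffle (w : U ⊗[k] U) (z : B ⊗[k] B) :
    (D.tensor U).counitFst (shuffle k B U (w ⊗ₜ z)) =
      TensorProduct.lid k U (LinearMap.rTensor U Coalgebra.counit w) ⊗ₜ D.counitFst z := by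
  induction w using TensorProduct.induction_on with
  | zero => simp
  | add x y hx hy => simp only [TensorProduct.add_tmul, map_add, hx, hy]
  | tmul u v =>
  induction z using TensorProduct.induction_on with
  | zero => simp
  | add x y hx hy => simp only [TensorProduct.tmul_add, map_add, hx, hy]
  | tmul a b =>
    simp [counitFst_tmul, tensor, TensorProduct.smul_tmul]

theorem tensor_counitSnd_shuffle (w : U ⊗[k] U) (z : B ⊗[k] B) :
    (D.tensor U).counitSnd (shuffle k B U (w ⊗ₜ z)) =
      TensorProduct.rid k U (LinearMap.lTensor U Coalgebra.counit w) ⊗ₜ D.counitSnd z := by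
  induction w using TensorProduct.induction_on with
  | zero => simp
  | add x y hx hy => simp only [TensorProduct.add_tmul, map_add, hx, hy]
  | tmul u v =>
  induction z using TensorProduct.induction_on with
  | zero => simp
  | add x y hx hy => simp only [TensorProduct.tmul_add, map_add, hx, hy]
  | tmul a b =>
    simp [counitSnd_tmul, tensor, TensorProduct.smul_tmul]

theorem shuffle_left (a : B) :
    ((1 ⊗ₜ a) ⊗ₜ 1 : (U ⊗[k] B) ⊗[k] (U ⊗[k] B)) = shuffle k B U (1 ⊗ₜ (a ⊗ₜ 1)) := by
  simp [Algebra.TensorProduct.one_def]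

theorem shuffle_right (a : B) :
    (1 ⊗ₜ (1 ⊗ₜ a) : (U ⊗[k] B) ⊗[k] (U ⊗[k] B)) = shuffle k B U (1 ⊗ₜ (1 ⊗ₜ a)) := by
  simp [Algebra.TensorProduct.one_def]

theorem tensor_s (D : BialgebroidData k L B) (l : L) : (D.tensor U).s l = 1 ⊗ₜ D.s l := rfl

theorem tensor_t (D : BialgebroidData k L B) (l : L) : (D.tensor U).t l = 1 ⊗ₜ D.t l := rfl

/-- The interchange of factors is an algebra isomorphism and sends U ⊗ U tensored with the relations
of B into the relations of U ⊗ B. Each coproduct axiom is therefore the image of the one for B,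
paired with the corresponding bialgebra axiom of U. -/
theorem IsLiftedBialgebroid.tensor (h : D.IsLiftedBialgebroid d) :
    (D.tensor U).IsLiftedBialgebroid (tensorLift U d) where
  Δ_eq := by
    ext u b
    change interchange U D.s D.t (D.Δ b) (Coalgebra.comul u) = _
    rw [h.Δ_eq]
    rfl
  s_one := by rw [tensor_s, h.s_one]; rfl
  s_mul l m := by simp [tensor_s, h.s_mul]
  t_one := by rw [tensor_t, h.t_one]; rfl
  t_mul l m := by simp [tensor_t, h.t_mul]
  s_mul_t l m := by simp [tensor_s, tensor_t, h.s_mul_t]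
  d_s_mul l a := by
    refine map_mem_of_tmul (tensorLift U d ∘ₗ LinearMap.mulLeft k ((D.tensor U).s l) -
      LinearMap.mulLeft k ((D.tensor U).s l ⊗ₜ 1) ∘ₗ tensorLift U d) (fun u b => ?_) a
    have := shuffle_mem U (Coalgebra.comul u) (h.d_s_mul l b)
    simp only [LinearMap.sub_apply, LinearMap.comp_apply, LinearMap.mulLeft_apply, tensor_s,
      Algebra.TensorProduct.tmul_mul_tmul, one_mul, tensorLift_tmul, shuffle_left, ← map_mul,
      ← map_sub, ← TensorProduct.tmul_sub]
    exact this
  d_t_mul l a := by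
    refine map_mem_of_tmul (tensorLift U d ∘ₗ LinearMap.mulLeft k ((D.tensor U).t l) -
      LinearMap.mulLeft k (1 ⊗ₜ (D.tensor U).t l) ∘ₗ tensorLift U d) (fun u b => ?_) a
    have := shuffle_mem U (Coalgebra.comul u) (h.d_t_mul l b)
    simp only [LinearMap.sub_apply, LinearMap.comp_apply, LinearMap.mulLeft_apply, tensor_t,
      Algebra.TensorProduct.tmul_mul_tmul, one_mul, tensorLift_tmul, shuffle_right, ← map_mul,
      ← map_sub, ← TensorProduct.tmul_sub]
    exact this
  coassoc a := by
    refine map_mem_of_tmul (lift₁ (tensorLift U d) ∘ₗ tensorLift U d -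
      lift₂ (tensorLift U d) ∘ₗ tensorLift U d) (fun u b => ?_) a
    have := shuffle₃_mem U (LinearMap.lTensor U Coalgebra.comul (Coalgebra.comul u))
      (h.coassoc b)
    simp only [LinearMap.sub_apply, LinearMap.comp_apply, tensorLift_tmul, lift₁_shuffle,
      lift₂_shuffle, Coalgebra.coassoc_apply, ← map_sub, ← TensorProduct.tmul_sub]
    exact this
  takeuchi a l := by
    refine map_mem_of_tmul (LinearMap.mulRight k ((D.tensor U).t l ⊗ₜ 1 -
      1 ⊗ₜ (D.tensor U).s l) ∘ₗ tensorLift U d) (fun u b => ?_) a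
    have := shuffle_mem U (Coalgebra.comul u) (h.takeuchi b l)
    simp only [LinearMap.comp_apply, LinearMap.mulRight_apply, tensor_s, tensor_t,
      tensorLift_tmul, shuffle_left, shuffle_right, ← map_sub, ← map_mul,
      ← TensorProduct.tmul_sub, Algebra.TensorProduct.tmul_mul_tmul, mul_one]
    exact this
  d_one := by
    have := shuffle_mem U 1 h.d_one
    rw [Algebra.TensorProduct.one_def, tensorLift_tmul, Bialgebra.comul_one]
    rw [TensorProduct.tmul_sub, map_sub, ← Algebra.TensorProduct.one_def,
      map_one (shuffle k B U)] at this
    exact this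
  d_mul a b := by
    refine map_mem_of_tmul (tensorLift U d ∘ₗ LinearMap.mulRight k b -
      LinearMap.mulRight k (tensorLift U d b) ∘ₗ tensorLift U d) (fun u x => ?_) a
    refine map_mem_of_tmul (tensorLift U d ∘ₗ LinearMap.mulLeft k (u ⊗ₜ x) -
      LinearMap.mulLeft k (tensorLift U d (u ⊗ₜ x)) ∘ₗ tensorLift U d) (fun v y => ?_) b
    have := shuffle_mem U (Coalgebra.comul (u * v)) (h.d_mul x y)
    simp only [LinearMap.sub_apply, LinearMap.comp_apply, LinearMap.mulLeft_apply,
      Algebra.TensorProduct.tmul_mul_tmul, tensorLift_tmul, ← map_mul, Bialgebra.comul_mul,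
      ← map_sub, ← TensorProduct.tmul_sub] at this ⊢
    exact this
  ε_s_mul l a := by
    induction a using TensorProduct.induction_on with
    | zero => simp
    | add x y hx hy => simp only [map_add, mul_add, hx, hy]
    | tmul u b => simp [tensor_s, tensor_ε_tmul, h.ε_s_mul]
  ε_t_mul l a := by
    induction a using TensorProduct.induction_on with
    | zero => simp
    | add x y hx hy => simp only [map_add, mul_add, add_mul, hx, hy]
    | tmul u b => simp [tensor_t, tensor_ε_tmul, h.ε_t_mul]
  ε_one := by
    rw [Algebra.TensorProduct.one_def, tensor_ε_tmul, h.ε_one]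
    simp
  ε_mul_s a b := by
    induction a using TensorProduct.induction_on with
    | zero => simp
    | add x y hx hy => simp only [map_add, add_mul, hx, hy]
    | tmul u x =>
    induction b using TensorProduct.induction_on with
    | zero => simp
    | add x y hx hy => simp only [map_add, mul_add, hx, hy]
    | tmul v y =>
      simp [tensor_s, tensor_ε_tmul, h.ε_mul_s, smul_smul,
        mul_comm (Coalgebra.counit v : k)]
  ε_mul_t a b := by
    induction a using TensorProduct.induction_on with
    | zero => simp
    | add x y hx hy => simp only [map_add, add_mul, hx, hy]
    | tmul u x =>
    induction b using TensorProduct.induction_on with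
    | zero => simp
    | add x y hx hy => simp only [map_add, mul_add, hx, hy]
    | tmul v y =>
      simp [tensor_t, tensor_ε_tmul, h.ε_mul_t, smul_smul,
        mul_comm (Coalgebra.counit v : k)]
  counit_fst a := by
    induction a using TensorProduct.induction_on with
    | zero => simp
    | add x y hx hy => simp only [map_add, hx, hy]
    | tmul u b =>
      rw [tensorLift_tmul, tensor_counitFst_shuffle, h.counit_fst,
        Coalgebra.rTensor_counit_comul]
      simp
  counit_snd a := by
    induction a using TensorProduct.induction_on with
    | zero => simp
    | add x y hx hy => simp only [map_add, hx, hy]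
    | tmul u b =>
      rw [tensorLift_tmul, tensor_counitSnd_shuffle, h.counit_snd,
        Coalgebra.lTensor_counit_comul]
      simp

end BialgebroidData

/-! ### Counits of the R-matrix -/

section RMatrix

variable {k H : Type*} [CommRing k] [Ring H] [Bialgebra k H]

variable (k H) in
/-- The algebra homomorphism `x ⊗ y ↦ ε(x) y`. -/
def counitLeft : H ⊗[k] H →ₐ[k] H :=
  (Algebra.TensorProduct.lid k H).toAlgHom.comp
    (Algebra.TensorProduct.map (Bialgebra.counitAlgHom k H) (AlgHom.id k H))

variable (k H) in
/-- The algebra homomorphism `x ⊗ y ↦ ε(y) x`. -/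
def counitRight : H ⊗[k] H →ₐ[k] H :=
  (counitLeft k H).comp (Algebra.TensorProduct.comm k H H).toAlgHom

@[simp] theorem counitLeft_tmul (x y : H) :
    counitLeft k H (x ⊗ₜ y) = (Coalgebra.counit x : k) • y := rfl

@[simp] theorem counitRight_tmul (x y : H) :
    counitRight k H (x ⊗ₜ y) = (Coalgebra.counit y : k) • x := rfl

theorem counitLeft_comul (h : H) : counitLeft k H (Coalgebra.comul h) = h := by
  change TensorProduct.lid k H (LinearMap.rTensor H Coalgebra.counit (Coalgebra.comul h)) = h
  rw [Coalgebra.rTensor_counit_comul]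
  simp

theorem counitRight_comul (h : H) : counitRight k H (Coalgebra.comul h) = h := by
  have e : ∀ w : H ⊗[k] H, counitRight k H w =
      TensorProduct.rid k H (LinearMap.lTensor H Coalgebra.counit w) := by
    intro w
    induction w using TensorProduct.induction_on with
    | zero => simp
    | add x y hx hy => simp only [map_add, hx, hy]
    | tmul x y => simp
  rw [e, Coalgebra.lTensor_counit_comul]
  simp

theorem leg13_tmul (x y : H) : leg13 (x ⊗ₜ[k] y) = x ⊗ₜ (1 ⊗ₜ y) := rfl

theorem leg12_tmul (x y : H) : leg12 (x ⊗ₜ[k] y) = x ⊗ₜ (y ⊗ₜ 1) := rfl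

theorem leg23_tmul (x y : H) : leg23 (x ⊗ₜ[k] y) = 1 ⊗ₜ (x ⊗ₜ y) := rfl

theorem leg13_zero : leg13 (0 : H ⊗[k] H) = 0 := by simp [leg13]

theorem leg12_zero : leg12 (0 : H ⊗[k] H) = 0 := by simp [leg12]

theorem leg23_zero : leg23 (0 : H ⊗[k] H) = 0 := by simp [leg23]

theorem leg13_add (x y : H ⊗[k] H) : leg13 (x + y) = leg13 x + leg13 y := by simp [leg13]

theorem leg12_add (x y : H ⊗[k] H) : leg12 (x + y) = leg12 x + leg12 y := by simp [leg12]

theorem leg23_add (x y : H ⊗[k] H) : leg23 (x + y) = leg23 x + leg23 y := by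
  simp [leg23, TensorProduct.tmul_add]

namespace IsUniversalRMatrix

variable {R : H ⊗[k] H} (hR : IsUniversalRMatrix R)
include hR

theorem rTensor_comul : LinearMap.rTensor H Coalgebra.comul R =
    (TensorProduct.assoc k H H H).symm (leg13 R * leg23 R) := by
  rw [← hR.comul_left, LinearEquiv.symm_apply_apply]

/-- `ε(R₁) R₂ = 1`. -/
theorem counitLeft_eq_one : counitLeft k H R = 1 := by
  -- Apply ε to the first leg of (Δ ⊗ id)(R) = R₁₃R₂₃. The left side gives R, the right side (1 ⊗
  -- ε(R₁)R₂)R, and R can be cancelled.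
  have h1 : ∀ S : H ⊗[k] H, LinearMap.rTensor H (counitLeft k H).toLinearMap
      (LinearMap.rTensor H Coalgebra.comul S) = S := by
    intro S
    induction S using TensorProduct.induction_on with
    | zero => simp
    | add x y hx hy => simp only [map_add, hx, hy]
    | tmul x y => simp [counitLeft_comul]
  have h2 : ∀ S T : H ⊗[k] H, LinearMap.rTensor H (counitLeft k H).toLinearMap
      ((TensorProduct.assoc k H H H).symm (leg13 S * leg23 T)) =
        (1 ⊗ₜ counitLeft k H S) * T := by
    intro S T
    induction S using TensorProduct.induction_on with
    | zero => simp [leg13_zero]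
    | add x y hx hy =>
      simp only [map_add, leg13_add, add_mul, hx, hy, TensorProduct.tmul_add]
    | tmul x y =>
    induction T using TensorProduct.induction_on with
    | zero => simp [leg23_zero]
    | add x y hx hy => simp only [map_add, leg23_add, mul_add, hx, hy]
    | tmul x' y' => simp [leg13_tmul, leg23_tmul, TensorProduct.smul_tmul]
  have h3 := h1 R
  rw [hR.rTensor_comul, h2] at h3
  have h4 := hR.isUnit.mul_right_cancel (h3.trans (one_mul R).symm)
  -- The equation obtained is 1 ⊗ c = 1 in H ⊗ H; applying ε to the first leg once more extracts c =
  -- 1.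
  simpa using congrArg (counitLeft k H) h4

/-- `R₁ ε(R₂) = 1`. -/
theorem counitRight_eq_one : counitRight k H R = 1 := by
  have h1 : ∀ S : H ⊗[k] H, LinearMap.lTensor H (counitRight k H).toLinearMap
      (LinearMap.lTensor H Coalgebra.comul S) = S := by
    intro S
    induction S using TensorProduct.induction_on with
    | zero => simp
    | add x y hx hy => simp only [map_add, hx, hy]
    | tmul x y => simp [counitRight_comul]
  have h2 : ∀ S T : H ⊗[k] H, LinearMap.lTensor H (counitRight k H).toLinearMap
      (leg13 S * leg12 T) = (counitRight k H S ⊗ₜ 1) * T := by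
    intro S T
    induction S using TensorProduct.induction_on with
    | zero => simp [leg13_zero]
    | add x y hx hy =>
      simp only [map_add, leg13_add, add_mul, hx, hy, TensorProduct.add_tmul]
    | tmul x y =>
    induction T using TensorProduct.induction_on with
    | zero => simp [leg12_zero]
    | add x y hx hy => simp only [map_add, leg12_add, mul_add, hx, hy]
    | tmul x' y' => simp [leg13_tmul, leg12_tmul, TensorProduct.smul_tmul]
  have h3 := h1 R
  rw [hR.comul_right, h2] at h3
  have h4 := hR.isUnit.mul_right_cancel (h3.trans (one_mul R).symm)
  simpa using congrArg (counitRight k H) h4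

end IsUniversalRMatrix

end RMatrix

/-! ### The bialgebroid of the smash product -/

/-- For homomorphisms `i` and `j` to an algebra `A`, the map `a ⊗ b ↦ i(a ▷ m) j(b)`. -/
def crossMap {k H L A : Type*} [CommRing k] [Ring H] [Bialgebra k H] [Ring L] [Algebra k L]
    [Module H L] [IsScalarTower k H L] [Ring A] [Algebra k A] (i : L →ₐ[k] A) (j : H →ₐ[k] A)
    (m : L) : H ⊗[k] H →ₗ[k] A :=
  LinearMap.mul' k _ ∘ₗ TensorProduct.map (i.toLinearMap ∘ₗ (actMap k H L).flip m)
    j.toLinearMap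

namespace Smash

variable {k H L : Type*} [CommRing k] [Ring H] [Bialgebra k H] [Ring L] [Algebra k L]
  [Module H L] [IsScalarTower k H L] [IsModuleAlgebra k H L]

variable (k H L) in
/-- The inclusion `l ↦ l ⊗ 1` of `L` into `L ⋊ H`. -/
def inl : L →ₐ[k] Smash k H L :=
  AlgHom.ofLinearMap (smashSource k H L) rfl (fun l m => by
    change of k H L ((l * m) ⊗ₜ 1) = of k H L (l ⊗ₜ 1) * of k H L (m ⊗ₜ 1)
    rw [of_mul_of, Bialgebra.comul_one, Algebra.TensorProduct.one_def]
    simp)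

variable (k H L) in
/-- The inclusion `h ↦ 1 ⊗ h` of `H` into `L ⋊ H`. -/
def inr : H →ₐ[k] Smash k H L :=
  AlgHom.ofLinearMap ((of k H L).toLinearMap ∘ₗ TensorProduct.mk k L H 1) rfl (fun f g => by
    change of k H L (1 ⊗ₜ (f * g)) = of k H L (1 ⊗ₜ f) * of k H L (1 ⊗ₜ g)
    rw [of_mul_of]
    have e : ∀ w : H ⊗[k] H, TensorProduct.map
        (LinearMap.mulLeft k 1 ∘ₗ (actMap k H L).flip 1) (LinearMap.mulRight k g) w =
        1 ⊗ₜ (counitLeft k H w * g) := by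
      intro w
      induction w using TensorProduct.induction_on with
      | zero => simp
      | add x y hx hy => simp only [map_add, hx, hy, add_mul, TensorProduct.tmul_add]
      | tmul x y =>
        simp [IsModuleAlgebra.smul_one' (k := k), Algebra.algebraMap_eq_smul_one,
          TensorProduct.smul_tmul]
    rw [e, counitLeft_comul])

theorem of_tmul (l : L) (h : H) : of k H L (l ⊗ₜ h) = inl k H L l * inr k H L h := by
  change _ = of k H L (l ⊗ₜ 1) * of k H L (1 ⊗ₜ h)
  rw [of_mul_of, Bialgebra.comul_one, Algebra.TensorProduct.one_def]
  simp

theorem inl_eq (l : L) : of k H L (l ⊗ₜ 1) = inl k H L l := rfl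

theorem inr_eq (h : H) : of k H L (1 ⊗ₜ h) = inr k H L h := rfl

theorem induction_on {p : Smash k H L → Prop} (x : Smash k H L) (zero : p 0)
    (add : ∀ x y, p x → p y → p (x + y)) (mul : ∀ l h, p (inl k H L l * inr k H L h)) : p x := by
  obtain ⟨x, rfl⟩ := (of k H L).surjective x
  induction x using TensorProduct.induction_on with
  | zero => simpa using zero
  | add x y hx hy => rw [map_add]; exact add _ _ hx hy
  | tmul l h => rw [of_tmul]; exact mul l h

/-- The map `a ⊗ b ↦ (a ▷ m) ⊗ b`. -/
def crossing (m : L) : H ⊗[k] H →ₗ[k] Smash k H L :=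
  crossMap (inl k H L) (inr k H L) m

theorem crossing_tmul (m : L) (a b : H) :
    crossing m (a ⊗ₜ[k] b) = inl k H L (a • m) * inr k H L b := rfl

theorem inr_mul_inl (h : H) (m : L) :
    inr k H L h * inl k H L m = crossing m (Coalgebra.comul h) := by
  change of k H L (1 ⊗ₜ h) * of k H L (m ⊗ₜ 1) = _
  rw [of_mul_of]
  generalize (Coalgebra.comul h : H ⊗[k] H) = w
  induction w using TensorProduct.induction_on with
  | zero => simp
  | add x y hx hy => simp only [map_add, hx, hy]
  | tmul x y => simp [crossing_tmul, of_tmul]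

theorem smashTarget_eq (S : H ⊗[k] H) (l : L) :
    smashTarget L S l = crossing l (TensorProduct.comm k H H S) := by
  induction S using TensorProduct.induction_on with
  | zero => simp [smashTarget]
  | add x y hx hy =>
    simp only [map_add, ← hx, ← hy]
    simp [smashTarget]
  | tmul x y => rw [smashTarget_tmul, of_tmul]; rfl

theorem smashTarget_zero : smashTarget L (0 : H ⊗[k] H) = 0 := by
  ext l
  simp [smashTarget_eq]

theorem smashTarget_add (S T : H ⊗[k] H) :
    smashTarget L (S + T) = smashTarget L S + smashTarget L T := by
  ext l
  simp [smashTarget_eq]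

theorem smashSource_eq (l : L) : smashSource k H L l = inl k H L l := rfl

variable {R : H ⊗[k] H}

/-- Moving R₁ past l gives (R₂ ▷ m)(R₁⁽¹⁾ ▷ l)R₁⁽²⁾, and (Δ ⊗ id)(R) = R₁₃R₂₃ makes this (S₂T₂ ▷
m)(S₁ ▷ l)T₁ with S, T two copies of R. H-commutativity, applied to l and T₂ ▷ m, contracts S and
leaves l(T₂ ▷ m)T₁. -/
theorem target_mul_inl (hR : IsUniversalRMatrix R) (hL : IsQuasiCommutative L R) (l m : L) :
    smashTarget L R m * inl k H L l = inl k H L l * smashTarget L R m := by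
  let Θ : (H ⊗[k] H) ⊗[k] H →ₗ[k] Smash k H L := LinearMap.mul' k _ ∘ₗ
    TensorProduct.map ((inl k H L).toLinearMap ∘ₗ (actMap k H L).flip m) (crossing l) ∘ₗ
    (TensorProduct.comm k _ _).toLinearMap
  have h1 : ∀ S : H ⊗[k] H, crossing m (TensorProduct.comm k H H S) * inl k H L l =
      Θ (LinearMap.rTensor H Coalgebra.comul S) := by
    intro S
    induction S using TensorProduct.induction_on with
    | zero => simp
    | add x y hx hy => simp only [map_add, add_mul, hx, hy]
    | tmul x y => simp [Θ, crossing_tmul, mul_assoc, inr_mul_inl]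
  have h2 : ∀ S T : H ⊗[k] H, Θ ((TensorProduct.assoc k H H H).symm (leg13 S * leg23 T)) =
      LinearMap.mul' k _ (TensorProduct.map ((inl k H L).toLinearMap ∘ₗ LinearMap.mul' k L ∘ₗ
        (actMap₂ k H L (TensorProduct.comm k H H S)) ∘ₗ (TensorProduct.mk k L L).flip l)
        LinearMap.id (TensorProduct.map ((actMap k H L).flip m) (inr k H L).toLinearMap
          (TensorProduct.comm k H H T))) := by
    intro S T
    induction S using TensorProduct.induction_on with
    | zero => simp [leg13_zero]
    | add x y hx hy =>
      simp only [map_add, leg13_add, add_mul, hx, hy, LinearMap.add_comp, LinearMap.comp_add,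
        TensorProduct.map_add_left, LinearMap.add_apply]
    | tmul x y =>
    induction T using TensorProduct.induction_on with
    | zero => simp [leg23_zero]
    | add x y hx hy => simp only [map_add, leg23_add, mul_add, hx, hy]
    | tmul x' y' =>
      simp [leg13_tmul, leg23_tmul, Θ, crossing_tmul, actMap₂, mul_assoc, mul_smul]
  have h3 : (LinearMap.mul' k L ∘ₗ (actMap₂ k H L (TensorProduct.comm k H H R)) ∘ₗ
      (TensorProduct.mk k L L).flip l) = LinearMap.mulLeft k l := by
    ext n
    exact (hL l n).symm
  have h4 : ∀ T : H ⊗[k] H, LinearMap.mul' k _ (TensorProduct.map ((inl k H L).toLinearMap ∘ₗ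
      LinearMap.mulLeft k l) LinearMap.id (TensorProduct.map ((actMap k H L).flip m)
        (inr k H L).toLinearMap T)) = inl k H L l * crossing m T := by
    intro T
    induction T using TensorProduct.induction_on with
    | zero => simp
    | add x y hx hy => simp only [map_add, mul_add, hx, hy]
    | tmul x y => simp [crossing_tmul, mul_assoc]
  rw [smashTarget_eq, h1, hR.rTensor_comul, h2, h3, h4]

/-- By (id ⊗ Δ)(R) = R₁₃R₁₂ with copies S and T, t(lm) = (T₂ ▷ l)(S₂ ▷ m)S₁T₁ = (T₂ ▷ l) t(m) T₁.
The target t(m) commutes with L, so it moves to the front and leaves t(l). -/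
theorem target_mul (hR : IsUniversalRMatrix R) (hL : IsQuasiCommutative L R) (l m : L) :
    smashTarget L R (l * m) = smashTarget L R m * smashTarget L R l := by
  let Θ : H ⊗[k] (H ⊗[k] H) →ₗ[k] Smash k H L := LinearMap.mul' k _ ∘ₗ
    TensorProduct.map ((inl k H L).toLinearMap ∘ₗ LinearMap.mul' k L ∘ₗ
      (actMap₂ k H L).flip (l ⊗ₜ m)) (inr k H L).toLinearMap ∘ₗ
    (TensorProduct.comm k _ _).toLinearMap
  have h1 : ∀ S : H ⊗[k] H, crossing (l * m) (TensorProduct.comm k H H S) =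
      Θ (LinearMap.lTensor H Coalgebra.comul S) := by
    intro S
    induction S using TensorProduct.induction_on with
    | zero => simp
    | add x y hx hy => simp only [map_add, hx, hy]
    | tmul x y => simp [Θ, crossing_tmul, IsModuleAlgebra.smul_mul' (k := k)]
  have h2 : ∀ S T : H ⊗[k] H, Θ (leg13 S * leg12 T) =
      TensorProduct.lift ((LinearMap.mul k (Smash k H L)).compl₁₂
        ((inl k H L).toLinearMap ∘ₗ (actMap k H L).flip l)
        (LinearMap.mulLeft k (crossing m (TensorProduct.comm k H H S)) ∘ₗ
          (inr k H L).toLinearMap)) (TensorProduct.comm k H H T) := by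
    intro S T
    induction T using TensorProduct.induction_on with
    | zero => simp [leg12_zero]
    | add x y hx hy => simp only [map_add, leg12_add, mul_add, hx, hy]
    | tmul x' y' =>
    induction S using TensorProduct.induction_on with
    | zero => simp [leg13_zero]
    | add x y hx hy =>
      simp only [TensorProduct.comm_tmul, TensorProduct.lift.tmul, LinearMap.compl₁₂_apply,
        LinearMap.mul_apply', LinearMap.comp_apply, LinearMap.mulLeft_apply] at hx hy ⊢
      simp only [map_add, leg13_add, add_mul, mul_add, hx, hy]
    | tmul x y =>
      simp [leg13_tmul, leg12_tmul, Θ, crossing_tmul, actMap₂, mul_assoc]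
  have h3 : ∀ T : H ⊗[k] H, TensorProduct.lift ((LinearMap.mul k (Smash k H L)).compl₁₂
        ((inl k H L).toLinearMap ∘ₗ (actMap k H L).flip l)
        (LinearMap.mulLeft k (smashTarget L R m) ∘ₗ (inr k H L).toLinearMap)) T =
      smashTarget L R m * crossing l T := by
    intro T
    induction T using TensorProduct.induction_on with
    | zero => simp
    | add x y hx hy => simp only [map_add, mul_add, hx, hy]
    | tmul x y => simp [crossing_tmul, ← mul_assoc, target_mul_inl hR hL]
  rw [smashTarget_eq, h1, hR.comul_right, h2, ← smashTarget_eq, h3, ← smashTarget_eq]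

theorem target_one (hR : IsUniversalRMatrix R) : smashTarget L R 1 = 1 := by
  have h : ∀ S : H ⊗[k] H, crossing (1 : L) (TensorProduct.comm k H H S) =
      inr k H L (counitRight k H S) := by
    intro S
    induction S using TensorProduct.induction_on with
    | zero => simp
    | add x y hx hy => simp only [map_add, hx, hy]
    | tmul x y =>
      simp [crossing_tmul, IsModuleAlgebra.smul_one' (k := k), Algebra.smul_def]
  rw [smashTarget_eq, h, hR.counitRight_eq_one, map_one]

/-- `h t(l) = t(h₂ ▷ l) h₁`. -/
theorem inr_mul_target (hR : IsUniversalRMatrix R) (h : H) (l : L) :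
    inr k H L h * smashTarget L R l =
      crossing l (TensorProduct.comm k H H (R * Coalgebra.comul h)) := by
  have e : ∀ S : H ⊗[k] H, inr k H L h * crossing l (TensorProduct.comm k H H S) =
      crossing l (TensorProduct.comm k H H
        (TensorProduct.comm k H H (Coalgebra.comul h) * S)) := by
    intro S
    induction S using TensorProduct.induction_on with
    | zero => simp
    | add x y hx hy => simp only [map_add, mul_add, hx, hy]
    | tmul x y =>
      rw [TensorProduct.comm_tmul, crossing_tmul, ← mul_assoc, inr_mul_inl]
      generalize (Coalgebra.comul h : H ⊗[k] H) = w
      induction w using TensorProduct.induction_on with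
      | zero => simp
      | add x y hx hy => simp only [map_add, add_mul, hx, hy]
      | tmul a b => simp [crossing_tmul, mul_smul, mul_assoc]
  rw [hR.mul_comul, smashTarget_eq, e]

theorem counit_inl_mul (l : L) (x : Smash k H L) :
    smashCounit k H L (inl k H L l * x) = l * smashCounit k H L x := by
  induction x using induction_on with
  | zero => simp
  | add x y hx hy => simp only [mul_add, map_add, hx, hy]
  | mul m h =>
    rw [← mul_assoc, ← map_mul, ← of_tmul, ← of_tmul, smashCounit_of, smashCounit_of,
      mul_smul_comm]

theorem counit_mul_inr (x : Smash k H L) (h : H) :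
    smashCounit k H L (x * inr k H L h) = (Coalgebra.counit h : k) • smashCounit k H L x := by
  induction x using induction_on with
  | zero => simp
  | add x y hx hy => simp only [add_mul, smul_add, map_add, hx, hy]
  | mul m g =>
    rw [mul_assoc, ← map_mul, ← of_tmul, ← of_tmul, smashCounit_of, smashCounit_of,
      smul_smul, Bialgebra.counit_mul, mul_comm]

theorem counit_inl (l : L) : smashCounit k H L (inl k H L l) = l := by
  simp [← inl_eq, smashCounit_of]

theorem counit_crossing (l : L) (w : H ⊗[k] H) :
    smashCounit k H L (crossing l w) = counitRight k H w • l := by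
  induction w using TensorProduct.induction_on with
  | zero => simp
  | add x y hx hy => simp only [map_add, add_smul, hx, hy]
  | tmul x y => simp [crossing_tmul, ← of_tmul, smashCounit_of]

/-- Because ε(R₁)R₂ = 1, the target map gives the same anchor action as the source map; this is the
content of ε(a t(ε(b))) = ε(ab). -/
theorem counit_inr_mul_target (hR : IsUniversalRMatrix R) (h : H) (l : L) :
    smashCounit k H L (inr k H L h * smashTarget L R l) = h • l := by
  have e : ∀ w : H ⊗[k] H, counitRight k H (TensorProduct.comm k H H w) = counitLeft k H w := by
    intro w
    induction w using TensorProduct.induction_on with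
    | zero => simp
    | add x y hx hy => simp only [map_add, hx, hy]
    | tmul x y => simp
  rw [inr_mul_target hR, counit_crossing, e, map_mul, counitLeft_comul, hR.counitLeft_eq_one,
    one_mul]

theorem counit_inr_mul_inl (h : H) (l : L) :
    smashCounit k H L (inr k H L h * inl k H L l) = h • l := by
  rw [inr_mul_inl, counit_crossing, counitRight_comul]

theorem counit_target (hR : IsUniversalRMatrix R) (l : L) :
    smashCounit k H L (smashTarget L R l) = l := by
  simpa using counit_inr_mul_target hR 1 l

variable (k H L) in
/-- The algebra homomorphism `f ⊗ g ↦ (1 ⊗ f) ⊗ (1 ⊗ g)`. -/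
def inr₂ : H ⊗[k] H →ₐ[k] Smash k H L ⊗[k] Smash k H L :=
  Algebra.TensorProduct.map (inr k H L) (inr k H L)

theorem inr₂_tmul (x y : H) : inr₂ k H L (x ⊗ₜ y) = inr k H L x ⊗ₜ inr k H L y := rfl

theorem comul_inl_mul_inr (l : L) (h : H) :
    smashComul k H L (inl k H L l * inr k H L h) =
      (inl k H L l ⊗ₜ 1) * inr₂ k H L (Coalgebra.comul h) := by
  rw [← of_tmul, smashComul_of]
  generalize (Coalgebra.comul h : H ⊗[k] H) = w
  induction w using TensorProduct.induction_on with
  | zero => simp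
  | add x y hx hy => simp only [map_add, mul_add, hx, hy]
  | tmul x y => simp [inr₂_tmul, of_tmul]

theorem comul_inr (h : H) :
    smashComul k H L (inr k H L h) = inr₂ k H L (Coalgebra.comul h) := by
  have := comul_inl_mul_inr (k := k) (1 : L) h
  rwa [map_one, one_mul, ← Algebra.TensorProduct.one_def, one_mul] at this

theorem comul_inl_mul (l : L) (x : Smash k H L) :
    smashComul k H L (inl k H L l * x) = (inl k H L l ⊗ₜ 1) * smashComul k H L x := by
  induction x using induction_on with
  | zero => simp
  | add x y hx hy => simp only [mul_add, map_add, hx, hy]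
  | mul m h =>
    rw [← mul_assoc, ← map_mul, comul_inl_mul_inr, comul_inl_mul_inr, ← mul_assoc]
    simp

theorem comul_mul_inr (x : Smash k H L) (h : H) :
    smashComul k H L (x * inr k H L h) =
      smashComul k H L x * inr₂ k H L (Coalgebra.comul h) := by
  induction x using induction_on with
  | zero => simp
  | add x y hx hy => simp only [add_mul, map_add, hx, hy]
  | mul m g =>
    rw [mul_assoc, ← map_mul, comul_inl_mul_inr, comul_inl_mul_inr, mul_assoc, ← map_mul,
      Bialgebra.comul_mul]

theorem comul_crossing (l : L) (w : H ⊗[k] H) :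
    smashComul k H L (crossing l w) =
      TensorProduct.map (crossing l) (inr k H L).toLinearMap
        ((TensorProduct.assoc k H H H).symm (LinearMap.lTensor H Coalgebra.comul w)) := by
  induction w using TensorProduct.induction_on with
  | zero => simp
  | add x y hx hy => simp only [map_add, hx, hy]
  | tmul x y =>
    rw [crossing_tmul, comul_inl_mul_inr, LinearMap.lTensor_tmul]
    generalize (Coalgebra.comul y : H ⊗[k] H) = w
    induction w using TensorProduct.induction_on with
    | zero => simp
    | add x y hx hy => simp only [map_add, mul_add, TensorProduct.tmul_add, hx, hy]
    | tmul a b => simp [inr₂_tmul, crossing_tmul]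

theorem comul_inr_mul_inl (h : H) (l : L) :
    smashComul k H L (inr k H L h * inl k H L l) =
      inr₂ k H L (Coalgebra.comul h) * (inl k H L l ⊗ₜ 1) := by
  rw [inr_mul_inl, comul_crossing, Coalgebra.coassoc_symm_apply]
  generalize (Coalgebra.comul h : H ⊗[k] H) = w
  induction w using TensorProduct.induction_on with
  | zero => simp
  | add x y hx hy => simp only [map_add, add_mul, hx, hy]
  | tmul a b => simp [inr₂_tmul, inr_mul_inl]

theorem comul_mul (x y : Smash k H L) :
    smashComul k H L (x * y) = smashComul k H L x * smashComul k H L y := by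
  induction x using induction_on with
  | zero => simp
  | add x x' hx hx' => simp only [add_mul, map_add, hx, hx']
  | mul l f =>
  induction y using induction_on with
  | zero => simp
  | add y y' hy hy' => simp only [mul_add, map_add, hy, hy']
  | mul m g =>
    rw [mul_assoc, ← mul_assoc (inr k H L f), comul_inl_mul, comul_mul_inr, comul_inr_mul_inl,
      comul_inl_mul_inr, comul_inl_mul_inr]
    simp only [mul_assoc]

theorem target_mul_source (hR : IsUniversalRMatrix R) (hL : IsQuasiCommutative L R) (l m : L) :
    smashSource k H L l * smashTarget L R m = smashTarget L R m * smashSource k H L l :=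
  (target_mul_inl hR hL l m).symm

/-- With copies S, T of R, splitting Δ(R₁) by (Δ ⊗ id)(R) = R₁₃R₂₃ gives (S₂T₂ ▷ l)S₁ ⊗ T₁ = t(T₂ ▷
l) ⊗ T₁. The balancing relation turns this into 1 ⊗ (T₂ ▷ l)T₁. Unlike multiplicativity and
coassociativity, which hold exactly for `smashComul`, this identity needs the relations. -/
theorem comul_target (hR : IsUniversalRMatrix R) (l : L) :
    smashComul k H L (smashTarget L R l) - 1 ⊗ₜ smashTarget L R l ∈
      balRel (smashSource k H L) (smashTarget L R) := by
  let Θ : (H ⊗[k] H) ⊗[k] H →ₗ[k] Smash k H L ⊗[k] Smash k H L :=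
    LinearMap.mul' k _ ∘ₗ TensorProduct.map
      ((TensorProduct.mk k _ _).flip 1 ∘ₗ (inl k H L).toLinearMap ∘ₗ (actMap k H L).flip l)
      (inr₂ k H L).toLinearMap ∘ₗ (TensorProduct.comm k _ _).toLinearMap
  have h1 : ∀ S : H ⊗[k] H, smashComul k H L (crossing l (TensorProduct.comm k H H S)) =
      Θ (LinearMap.rTensor H Coalgebra.comul S) := by
    intro S
    induction S using TensorProduct.induction_on with
    | zero => simp
    | add x y hx hy => simp only [map_add, hx, hy]
    | tmul x y => simp [Θ, crossing_tmul, comul_inl_mul_inr]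
  have h2 : ∀ S T : H ⊗[k] H, Θ ((TensorProduct.assoc k H H H).symm (leg13 S * leg23 T)) =
      TensorProduct.map (smashTarget L S ∘ₗ (actMap k H L).flip l)
        (inr k H L).toLinearMap (TensorProduct.comm k H H T) := by
    intro S T
    induction S using TensorProduct.induction_on with
    | zero => simp [leg13_zero, smashTarget_zero, TensorProduct.map_zero_left]
    | add x y hx hy =>
      simp only [map_add, leg13_add, add_mul, hx, hy, smashTarget_add, LinearMap.add_comp,
        TensorProduct.map_add_left, LinearMap.add_apply]
    | tmul x y =>
    induction T using TensorProduct.induction_on with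
    | zero => simp [leg23_zero]
    | add x y hx hy => simp only [map_add, leg23_add, mul_add, hx, hy]
    | tmul x' y' =>
      simp [leg13_tmul, leg23_tmul, Θ, inr₂_tmul, smashTarget_eq, crossing_tmul, mul_smul]
  have h3 : ∀ T : H ⊗[k] H, TensorProduct.map (smashTarget L R ∘ₗ (actMap k H L).flip l)
      (inr k H L).toLinearMap T - 1 ⊗ₜ crossing l T ∈
        balRel (smashSource k H L) (smashTarget L R) := by
    intro T
    induction T using TensorProduct.induction_on with
    | zero => simp
    | add x y hx hy =>
      rw [map_add, map_add, TensorProduct.tmul_add, add_sub_add_comm]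
      exact add_mem hx hy
    | tmul x y =>
      refine Submodule.subset_span ⟨x • l, 1, inr k H L y, ?_⟩
      rw [mul_one]
      rfl
  have h4 := h3 (TensorProduct.comm k H H R)
  rwa [← h2, ← hR.rTensor_comul, ← h1, ← smashTarget_eq] at h4

/-- The chain is h₁t(l) ⊗ h₂ = t(h₂ ▷ l)h₁ ⊗ h₃ ≡ h₁ ⊗ (h₂ ▷ l)h₃ = h₁ ⊗ h₂ s(l), where the first
equality comes from RΔ(h) = Δᵒᵖ(h)R and the congruence is the balancing relation. -/
theorem inr₂_takeuchi (hR : IsUniversalRMatrix R) (h : H) (l : L) :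
    inr₂ k H L (Coalgebra.comul h) *
      (smashTarget L R l ⊗ₜ 1 - 1 ⊗ₜ smashSource k H L l) ∈
        balRel (smashSource k H L) (smashTarget L R) := by
  let Θ : H ⊗[k] (H ⊗[k] H) →ₗ[k] Smash k H L ⊗[k] Smash k H L :=
    LinearMap.mul' k _ ∘ₗ TensorProduct.map
      ((TensorProduct.mk k _ _).flip 1 ∘ₗ smashTarget L R ∘ₗ (actMap k H L).flip l)
      (inr₂ k H L).toLinearMap ∘ₗ (TensorProduct.leftComm k H H H).toLinearMap
  have h0 : ∀ (S w : H ⊗[k] H) (c : H),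
      crossing l (TensorProduct.comm k H H (S * w)) ⊗ₜ inr k H L c =
        LinearMap.mul' k _ (TensorProduct.map
          ((TensorProduct.mk k _ _).flip 1 ∘ₗ smashTarget L S ∘ₗ (actMap k H L).flip l)
          (inr₂ k H L).toLinearMap
          (TensorProduct.leftComm k H H H (TensorProduct.assoc k H H H (w ⊗ₜ c)))) := by
    intro S w c
    induction w using TensorProduct.induction_on with
    | zero => simp
    | add x y hx hy => simp only [map_add, mul_add, TensorProduct.add_tmul, hx, hy]
    | tmul a b =>
    induction S using TensorProduct.induction_on with
    | zero => simp [smashTarget_zero]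
    | add x y hx hy =>
      simp only [map_add, add_mul, TensorProduct.add_tmul, hx, hy, smashTarget_add,
        LinearMap.add_comp, LinearMap.comp_add, TensorProduct.map_add_left, LinearMap.add_apply]
    | tmul x y => simp [inr₂_tmul, smashTarget_eq, crossing_tmul, mul_smul, mul_assoc]
  have h1 : ∀ w : H ⊗[k] H, inr₂ k H L w * (smashTarget L R l ⊗ₜ 1) =
      Θ (TensorProduct.assoc k H H H (LinearMap.rTensor H Coalgebra.comul w)) := by
    intro w
    induction w using TensorProduct.induction_on with
    | zero => simp
    | add x y hx hy => simp only [map_add, add_mul, hx, hy]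
    | tmul a b =>
      rw [inr₂_tmul, Algebra.TensorProduct.tmul_mul_tmul, inr_mul_target hR, mul_one,
        LinearMap.rTensor_tmul, h0]
      rfl
  have h2 : ∀ w : H ⊗[k] H, Θ (LinearMap.lTensor H Coalgebra.comul w) -
      inr₂ k H L w * (1 ⊗ₜ smashSource k H L l) ∈
        balRel (smashSource k H L) (smashTarget L R) := by
    intro w
    induction w using TensorProduct.induction_on with
    | zero => simp
    | add x y hx hy =>
      rw [map_add, map_add, map_add, add_mul, add_sub_add_comm]
      exact add_mem hx hy
    | tmul a b =>
      rw [inr₂_tmul, Algebra.TensorProduct.tmul_mul_tmul, mul_one, smashSource_eq, inr_mul_inl,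
        LinearMap.lTensor_tmul]
      generalize (Coalgebra.comul b : H ⊗[k] H) = w
      induction w using TensorProduct.induction_on with
      | zero => simp
      | add x y hx hy =>
        rw [map_add, TensorProduct.tmul_add, TensorProduct.tmul_add, map_add, add_sub_add_comm]
        exact add_mem hx hy
      | tmul b c =>
        refine Submodule.subset_span ⟨b • l, inr k H L a, inr k H L c, ?_⟩
        simp [Θ, inr₂_tmul, crossing_tmul, smashSource_eq]
  rw [mul_sub, h1, Coalgebra.coassoc_apply]
  exact h2 _

theorem inl_mul_mem (hR : IsUniversalRMatrix R) (hL : IsQuasiCommutative L R) (l : L)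
    {x : Smash k H L ⊗[k] Smash k H L}
    (hx : x ∈ balRel (smashSource k H L) (smashTarget L R)) :
    (inl k H L l ⊗ₜ 1) * x ∈ balRel (smashSource k H L) (smashTarget L R) := by
  refine mul_balRel_mem (fun m => ?_) hx
  have e : (inl k H L l ⊗ₜ 1 : Smash k H L ⊗[k] Smash k H L) *
      (smashTarget L R m ⊗ₜ 1 - 1 ⊗ₜ smashSource k H L m) =
      (smashTarget L R m ⊗ₜ 1 - 1 ⊗ₜ smashSource k H L m) * (inl k H L l ⊗ₜ 1) := by
    simp [mul_sub, sub_mul, target_mul_inl hR hL]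
  rw [e]
  exact balRel_mul_mem _ _ (balRel_gen_mem _ _ m) _

theorem lift₁_comul (x : Smash k H L) :
    lift₁ (smashComul k H L) (smashComul k H L x) =
      lift₂ (smashComul k H L) (smashComul k H L x) := by
  have h1 : ∀ (l : L) (w : Smash k H L ⊗[k] Smash k H L), lift₁ (smashComul k H L)
      ((inl k H L l ⊗ₜ 1) * w) = (inl k H L l ⊗ₜ 1) * lift₁ (smashComul k H L) w := by
    intro l w
    induction w using TensorProduct.induction_on with
    | zero => simp
    | add x y hx hy => simp only [map_add, mul_add, hx, hy]
    | tmul x y =>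
      rw [Algebra.TensorProduct.tmul_mul_tmul, lift₁_tmul, comul_inl_mul, lift₁_tmul, map_mul,
        inl₁₂_tmul, one_mul, mul_assoc]
      rfl
  have h2 : ∀ (l : L) (w : Smash k H L ⊗[k] Smash k H L), lift₂ (smashComul k H L)
      ((inl k H L l ⊗ₜ 1) * w) = (inl k H L l ⊗ₜ 1) * lift₂ (smashComul k H L) w := by
    intro l w
    induction w using TensorProduct.induction_on with
    | zero => simp
    | add x y hx hy => simp only [map_add, mul_add, hx, hy]
    | tmul x y => simp [lift₂]
  have h3 : ∀ w : H ⊗[k] H, lift₁ (smashComul k H L) (inr₂ k H L w) =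
      TensorProduct.map (inr k H L).toLinearMap (inr₂ k H L).toLinearMap
        (TensorProduct.assoc k H H H (LinearMap.rTensor H Coalgebra.comul w)) := by
    intro w
    induction w using TensorProduct.induction_on with
    | zero => simp
    | add x y hx hy => simp only [map_add, hx, hy]
    | tmul a b =>
      rw [inr₂_tmul, lift₁_tmul, comul_inr, LinearMap.rTensor_tmul]
      generalize (Coalgebra.comul a : H ⊗[k] H) = w
      induction w using TensorProduct.induction_on with
      | zero => simp
      | add x y hx hy => simp only [map_add, add_mul, TensorProduct.add_tmul, hx, hy]
      | tmul a c => simp [inr₂_tmul, inl₁₂_tmul]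
  have h4 : ∀ w : H ⊗[k] H, lift₂ (smashComul k H L) (inr₂ k H L w) =
      TensorProduct.map (inr k H L).toLinearMap (inr₂ k H L).toLinearMap
        (LinearMap.lTensor H Coalgebra.comul w) := by
    intro w
    induction w using TensorProduct.induction_on with
    | zero => simp
    | add x y hx hy => simp only [map_add, hx, hy]
    | tmul a b => simp [lift₂, inr₂_tmul, comul_inr]
  induction x using induction_on with
  | zero => simp
  | add x y hx hy => simp only [map_add, hx, hy]
  | mul l h => rw [comul_inl_mul_inr, h1, h2, h3, h4, Coalgebra.coassoc_apply]

theorem smashPlus_counitFst (l : L) (w : H ⊗[k] H) :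
    (smashPlus L R).counitFst ((inl k H L l ⊗ₜ 1) * inr₂ k H L w) =
      inl k H L l * inr k H L (counitLeft k H w) := by
  induction w using TensorProduct.induction_on with
  | zero => simp
  | add x y hx hy => simp only [map_add, mul_add, hx, hy]
  | tmul x y =>
    rw [inr₂_tmul, Algebra.TensorProduct.tmul_mul_tmul, BialgebroidData.counitFst_tmul]
    change inl k H L (smashCounit k H L _) * _ = _
    rw [← of_tmul, smashCounit_of]
    simp

theorem smashPlus_counitSnd (hR : IsUniversalRMatrix R) (l : L) (w : H ⊗[k] H) :
    (smashPlus L R).counitSnd ((inl k H L l ⊗ₜ 1) * inr₂ k H L w) =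
      inl k H L l * inr k H L (counitRight k H w) := by
  induction w using TensorProduct.induction_on with
  | zero => simp
  | add x y hx hy => simp only [map_add, mul_add, hx, hy]
  | tmul x y =>
    rw [inr₂_tmul, Algebra.TensorProduct.tmul_mul_tmul, BialgebroidData.counitSnd_tmul]
    change smashTarget L R (smashCounit k H L _) * _ = _
    rw [one_mul, ← inr_eq, smashCounit_of, map_smul, target_one hR]
    simp

theorem isLiftedBialgebroid_smashPlus (hR : IsUniversalRMatrix R)
    (hL : IsQuasiCommutative L R) :
    (smashPlus L R).IsLiftedBialgebroid (smashComul k H L) where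
  Δ_eq := rfl
  s_one := map_one (inl k H L)
  s_mul := map_mul (inl k H L)
  t_one := target_one hR
  t_mul := target_mul hR hL
  s_mul_t := target_mul_source hR hL
  d_s_mul l a := by
    change smashComul k H L (inl k H L l * a) - (inl k H L l ⊗ₜ 1) * smashComul k H L a ∈ _
    rw [comul_inl_mul, sub_self]
    exact zero_mem _
  d_t_mul l a := by
    have := balRel_mul_mem _ _ (comul_target hR l) (smashComul k H L a)
    rwa [sub_mul, ← comul_mul] at this
  coassoc a := by
    rw [lift₁_comul, sub_self]
    exact zero_mem _
  takeuchi a l := by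
    induction a using induction_on with
    | zero => simp
    | add x y hx hy => rw [map_add, add_mul]; exact add_mem hx hy
    | mul m h =>
      rw [comul_inl_mul_inr, mul_assoc]
      exact inl_mul_mem hR hL m (inr₂_takeuchi hR h l)
  d_one := by
    have := comul_inr (L := L) (k := k) (1 : H)
    rw [Bialgebra.comul_one, map_one (inr k H L), map_one (inr₂ k H L)] at this
    rw [this, sub_self]
    exact zero_mem _
  d_mul a b := by
    rw [comul_mul, sub_self]
    exact zero_mem _
  ε_s_mul := counit_inl_mul
  ε_t_mul l a := by
    change smashCounit k H L (smashTarget L R l * a) = smashCounit k H L a * l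
    induction a using induction_on with
    | zero => simp
    | add x y hx hy => simp only [mul_add, map_add, hx, hy, add_mul]
    | mul m h =>
      rw [← mul_assoc, target_mul_inl hR hL, mul_assoc, counit_inl_mul, counit_mul_inr,
        counit_target hR, counit_mul_inr, counit_inl]
      simp
  ε_one := by
    change smashCounit k H L 1 = 1
    simpa using counit_inl (k := k) (H := H) (1 : L)
  ε_mul_s a b := by
    change smashCounit k H L (a * inl k H L (smashCounit k H L b)) = smashCounit k H L (a * b)
    induction b using induction_on with
    | zero => simp
    | add x y hx hy => simp only [mul_add, map_add, hx, hy]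
    | mul m h => rw [← mul_assoc, counit_mul_inr, counit_mul_inr, counit_inl]; simp
  ε_mul_t a b := by
    change smashCounit k H L (a * smashTarget L R (smashCounit k H L b)) =
      smashCounit k H L (a * b)
    induction b using induction_on with
    | zero => simp
    | add x y hx hy => simp only [mul_add, map_add, hx, hy]
    | mul m h =>
      rw [← mul_assoc, counit_mul_inr, counit_mul_inr, counit_inl, map_smul, mul_smul_comm,
        map_smul]
      congr 1
      induction a using induction_on with
      | zero => simp
      | add x y hx hy => simp only [add_mul, map_add, hx, hy]
      | mul n g =>
        rw [mul_assoc, mul_assoc, counit_inl_mul, counit_inl_mul, counit_inr_mul_target hR,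
          counit_inr_mul_inl]
  counit_fst a := by
    induction a using induction_on with
    | zero => simp
    | add x y hx hy => simp only [map_add, hx, hy]
    | mul l h => rw [comul_inl_mul_inr, smashPlus_counitFst, counitLeft_comul]
  counit_snd a := by
    induction a using induction_on with
    | zero => simp
    | add x y hx hy => simp only [map_add, hx, hy]
    | mul l h => rw [comul_inl_mul_inr, smashPlus_counitSnd hR, counitRight_comul]

end Smash

/-! ### The representative P and the comparison of the two sets of relations -/

section Twist

open BialgebroidData

variable {k H U L A : Type*} [CommRing k] [Ring H] [Bialgebra k H] [Ring U] [Bialgebra k U]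
  [Ring L] [Algebra k L] [Module H L] [IsScalarTower k H L]
  [Ring A] [Algebra k A]

/-- The bialgebroid `D` on `A`, with lift `d` of the coproduct, has the structure maps of the
smash product `L₊ ⋊ H`, expressed through the images `i` and `j` of `L` and `H` in `A`. -/
structure IsSmashBialgebroid (D : BialgebroidData k L A) (d : A →ₗ[k] A ⊗[k] A)
    (R : H ⊗[k] H) (i : L →ₐ[k] A) (j : H →ₐ[k] A) : Prop where
  isLifted : D.IsLiftedBialgebroid d
  s_eq : ∀ l, D.s l = i l
  t_eq : ∀ l, D.t l = crossMap i j l (TensorProduct.comm k H H R)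
  j_mul_i : ∀ h l, j h * i l = crossMap i j l (Coalgebra.comul h)
  j_mul_t : ∀ h l, j h * D.t l =
    crossMap i j l (TensorProduct.comm k H H (R * Coalgebra.comul h))
  d_eq : ∀ l h, d (i l * j h) =
    (i l ⊗ₜ 1) * Algebra.TensorProduct.map j j (Coalgebra.comul h)
  ε_eq : ∀ l h, D.ε (i l * j h) = (Coalgebra.counit h : k) • l

theorem crossMap_tmul (i : L →ₐ[k] A) (j : H →ₐ[k] A) (m : L) (a b : H) :
    crossMap i j m (a ⊗ₜ[k] b) = i (a • m) * j b := rfl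

variable (i : L →ₐ[k] A) (j : H →ₐ[k] A) (ι : H →ₐc[k] U)

variable (U) in
/-- The algebra homomorphism `u ⊗ v ⊗ l ↦ (u ⊗ l) ⊗ (v ⊗ 1)`. -/
def cocycleHom : U ⊗[k] (U ⊗[k] L) →ₐ[k] (U ⊗[k] A) ⊗[k] (U ⊗[k] A) :=
  ((Algebra.TensorProduct.map
    (Algebra.TensorProduct.map (AlgHom.id k U) i)
    Algebra.TensorProduct.includeLeft).comp
      (Algebra.TensorProduct.assoc k k k U L U).symm.toAlgHom).comp
        (Algebra.TensorProduct.map (AlgHom.id k U)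
          (Algebra.TensorProduct.comm k U L).toAlgHom)

theorem cocycleHom_tmul (u v : U) (l : L) :
    cocycleHom U i (u ⊗ₜ[k] (v ⊗ₜ[k] l)) = (u ⊗ₜ i l) ⊗ₜ (v ⊗ₜ 1) := rfl

/-- The algebra homomorphism `x ⊗ y ↦ (1 ⊗ x) ⊗ (y ⊗ 1)`. -/
def rMatrixHom : H ⊗[k] H →ₐ[k] (U ⊗[k] A) ⊗[k] (U ⊗[k] A) :=
  Algebra.TensorProduct.map
    (Algebra.TensorProduct.includeRight.comp j)
    (Algebra.TensorProduct.includeLeft.comp (ι : H →ₐ[k] U))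

theorem rMatrixHom_tmul (x y : H) :
    rMatrixHom j ι (x ⊗ₜ[k] y) = (1 ⊗ₜ j x) ⊗ₜ (ι y ⊗ₜ 1) := rfl

/-- The map `l ↦ R₂ ⊗ (R₁ ▷ l)`. -/
def sourceMap (R : H ⊗[k] H) : L →ₗ[k] U ⊗[k] A :=
  TensorProduct.map (ι : H →ₗ[k] U) i.toLinearMap ∘ₗ coactionMinus L R

theorem sourceMap_zero : sourceMap i ι (0 : H ⊗[k] H) = 0 := by
  simp [sourceMap, coactionMinus]

theorem sourceMap_add (S T : H ⊗[k] H) :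
    sourceMap i ι (S + T) = sourceMap i ι S + sourceMap i ι T := by
  simp [sourceMap, coactionMinus, LinearMap.comp_add]

theorem sourceMap_tmul (x y : H) (l : L) :
    sourceMap i ι (x ⊗ₜ[k] y) l = ι y ⊗ₜ[k] i (x • l) := rfl

variable {R : H ⊗[k] H}

theorem sourceMap_one [IsModuleAlgebra k H L] (hR : IsUniversalRMatrix R) :
    sourceMap i ι R 1 = 1 := by
  have h : ∀ S : H ⊗[k] H, sourceMap i ι S 1 = ι (counitLeft k H S) ⊗ₜ 1 := by
    intro S
    induction S using TensorProduct.induction_on with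
    | zero => simp [sourceMap_zero]
    | add x y hx hy =>
      rw [sourceMap_add, LinearMap.add_apply, hx, hy, map_add, map_add,
        TensorProduct.add_tmul]
    | tmul x y =>
      rw [sourceMap_tmul, IsModuleAlgebra.smul_one' (k := k), Algebra.algebraMap_eq_smul_one,
        map_smul, map_one, TensorProduct.tmul_smul, counitLeft_tmul, map_smul,
        TensorProduct.smul_tmul']
  rw [h, hR.counitLeft_eq_one, map_one]
  rfl

/-- Acting by R₁ on lm requires Δ(R₁), and (Δ ⊗ id)(R) = R₁₃R₂₃ distributes the two copies of R over
the two factors in the right order. -/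
theorem sourceMap_mul [IsModuleAlgebra k H L] (hR : IsUniversalRMatrix R) (l m : L) :
    sourceMap i ι R (l * m) = sourceMap i ι R l * sourceMap i ι R m := by
  let Θ : (H ⊗[k] H) ⊗[k] H →ₗ[k] U ⊗[k] A :=
    TensorProduct.map (ι : H →ₗ[k] U) (i.toLinearMap ∘ₗ LinearMap.mul' k L ∘ₗ
      (actMap₂ k H L).flip (l ⊗ₜ m)) ∘ₗ (TensorProduct.comm k _ _).toLinearMap
  have h1 : ∀ S : H ⊗[k] H, sourceMap i ι S (l * m) =
      Θ (LinearMap.rTensor H Coalgebra.comul S) := by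
    intro S
    induction S using TensorProduct.induction_on with
    | zero => simp [sourceMap_zero]
    | add x y hx hy => rw [sourceMap_add, LinearMap.add_apply, hx, hy, map_add, map_add]
    | tmul x y => simp [Θ, sourceMap_tmul, IsModuleAlgebra.smul_mul' (k := k)]
  have h2 : ∀ S T : H ⊗[k] H, Θ ((TensorProduct.assoc k H H H).symm (leg13 S * leg23 T)) =
      sourceMap i ι S l * sourceMap i ι T m := by
    intro S T
    induction S using TensorProduct.induction_on with
    | zero => simp [sourceMap_zero, leg13_zero]
    | add x y hx hy =>
      rw [sourceMap_add, LinearMap.add_apply, add_mul, ← hx, ← hy, leg13_add, add_mul,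
        map_add, map_add]
    | tmul x y =>
    induction T using TensorProduct.induction_on with
    | zero => simp [sourceMap_zero, leg23_zero]
    | add x y hx hy =>
      rw [sourceMap_add, LinearMap.add_apply, mul_add, ← hx, ← hy, leg23_add, mul_add,
        map_add, map_add]
    | tmul x' y' => simp [Θ, sourceMap_tmul, leg13_tmul, leg23_tmul, actMap₂]
  rw [h1, hR.rTensor_comul, h2]

/-- For `γ : L → B ⊗ B`, the map `x ⊗ y ↦ γ(x ▷ l) P (1 ⊗ y)`. -/
def actThrough (γ : L →ₗ[k] (U ⊗[k] A) ⊗[k] (U ⊗[k] A)) (P : (U ⊗[k] A) ⊗[k] (U ⊗[k] A))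
    (l : L) : H ⊗[k] H →ₗ[k] (U ⊗[k] A) ⊗[k] (U ⊗[k] A) :=
  LinearMap.mul' k _ ∘ₗ TensorProduct.map
    (LinearMap.mulRight k P ∘ₗ γ ∘ₗ (actMap k H L).flip l)
    ((rMatrixHom j ι).toLinearMap ∘ₗ TensorProduct.mk k H H 1)

theorem actThrough_tmul (γ : L →ₗ[k] (U ⊗[k] A) ⊗[k] (U ⊗[k] A))
    (P : (U ⊗[k] A) ⊗[k] (U ⊗[k] A)) (l : L) (x y : H) :
    actThrough j ι γ P l (x ⊗ₜ y) = γ (x • l) * P * rMatrixHom j ι (1 ⊗ₜ y) := rfl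

/-- The generators `t(l) ⊗ 1 - 1 ⊗ s(l)` of the relations of `B ⊗_L B`. -/
def balGen {B : Type*} [Ring B] [Algebra k B] (s t : L →ₗ[k] B) : L →ₗ[k] B ⊗[k] B :=
  (TensorProduct.mk k _ _).flip 1 ∘ₗ t - TensorProduct.mk k _ _ 1 ∘ₗ s

theorem balGen_apply {B : Type*} [Ring B] [Algebra k B] (s t : L →ₗ[k] B) (l : L) :
    balGen s t l = t l ⊗ₜ 1 - 1 ⊗ₜ s l := rfl

theorem actThrough_mem (s t : L →ₗ[k] U ⊗[k] A) (P : (U ⊗[k] A) ⊗[k] (U ⊗[k] A)) (l : L)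
    (S : H ⊗[k] H) : actThrough j ι (balGen s t) P l S ∈ balRel s t := by
  induction S using TensorProduct.induction_on with
  | zero => simp
  | add x y hx hy => rw [map_add]; exact add_mem hx hy
  | tmul x y =>
    rw [actThrough_tmul, mul_assoc]
    exact balRel_mul_mem _ _ (balRel_gen_mem _ _ (x • l)) _

namespace IsSmashBialgebroid

variable {i j} {D : BialgebroidData k L A} {d : A →ₗ[k] A ⊗[k] A}
  (h : IsSmashBialgebroid D d R i j)
include h

theorem t_mul_i (l m : L) : D.t m * i l = i l * D.t m := by
  rw [← h.s_eq, h.isLifted.s_mul_t]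

/-- The first leg of the image of F has A-component in i(L), which commutes with t(l); the second
has trivial A-component and so commutes with s(l). -/
theorem cocycleHom_mul_balGen (f : U ⊗[k] (U ⊗[k] L)) (l : L) :
    cocycleHom U i f * balGen (D.tensor U).s (D.tensor U).t l =
      balGen (D.tensor U).s (D.tensor U).t l * cocycleHom U i f := by
  induction f using TensorProduct.induction_on with
  | zero => simp
  | add x y hx hy => simp only [map_add, add_mul, mul_add, hx, hy]
  | tmul u w =>
  induction w using TensorProduct.induction_on with
  | zero => simp
  | add x y hx hy => simp only [TensorProduct.tmul_add, map_add, add_mul, mul_add, hx, hy]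
  | tmul v n =>
    simp [balGen_apply, cocycleHom_tmul, mul_sub, sub_mul, h.t_mul_i, tensor_s, tensor_t]

/-- The relation h t(l) = t(h₂ ▷ l)h₁ for h = R₁, with Δ(R₁) split by R₁₃R₂₃ into copies S and T,
gives t(T₁ ▷ l)S₁ ⊗ S₂T₂: the generator is moved to the left of S at the cost of the action of T. -/
theorem rMatrixHom_mul_t (hR : IsUniversalRMatrix R) (l : L) :
    rMatrixHom j ι R * ((D.tensor U).t l ⊗ₜ 1) =
      actThrough j ι ((TensorProduct.mk k _ _).flip 1 ∘ₗ (D.tensor U).t)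
        (rMatrixHom j ι R) l R := by
  let Θ : (H ⊗[k] H) ⊗[k] H →ₗ[k] (U ⊗[k] A) ⊗[k] (U ⊗[k] A) :=
    TensorProduct.map (TensorProduct.mk k U A 1 ∘ₗ crossMap i j l ∘ₗ
      (TensorProduct.comm k H H).toLinearMap ∘ₗ LinearMap.mulLeft k R)
      ((TensorProduct.mk k U A).flip 1 ∘ₗ (ι : H →ₗ[k] U))
  have h1 : ∀ S : H ⊗[k] H, rMatrixHom j ι S * ((D.tensor U).t l ⊗ₜ 1) =
      Θ (LinearMap.rTensor H Coalgebra.comul S) := by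
    intro S
    induction S using TensorProduct.induction_on with
    | zero => simp
    | add x y hx hy => simp only [map_add, add_mul, hx, hy]
    | tmul x y => simp [Θ, rMatrixHom_tmul, h.j_mul_t, tensor_t]
  have h0 : ∀ (Q : H ⊗[k] H) (x x' : H),
      crossMap i j l (TensorProduct.comm k H H (Q * (x' ⊗ₜ x))) =
        crossMap i j (x • l) (TensorProduct.comm k H H Q) * j x' := by
    intro Q x x'
    induction Q using TensorProduct.induction_on with
    | zero => simp
    | add a b ha hb => simp only [map_add, add_mul, ha, hb]
    | tmul a b => simp [crossMap_tmul, mul_smul, mul_assoc]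
  have h2 : ∀ S T : H ⊗[k] H, Θ ((TensorProduct.assoc k H H H).symm (leg13 S * leg23 T)) =
      actThrough j ι ((TensorProduct.mk k _ _).flip 1 ∘ₗ (D.tensor U).t)
        (rMatrixHom j ι S) l T := by
    intro S T
    induction T using TensorProduct.induction_on with
    | zero => simp [leg23_zero]
    | add x y hx hy => simp only [map_add, leg23_add, mul_add, hx, hy]
    | tmul x' y' =>
    rw [actThrough_tmul]
    induction S using TensorProduct.induction_on with
    | zero => simp [leg13_zero]
    | add x y hx hy => simp only [map_add, leg13_add, add_mul, mul_add, hx, hy]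
    | tmul x y =>
      simp [Θ, leg13_tmul, leg23_tmul, rMatrixHom_tmul, h0, tensor_t, h.t_eq]
  rw [h1, hR.rTensor_comul, h2]

theorem rMatrixHom_mul_sourceMap (S T : H ⊗[k] H) (l : L) :
    rMatrixHom j ι S * (1 ⊗ₜ sourceMap i ι T l) =
      actThrough j ι (TensorProduct.mk k _ _ 1 ∘ₗ (D.tensor U).s) (rMatrixHom j ι S) l T := by
  induction T using TensorProduct.induction_on with
  | zero => simp [sourceMap_zero]
  | add x y hx hy =>
    rw [sourceMap_add, LinearMap.add_apply, TensorProduct.tmul_add, mul_add, hx, hy, map_add]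
  | tmul x' y' =>
  rw [actThrough_tmul]
  induction S using TensorProduct.induction_on with
  | zero => simp
  | add x y hx hy => simp only [map_add, add_mul, mul_add, hx, hy]
  | tmul x y => simp [rMatrixHom_tmul, sourceMap_tmul, tensor_s, h.s_eq]

/-- Both halves of a twisted generator pass through R with the same coefficients R₁ ▷ l and R₂, so
their difference becomes a combination of untwisted generators. The twisted source map is the one
for which the second half matches the first. -/
theorem rMatrixHom_mul_gen (hR : IsUniversalRMatrix R) (l : L) :
    rMatrixHom j ι R * balGen (sourceMap i ι R) (D.tensor U).t l =
      actThrough j ι (balGen (D.tensor U).s (D.tensor U).t) (rMatrixHom j ι R) l R := by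
  rw [balGen_apply, mul_sub, h.rMatrixHom_mul_t ι hR, h.rMatrixHom_mul_sourceMap,
    ← LinearMap.sub_apply]
  congr 1
  ext x y
  simp [actThrough_tmul, balGen_apply, sub_mul]

omit h in
-- This solves the exchange relation for γ(l): when R sends γ' to γ through the action of R on l,
-- acting beforehand with R⁻¹ cancels that action. It yields the inclusion of relations needed for
-- P⁻¹.
theorem rMatrixHom_mul_actThrough (hR : IsUniversalRMatrix R)
    {γ γ' : L →ₗ[k] (U ⊗[k] A) ⊗[k] (U ⊗[k] A)}
    (hγ : ∀ l, rMatrixHom j ι R * γ' l = actThrough j ι γ (rMatrixHom j ι R) l R) (l : L) :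
    ∃ S : H ⊗[k] H, rMatrixHom j ι R * actThrough j ι γ' 1 l S = γ l * rMatrixHom j ι R := by
  -- The witness is R⁻¹; by `h2` below, inserting T on the right replaces the action of R by that of
  -- RT.
  obtain ⟨S, hS⟩ := hR.isUnit.exists_right_inv
  refine ⟨S, ?_⟩
  have h1 : ∀ (P : (U ⊗[k] A) ⊗[k] (U ⊗[k] A)) (Q : H ⊗[k] H) (x y : H),
      actThrough j ι γ P (x • l) Q * rMatrixHom j ι (1 ⊗ₜ y) =
        actThrough j ι γ P l (Q * (x ⊗ₜ y)) := by
    intro P Q x y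
    induction Q using TensorProduct.induction_on with
    | zero => simp
    | add a b ha hb => simp only [map_add, add_mul, ha, hb]
    | tmul a b =>
      simp only [actThrough_tmul, Algebra.TensorProduct.tmul_mul_tmul, mul_assoc, mul_smul,
        ← map_mul, one_mul]
  have h2 : ∀ T : H ⊗[k] H, rMatrixHom j ι R * actThrough j ι γ' 1 l T =
      actThrough j ι γ (rMatrixHom j ι R) l (R * T) := by
    intro T
    induction T using TensorProduct.induction_on with
    | zero => simp
    | add a b ha hb => simp only [map_add, mul_add, ha, hb]
    | tmul a b => rw [actThrough_tmul, mul_one, ← mul_assoc, hγ, h1]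
  rw [h2, hS, Algebra.TensorProduct.one_def, actThrough_tmul, one_smul,
    ← Algebra.TensorProduct.one_def, map_one, mul_one]

end IsSmashBialgebroid

end Twist

/-- Induction on elements of a triple tensor product. -/
theorem TensorProduct.induction_on₃ {k X Y Z : Type*} [CommRing k] [AddCommGroup X] [Module k X]
    [AddCommGroup Y] [Module k Y] [AddCommGroup Z] [Module k Z]
    {p : X ⊗[k] (Y ⊗[k] Z) → Prop} (f : X ⊗[k] (Y ⊗[k] Z)) (zero : p 0)
    (add : ∀ a b, p a → p b → p (a + b)) (tmul : ∀ x y z, p (x ⊗ₜ (y ⊗ₜ z))) : p f := by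
  induction f using TensorProduct.induction_on with
  | zero => exact zero
  | add x y hx hy => exact add _ _ hx hy
  | tmul x w =>
  induction w using TensorProduct.induction_on with
  | zero => rw [TensorProduct.tmul_zero]; exact zero
  | add y z hy hz => rw [TensorProduct.tmul_add]; exact add _ _ hy hz
  | tmul y z => exact tmul x y z

/-! ### Equivariance of F, the twisted source map and counits -/

section Twist

open BialgebroidData

variable {k H U L A : Type*} [CommRing k] [Ring H] [Bialgebra k H] [Ring U] [Bialgebra k U]
  [Ring L] [Algebra k L] [Module H L] [IsScalarTower k H L]
  [Ring A] [Algebra k A] {i : L →ₐ[k] A} {j : H →ₐ[k] A} (ι : H →ₐc[k] U)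
  {R : H ⊗[k] H} {F : U ⊗[k] (U ⊗[k] L)}

omit [Module H L] [IsScalarTower k H L] in
theorem embed₂_tmul (x y : H) : embed₂ L ι (x ⊗ₜ[k] y) = ι x ⊗ₜ (ι y ⊗ₜ 1) := rfl

theorem leftAct₃_tmul (x y z : H) (u v : U) (l : L) :
    leftAct₃ L ι (x ⊗ₜ[k] (y ⊗ₜ[k] z)) (u ⊗ₜ (v ⊗ₜ l)) =
      (ι x * u) ⊗ₜ ((ι y * v) ⊗ₜ (z • l)) := rfl

/-- The invariance of `F`, evaluated on the second leg of the R-matrix. -/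
theorem lTensor_leftAct₃ {δ : L →ₗ[k] H ⊗[k] L} (hR : IsUniversalRMatrix R)
    (hF : IsDynamicalCocycle ι δ F) :
    LinearMap.lTensor H ((leftAct₃ L ι).flip F ∘ₗ (TensorProduct.assoc k H H H).toLinearMap ∘ₗ
      LinearMap.rTensor H Coalgebra.comul) (leg13 R * leg12 R) =
    LinearMap.lTensor H (LinearMap.mulLeft k F ∘ₗ embed₂ L ι ∘ₗ Coalgebra.comul) R := by
  rw [← hR.comul_right, ← LinearMap.comp_apply, ← LinearMap.lTensor_comp]
  congr 2
  ext x
  simp [Coalgebra.coassoc_apply, hF.invariant]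

variable (U) in
/-- The map `a ⊗ f ↦ f (1 ⊗ 1 ⊗ (a ▷ l))`. -/
def actLast (l : L) : H ⊗[k] (U ⊗[k] (U ⊗[k] L)) →ₗ[k] U ⊗[k] (U ⊗[k] L) :=
  LinearMap.mul' k _ ∘ₗ TensorProduct.map LinearMap.id
    (TensorProduct.mk k U (U ⊗[k] L) 1 ∘ₗ TensorProduct.mk k U L 1 ∘ₗ (actMap k H L).flip l) ∘ₗ
    (TensorProduct.comm k _ _).toLinearMap

theorem actLast_tmul (l : L) (a : H) (f : U ⊗[k] (U ⊗[k] L)) :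
    actLast U l (a ⊗ₜ f) = f * (1 ⊗ₜ (1 ⊗ₜ (a • l))) := rfl

/-- `R₂₁ ⊗ R₂₂ ⊗ (R₁ ▷ l)` commutes with `F`. -/
theorem cocycle_mul_actLast {δ : L →ₗ[k] H ⊗[k] L} (hR : IsUniversalRMatrix R)
    (hL : IsQuasiCommutative L R) (hF : IsDynamicalCocycle ι δ F) (l : L) :
    F * actLast U l (LinearMap.lTensor H (embed₂ L ι ∘ₗ Coalgebra.comul) R) =
      actLast U l (LinearMap.lTensor H (embed₂ L ι ∘ₗ Coalgebra.comul) R) * F := by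
  have h1 : ∀ S : H ⊗[k] H,
      F * actLast U l (LinearMap.lTensor H (embed₂ L ι ∘ₗ Coalgebra.comul) S) =
      actLast U l (LinearMap.lTensor H
        (LinearMap.mulLeft k F ∘ₗ embed₂ L ι ∘ₗ Coalgebra.comul) S) := by
    intro S
    induction S using TensorProduct.induction_on with
    | zero => simp
    | add x y hx hy => simp only [map_add, mul_add, hx, hy]
    | tmul x y => simp [actLast_tmul, mul_assoc]
  -- Equivariance has moved R₂ to the left of F, where its last coproduct component acts on F₃.
  -- Splitting (id ⊗ Δ)(R) as R₁₃R₁₂ with copies S and T, the L-component is (S₂ ▷ F₃)(S₁T₁ ▷ l),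
  -- which H-commutativity contracts to (T₁ ▷ l)F₃.
  have h2 : ∀ (S : H ⊗[k] H) (x y : H) (u v : U) (n : L),
      actLast U l (LinearMap.lTensor H ((leftAct₃ L ι).flip (u ⊗ₜ (v ⊗ₜ n)) ∘ₗ
        (TensorProduct.assoc k H H H).toLinearMap ∘ₗ LinearMap.rTensor H Coalgebra.comul)
        (leg13 S * leg12 (x ⊗ₜ y))) =
      embed₂ L ι (Coalgebra.comul y) * (u ⊗ₜ (v ⊗ₜ LinearMap.mul' k L
        (actMap₂ k H L (TensorProduct.comm k H H S) (n ⊗ₜ (x • l))))) := by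
    intro S x y u v n
    induction S using TensorProduct.induction_on with
    | zero => simp [leg13_zero]
    | add a b ha hb =>
      rw [leg13_add, add_mul, map_add, map_add, ha, hb, map_add, map_add, LinearMap.add_apply,
        map_add, TensorProduct.tmul_add, TensorProduct.tmul_add, mul_add]
    | tmul a b =>
      simp only [leg13_tmul, leg12_tmul, Algebra.TensorProduct.tmul_mul_tmul, one_mul, mul_one,
        LinearMap.lTensor_tmul, LinearMap.comp_apply, LinearMap.rTensor_tmul, actLast_tmul]
      generalize (Coalgebra.comul y : H ⊗[k] H) = w
      induction w using TensorProduct.induction_on with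
      | zero => simp
      | add c d hc hd => simp only [TensorProduct.add_tmul, map_add, add_mul, hc, hd]
      | tmul c d => simp [leftAct₃_tmul, embed₂_tmul, actMap₂, mul_smul]
  have h3 : ∀ (f : U ⊗[k] (U ⊗[k] L)) (T : H ⊗[k] H),
      actLast U l (LinearMap.lTensor H ((leftAct₃ L ι).flip f ∘ₗ
        (TensorProduct.assoc k H H H).toLinearMap ∘ₗ LinearMap.rTensor H Coalgebra.comul)
        (leg13 R * leg12 T)) =
      actLast U l (LinearMap.lTensor H (embed₂ L ι ∘ₗ Coalgebra.comul) T) * f := by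
    intro f T
    induction T using TensorProduct.induction_on with
    | zero => simp [leg12_zero]
    | add a b ha hb => simp only [leg12_add, mul_add, add_mul, map_add, ha, hb]
    | tmul x y =>
    induction f using TensorProduct.induction_on₃ with
    | zero => simp
    | add a b ha hb =>
      simp only [map_add, mul_add, LinearMap.add_comp, LinearMap.lTensor_add,
        LinearMap.add_apply, ha, hb]
    | tmul u v n =>
      rw [h2, ← hL]
      simp [actLast_tmul, mul_assoc]
  rw [h1, ← lTensor_leftAct₃ ι hR hF, h3]

/-- Passing R₁ across the L-component splits R by (Δ ⊗ id)(R) = R₁₃R₂₃. One copy remains on the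
right; the other combines with the R inside s̃(l) to R₁₃R₁₂ = (id ⊗ Δ)(R), which is the coproduct of
s̃(l). -/
theorem rMatrixHom_mul_sourceMap_left (hR : IsUniversalRMatrix R) (hji : ∀ h l, j h * i l =
    crossMap i j l (Coalgebra.comul h)) (l : L) :
    rMatrixHom j ι R * (sourceMap i ι R l ⊗ₜ 1) =
      cocycleHom U i (actLast U l (LinearMap.lTensor H (embed₂ L ι ∘ₗ Coalgebra.comul) R)) *
        rMatrixHom j ι R := by
  let Θ (x y : H) : (H ⊗[k] H) ⊗[k] H →ₗ[k] (U ⊗[k] A) ⊗[k] (U ⊗[k] A) :=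
    TensorProduct.map (TensorProduct.mk k U A (ι y) ∘ₗ crossMap i j (x • l))
      ((TensorProduct.mk k U A).flip 1 ∘ₗ (ι : H →ₗ[k] U))
  have h1 : ∀ (S : H ⊗[k] H) (x y : H),
      rMatrixHom j ι S * (sourceMap i ι (x ⊗ₜ y) l ⊗ₜ 1) =
        Θ x y (LinearMap.rTensor H Coalgebra.comul S) := by
    intro S x y
    induction S using TensorProduct.induction_on with
    | zero => simp
    | add a b ha hb => simp only [map_add, add_mul, ha, hb]
    | tmul a b => simp [Θ, rMatrixHom_tmul, sourceMap_tmul, hji]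
  have h2 : ∀ (S T : H ⊗[k] H) (x y : H),
      Θ x y ((TensorProduct.assoc k H H H).symm (leg13 S * leg23 T)) =
        cocycleHom U i (actLast U l (LinearMap.lTensor H (embed₂ L ι)
          (leg13 S * leg12 (x ⊗ₜ y)))) * rMatrixHom j ι T := by
    intro S T x y
    induction S using TensorProduct.induction_on with
    | zero => simp [leg13_zero]
    | add a b ha hb => simp only [leg13_add, map_add, add_mul, ha, hb]
    | tmul a b =>
    induction T using TensorProduct.induction_on with
    | zero => simp [leg23_zero]
    | add a b ha hb => simp only [leg23_add, map_add, mul_add, ha, hb]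
    | tmul a' b' =>
      simp [Θ, leg13_tmul, leg23_tmul, leg12_tmul, crossMap_tmul, embed₂_tmul, actLast_tmul,
        cocycleHom_tmul, rMatrixHom_tmul, mul_smul]
  have h3 : ∀ T : H ⊗[k] H, rMatrixHom j ι R * (sourceMap i ι T l ⊗ₜ 1) =
      cocycleHom U i (actLast U l (LinearMap.lTensor H (embed₂ L ι) (leg13 R * leg12 T))) *
        rMatrixHom j ι R := by
    intro T
    induction T using TensorProduct.induction_on with
    | zero => simp [sourceMap_zero, leg12_zero]
    | add a b ha hb =>
      rw [sourceMap_add, LinearMap.add_apply, TensorProduct.add_tmul, mul_add, ha, hb, leg12_add,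
        mul_add, map_add, map_add, map_add, add_mul]
    | tmul x y => rw [h1, hR.rTensor_comul, h2]
  rw [h3, ← hR.comul_right, ← LinearMap.lTensor_comp_apply]

namespace IsSmashBialgebroid

variable {D : BialgebroidData k L A} {d : A →ₗ[k] A ⊗[k] A}
  (h : IsSmashBialgebroid D d R i j)
include h

theorem d_i (l : L) : d (i l) = i l ⊗ₜ 1 := by
  have := h.d_eq l 1
  rwa [map_one, mul_one, Bialgebra.comul_one, map_one, mul_one] at this

theorem tensorLift_sourceMap (S : H ⊗[k] H) (l : L) :
    tensorLift U d (sourceMap i ι S l) = cocycleHom U i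
      (actLast U l (LinearMap.lTensor H (embed₂ L ι ∘ₗ Coalgebra.comul) S)) := by
  induction S using TensorProduct.induction_on with
  | zero => simp [sourceMap_zero]
  | add a b ha hb => rw [sourceMap_add, LinearMap.add_apply, map_add, ha, hb]; simp
  | tmul x y =>
    rw [sourceMap_tmul, tensorLift_tmul, h.d_i, ← CoalgHomClass.map_comp_comul_apply,
      LinearMap.lTensor_tmul, actLast_tmul, LinearMap.comp_apply]
    generalize (Coalgebra.comul y : H ⊗[k] H) = w
    induction w using TensorProduct.induction_on with
    | zero => simp
    | add c d hc hd => simp only [TensorProduct.add_tmul, map_add, add_mul, hc, hd]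
    | tmul c d => simp [embed₂_tmul, cocycleHom_tmul]

/-- The lifted coproduct of s̃(l) is the image of R₂⁽¹⁾ ⊗ R₂⁽²⁾ ⊗ (R₁ ▷ l). This element commutes
with F, and passing it through R turns it into s̃(l) ⊗ 1. No balancing relation is needed. -/
theorem d_sourceMap_mul {δ : L →ₗ[k] H ⊗[k] L} (hR : IsUniversalRMatrix R)
    (hL : IsQuasiCommutative L R) (hF : IsDynamicalCocycle ι δ F) (l : L) :
    tensorLift U d (sourceMap i ι R l) * (cocycleHom U i F * rMatrixHom j ι R) =
      cocycleHom U i F * rMatrixHom j ι R * (sourceMap i ι R l ⊗ₜ 1) := by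
  rw [h.tensorLift_sourceMap, mul_assoc, rMatrixHom_mul_sourceMap_left ι hR h.j_mul_i,
    ← mul_assoc, ← mul_assoc, ← map_mul, ← map_mul, cocycle_mul_actLast ι hR hL hF]

omit [Module H L] [IsScalarTower k H L] h in
-- The second leg of P lies in U ⊗ 1. Since Δ(t(l)) ≡ 1 ⊗ t(l), this is why the target map is
-- unchanged by the twist.
theorem mul_one_tmul (f : U ⊗[k] (U ⊗[k] L)) (S : H ⊗[k] H) (a : A) :
    (1 ⊗ₜ (1 ⊗ₜ a)) * (cocycleHom U i f * rMatrixHom j ι S) =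
      cocycleHom U i f * rMatrixHom j ι S * (1 ⊗ₜ (1 ⊗ₜ a)) := by
  induction f using TensorProduct.induction_on₃ with
  | zero => simp
  | add a b ha hb => simp only [map_add, add_mul, mul_add, ha, hb]
  | tmul u v n =>
  induction S using TensorProduct.induction_on with
  | zero => simp
  | add a b ha hb => simp only [map_add, add_mul, mul_add, ha, hb]
  | tmul x y => simp [cocycleHom_tmul, rMatrixHom_tmul]

theorem ε_crossMap (l : L) (w : H ⊗[k] H) : D.ε (crossMap i j l w) = counitRight k H w • l := by
  induction w using TensorProduct.induction_on with
  | zero => simp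
  | add x y hx hy => simp only [map_add, add_smul, hx, hy]
  | tmul x y => simp [crossMap_tmul, h.ε_eq]

theorem anchor_tmul (u : U) (n l : L) (x : H) :
    (D.tensor U).anchor (u ⊗ₜ (i n * j x)) l = (Coalgebra.counit u : k) • (n * x • l) := by
  rw [anchor_apply, tensor_s, Algebra.TensorProduct.tmul_mul_tmul, mul_one, tensor_ε_tmul,
    h.s_eq, mul_assoc, h.j_mul_i, ← h.s_eq, h.isLifted.ε_s_mul, h.ε_crossMap,
    counitRight_comul]

theorem anchor_tmul_one (u : U) (l : L) :
    (D.tensor U).anchor (u ⊗ₜ 1) l = (Coalgebra.counit u : k) • l := by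
  simpa using h.anchor_tmul u 1 l 1

/-- The anchor action of the first leg produces ε(F₁)F₃(R₁ ▷ l), so F enters only through its
normalisation (ε ⊗ id ⊗ id)(F), which is 1 for a dynamical cocycle. -/
theorem source (f : U ⊗[k] (U ⊗[k] L)) (S : H ⊗[k] H) (l : L) :
    TensorProduct.lift (LinearMap.mul k _ ∘ₗ (D.tensor U).s ∘ₗ (D.tensor U).anchor.flip l)
      (cocycleHom U i f * rMatrixHom j ι S) =
      Algebra.TensorProduct.map (AlgHom.id k U) i (_root_.counitFst k U (U ⊗[k] L) f) *
        sourceMap i ι S l := by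
  induction f using TensorProduct.induction_on₃ with
  | zero => simp
  | add a b ha hb => simp only [map_add, add_mul, ha, hb]
  | tmul u v n =>
  induction S using TensorProduct.induction_on with
  | zero => simp [sourceMap_zero]
  | add a b ha hb => simp only [map_add, mul_add, ha, hb, sourceMap_add, LinearMap.add_apply]
  | tmul x y =>
    simp [cocycleHom_tmul, rMatrixHom_tmul, h.anchor_tmul, tensor_s, h.s_eq, sourceMap_tmul,
      _root_.counitFst, TensorProduct.smul_tmul']

theorem target (f : U ⊗[k] (U ⊗[k] L)) (S : H ⊗[k] H) (l : L) :
    TensorProduct.lift (LinearMap.mul k _ ∘ₗ (D.tensor U).t ∘ₗ (D.tensor U).anchor.flip l).flip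
      (cocycleHom U i f * rMatrixHom j ι S) =
      (D.tensor U).t l * (Algebra.TensorProduct.map (AlgHom.id k U) i
        (LinearMap.lTensor U (_root_.counitFst k U L) f) * (1 ⊗ₜ j (counitRight k H S))) := by
  induction f using TensorProduct.induction_on₃ with
  | zero => simp
  | add a b ha hb => simp only [map_add, add_mul, mul_add, ha, hb]
  | tmul u v n =>
  induction S using TensorProduct.induction_on with
  | zero => simp
  | add a b ha hb => simp only [map_add, mul_add, ha, hb, TensorProduct.tmul_add]
  | tmul x y =>
    simp [cocycleHom_tmul, rMatrixHom_tmul, h.anchor_tmul_one, tensor_t,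
      _root_.counitFst, smul_smul, mul_comm (Coalgebra.counit v : k)]

theorem base (f : U ⊗[k] (U ⊗[k] L)) (S : H ⊗[k] H) (l m : L) :
    LinearMap.mul' k L (TensorProduct.map ((D.tensor U).anchor.flip l)
      ((D.tensor U).anchor.flip m) (cocycleHom U i f * rMatrixHom j ι S)) =
      _root_.counitFst k U L (LinearMap.lTensor U (_root_.counitFst k U L) f) *
        (counitRight k H S • l) * m := by
  induction f using TensorProduct.induction_on₃ with
  | zero => simp
  | add a b ha hb => simp only [map_add, add_mul, ha, hb]
  | tmul u v n =>
  induction S using TensorProduct.induction_on with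
  | zero => simp
  | add a b ha hb => simp only [map_add, mul_add, ha, hb, add_smul, add_mul]
  | tmul x y =>
    simp [cocycleHom_tmul, rMatrixHom_tmul, h.anchor_tmul_one, h.anchor_tmul,
      _root_.counitFst, smul_smul]
    ring_nf

theorem ε_sourceMap_mul (hR : IsUniversalRMatrix R) (l : L) (a : U ⊗[k] A) :
    (D.tensor U).ε (sourceMap i ι R l * a) = l * (D.tensor U).ε a := by
  have e : ∀ S : H ⊗[k] H, (D.tensor U).ε (sourceMap i ι S l * a) =
      (counitRight k H S • l) * (D.tensor U).ε a := by
    intro S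
    induction S using TensorProduct.induction_on with
    | zero => simp [sourceMap_zero]
    | add x y hx hy =>
      rw [sourceMap_add, LinearMap.add_apply, add_mul, map_add, hx, hy, map_add, add_smul,
        add_mul]
    | tmul x y =>
    induction a using TensorProduct.induction_on with
    | zero => simp
    | add x y hx hy => simp only [mul_add, map_add, hx, hy]
    | tmul u b =>
      rw [sourceMap_tmul, Algebra.TensorProduct.tmul_mul_tmul, tensor_ε_tmul, tensor_ε_tmul,
        ← h.s_eq, h.isLifted.ε_s_mul]
      simp [smul_smul, mul_comm]
  rw [e, hR.counitRight_eq_one, one_smul]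

theorem ε_mul_sourceMap (hR : IsUniversalRMatrix R) (a : U ⊗[k] A) (l : L) :
    (D.tensor U).ε (a * sourceMap i ι R l) = (D.tensor U).ε (a * (D.tensor U).s l) := by
  have e : ∀ S : H ⊗[k] H, (D.tensor U).ε (a * sourceMap i ι S l) =
      (D.tensor U).ε (a * (D.tensor U).s (counitRight k H S • l)) := by
    intro S
    induction S using TensorProduct.induction_on with
    | zero => simp [sourceMap_zero]
    | add x y hx hy =>
      rw [sourceMap_add, LinearMap.add_apply, mul_add, map_add, hx, hy, map_add, add_smul,
        map_add, mul_add, map_add]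
    | tmul x y =>
    induction a using TensorProduct.induction_on with
    | zero => simp
    | add x y hx hy => simp only [add_mul, map_add, hx, hy]
    | tmul u b =>
      simp [sourceMap_tmul, tensor_ε_tmul, tensor_s, h.s_eq, smul_smul,
        mul_comm (Coalgebra.counit u : k)]
  rw [e, hR.counitRight_eq_one, one_smul]

end IsSmashBialgebroid

end Twist

/-! ### The cocycle identity for P -/

section Twist

set_option maxSynthPendingDepth 3

open BialgebroidData

variable {k H U L A : Type*} [CommRing k] [Ring H] [Bialgebra k H] [Ring U] [Bialgebra k U]
  [Ring L] [Algebra k L] [Ring A] [Algebra k A]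
  (i : L →ₐ[k] A) (j : H →ₐ[k] A) (ι : H →ₐc[k] U)

variable (U) in
/-- The algebra homomorphism `u ⊗ v ⊗ w ⊗ l ↦ (u ⊗ l) ⊗ (v ⊗ 1) ⊗ (w ⊗ 1)`. -/
def cocycleHom₃ : U ⊗[k] (U ⊗[k] (U ⊗[k] L)) →ₐ[k]
    (U ⊗[k] A) ⊗[k] ((U ⊗[k] A) ⊗[k] (U ⊗[k] A)) :=
  ((Algebra.TensorProduct.map
    (Algebra.TensorProduct.map (AlgHom.id k U) i)
    (Algebra.TensorProduct.map Algebra.TensorProduct.includeLeft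
      Algebra.TensorProduct.includeLeft)).comp
      (Algebra.TensorProduct.assoc k k k U L (U ⊗[k] U)).symm.toAlgHom).comp
        (Algebra.TensorProduct.map (AlgHom.id k U)
          ((Algebra.TensorProduct.leftComm k U L U).toAlgHom.comp
            (Algebra.TensorProduct.map (AlgHom.id k U)
              (Algebra.TensorProduct.comm k U L).toAlgHom)))

theorem cocycleHom₃_tmul (u v w : U) (l : L) :
    cocycleHom₃ U i (u ⊗ₜ[k] (v ⊗ₜ[k] (w ⊗ₜ[k] l))) =
      (u ⊗ₜ i l) ⊗ₜ ((v ⊗ₜ 1) ⊗ₜ (w ⊗ₜ 1)) := rfl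

/-- The algebra homomorphism `x ⊗ y ⊗ z ↦ (1 ⊗ x) ⊗ (1 ⊗ y) ⊗ (z ⊗ 1)`. -/
def rMatrixHom₁ : H ⊗[k] (H ⊗[k] H) →ₐ[k] (U ⊗[k] A) ⊗[k] ((U ⊗[k] A) ⊗[k] (U ⊗[k] A)) :=
  Algebra.TensorProduct.map (Algebra.TensorProduct.includeRight.comp j) (rMatrixHom j ι)

/-- The algebra homomorphism `x ⊗ y ⊗ z ↦ (1 ⊗ x) ⊗ (y ⊗ 1) ⊗ (z ⊗ 1)`. -/
def rMatrixHom₂ : H ⊗[k] (H ⊗[k] H) →ₐ[k] (U ⊗[k] A) ⊗[k] ((U ⊗[k] A) ⊗[k] (U ⊗[k] A)) :=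
  Algebra.TensorProduct.map (Algebra.TensorProduct.includeRight.comp j)
    (Algebra.TensorProduct.map (Algebra.TensorProduct.includeLeft.comp (ι : H →ₐ[k] U))
      (Algebra.TensorProduct.includeLeft.comp (ι : H →ₐ[k] U)))

theorem rMatrixHom₁_tmul (x y z : H) : rMatrixHom₁ j ι (x ⊗ₜ[k] (y ⊗ₜ[k] z)) =
    (1 ⊗ₜ j x) ⊗ₜ ((1 ⊗ₜ j y) ⊗ₜ (ι z ⊗ₜ 1)) := rfl

theorem rMatrixHom₂_tmul (x y z : H) : rMatrixHom₂ j ι (x ⊗ₜ[k] (y ⊗ₜ[k] z)) =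
    (1 ⊗ₜ j x) ⊗ₜ ((ι y ⊗ₜ 1) ⊗ₜ (ι z ⊗ₜ 1)) := rfl

theorem rMatrixHom₁_leg23 (S : H ⊗[k] H) :
    rMatrixHom₁ j ι (leg23 S) = inr₂₃ (rMatrixHom j ι S) := by
  simp only [leg23, rMatrixHom₁, Algebra.TensorProduct.map_tmul, map_one]
  rfl

theorem rMatrixHom₂_leg12 (S : H ⊗[k] H) :
    rMatrixHom₂ j ι (leg12 S) = inl₁₂ (rMatrixHom j ι S) := by
  induction S using TensorProduct.induction_on with
  | zero => simp [leg12_zero]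
  | add a b ha hb => simp only [leg12_add, map_add, ha, hb]
  | tmul x y =>
    rw [leg12_tmul, rMatrixHom₂_tmul, rMatrixHom_tmul, inl₁₂_tmul, map_one]
    rfl

theorem rMatrixHom₂_leg13 (S : H ⊗[k] H) :
    rMatrixHom₂ j ι (leg13 S) = rMatrixHom₁ j ι (leg13 S) := by
  induction S using TensorProduct.induction_on with
  | zero => simp [leg13_zero]
  | add a b ha hb => simp only [leg13_add, map_add, ha, hb]
  | tmul x y =>
    rw [leg13_tmul, rMatrixHom₂_tmul, rMatrixHom₁_tmul, map_one, map_one]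

/-- In the shared second leg one factor lies in U and the other in A, so they commute; the
Yang–Baxter equation is not needed to reorder the copies of R. -/
theorem inl₁₂_mul_inr₂₃_rMatrixHom (S T : H ⊗[k] H) :
    inl₁₂ (rMatrixHom j ι S) * inr₂₃ (rMatrixHom j ι T) =
      inr₂₃ (rMatrixHom j ι T) * inl₁₂ (rMatrixHom j ι S) := by
  induction S using TensorProduct.induction_on with
  | zero => simp
  | add a b ha hb => simp only [map_add, add_mul, mul_add, ha, hb]
  | tmul x y =>
  induction T using TensorProduct.induction_on with
  | zero => simp
  | add a b ha hb => simp only [map_add, add_mul, mul_add, ha, hb]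
  | tmul x' y' => simp [rMatrixHom_tmul, inl₁₂_tmul, inr₂₃_apply]

theorem inr₂₃_mul_inl₁₂_cocycleHom (f : U ⊗[k] (U ⊗[k] L)) (S : H ⊗[k] H) :
    inr₂₃ (rMatrixHom j ι S) * inl₁₂ (cocycleHom U i f) =
      inl₁₂ (cocycleHom U i f) * inr₂₃ (rMatrixHom j ι S) := by
  induction f using TensorProduct.induction_on₃ with
  | zero => simp
  | add a b ha hb => simp only [map_add, add_mul, mul_add, ha, hb]
  | tmul u v n =>
  induction S using TensorProduct.induction_on with
  | zero => simp
  | add a b ha hb => simp only [map_add, add_mul, mul_add, ha, hb]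
  | tmul x y => simp [rMatrixHom_tmul, cocycleHom_tmul, inl₁₂_tmul, inr₂₃_apply]

variable [Module H L] [IsScalarTower k H L] {R : H ⊗[k] H} {F : U ⊗[k] (U ⊗[k] L)}

/-- The map `a ⊗ u ⊗ v ⊗ l ↦ (1 ⊗ i(l) j(a)) ⊗ (u ⊗ 1) ⊗ (v ⊗ 1)`. -/
def shiftMap : H ⊗[k] (U ⊗[k] (U ⊗[k] L)) →ₗ[k]
    (U ⊗[k] A) ⊗[k] ((U ⊗[k] A) ⊗[k] (U ⊗[k] A)) :=
  LinearMap.mul' k _ ∘ₗ TensorProduct.map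
    ((cocycleHom₃ U i).toLinearMap ∘ₗ TensorProduct.mk k U _ 1)
    ((rMatrixHom₂ j ι).toLinearMap ∘ₗ (TensorProduct.mk k H (H ⊗[k] H)).flip 1) ∘ₗ
    (TensorProduct.comm k _ _).toLinearMap

omit [Module H L] [IsScalarTower k H L] in
theorem shiftMap_tmul (a : H) (f : U ⊗[k] (U ⊗[k] L)) :
    shiftMap i j ι (a ⊗ₜ f) = cocycleHom₃ U i (1 ⊗ₜ f) * rMatrixHom₂ j ι (a ⊗ₜ 1) := rfl

omit [Module H L] [IsScalarTower k H L] in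
theorem shiftMap_tmul₃ (a : H) (u v : U) (l : L) :
    shiftMap i j ι (a ⊗ₜ (u ⊗ₜ (v ⊗ₜ l))) = (1 ⊗ₜ (i l * j a)) ⊗ₜ ((u ⊗ₜ 1) ⊗ₜ (v ⊗ₜ 1)) := by
  simp [shiftMap_tmul, cocycleHom₃_tmul, Algebra.TensorProduct.one_def, rMatrixHom₂_tmul]

omit [Module H L] [IsScalarTower k H L] in
theorem shiftMap_mul_embed₂ (f : U ⊗[k] (U ⊗[k] L)) (S : H ⊗[k] H) :
    shiftMap i j ι
      (LinearMap.lTensor H (LinearMap.mulLeft k f ∘ₗ embed₂ L ι ∘ₗ Coalgebra.comul) S) =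
      cocycleHom₃ U i (1 ⊗ₜ f) * rMatrixHom₂ j ι (LinearMap.lTensor H Coalgebra.comul S) := by
  have e : ∀ (x : H) (w : H ⊗[k] H), cocycleHom₃ U i (1 ⊗ₜ embed₂ L ι w) *
      rMatrixHom₂ j ι (x ⊗ₜ 1) = rMatrixHom₂ j ι (x ⊗ₜ w) := by
    intro x w
    induction w using TensorProduct.induction_on with
    | zero => simp
    | add a b ha hb => simp only [map_add, TensorProduct.tmul_add, add_mul, ha, hb]
    | tmul a b =>
      simp [Algebra.TensorProduct.one_def, embed₂_tmul, cocycleHom₃_tmul, rMatrixHom₂_tmul]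
  induction S using TensorProduct.induction_on with
  | zero => simp
  | add a b ha hb => simp only [map_add, mul_add, ha, hb]
  | tmul x y =>
    have e1 : (1 ⊗ₜ (f * embed₂ L ι (Coalgebra.comul y)) : U ⊗[k] (U ⊗[k] (U ⊗[k] L))) =
        (1 ⊗ₜ f) * (1 ⊗ₜ embed₂ L ι (Coalgebra.comul y)) := by simp
    rw [LinearMap.lTensor_tmul, LinearMap.lTensor_tmul, shiftMap_tmul, LinearMap.comp_apply,
      LinearMap.comp_apply, LinearMap.mulLeft_apply, e1, map_mul, mul_assoc, e]

namespace IsSmashBialgebroid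

variable {i j} {D : BialgebroidData k L A} {d : A →ₗ[k] A ⊗[k] A}
  (h : IsSmashBialgebroid D d R i j)
include h

theorem lift₁_tensorLift (f : U ⊗[k] (U ⊗[k] L)) (S : H ⊗[k] H) :
    lift₁ (tensorLift U d) (cocycleHom U i f * rMatrixHom j ι S) =
      cocycleHom₃ U i (comulFst k U (U ⊗[k] L) f) *
        rMatrixHom₁ j ι (TensorProduct.assoc k H H H (LinearMap.rTensor H Coalgebra.comul S)) := by
  induction f using TensorProduct.induction_on₃ with
  | zero => simp
  | add a b ha hb => simp only [map_add, add_mul, ha, hb]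
  | tmul u v n =>
  induction S using TensorProduct.induction_on with
  | zero => simp
  | add a b ha hb => simp only [map_add, mul_add, ha, hb]
  | tmul x y =>
    simp only [cocycleHom_tmul, rMatrixHom_tmul, Algebra.TensorProduct.tmul_mul_tmul, mul_one,
      lift₁_tmul, tensorLift_tmul, h.d_eq, comulFst, LinearMap.comp_apply,
      LinearMap.rTensor_tmul, LinearEquiv.coe_coe]
    generalize (Coalgebra.comul u : U ⊗[k] U) = w
    generalize (Coalgebra.comul x : H ⊗[k] H) = z
    induction w using TensorProduct.induction_on with
    | zero => simp
    | add a b ha hb => simp only [TensorProduct.add_tmul, map_add, add_mul, ha, hb]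
    | tmul u₁ u₂ =>
    induction z using TensorProduct.induction_on with
    | zero => simp
    | add a b ha hb =>
      simp only [TensorProduct.add_tmul, TensorProduct.tmul_add, map_add, add_mul, mul_add,
        ha, hb]
    | tmul x₁ x₂ => simp [inl₁₂_tmul, cocycleHom₃_tmul, rMatrixHom₁_tmul]

theorem lift₂_tensorLift (f : U ⊗[k] (U ⊗[k] L)) (S : H ⊗[k] H) :
    lift₂ (tensorLift U d) (cocycleHom U i f * rMatrixHom j ι S) =
      cocycleHom₃ U i (LinearMap.lTensor U (comulFst k U L) f) *
        rMatrixHom₂ j ι (LinearMap.lTensor H Coalgebra.comul S) := by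
  have d1 : d 1 = 1 ⊗ₜ 1 := by simpa using h.d_i 1
  induction f using TensorProduct.induction_on₃ with
  | zero => simp
  | add a b ha hb => simp only [map_add, add_mul, ha, hb]
  | tmul u v n =>
  induction S using TensorProduct.induction_on with
  | zero => simp
  | add a b ha hb => simp only [map_add, mul_add, ha, hb]
  | tmul x y =>
    simp only [cocycleHom_tmul, rMatrixHom_tmul, Algebra.TensorProduct.tmul_mul_tmul, mul_one,
      lift₂, LinearMap.lTensor_tmul, tensorLift_tmul, d1, comulFst, LinearMap.comp_apply,
      LinearMap.rTensor_tmul, LinearEquiv.coe_coe, Bialgebra.comul_mul,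
      ← CoalgHomClass.map_comp_comul_apply]
    generalize (Coalgebra.comul v : U ⊗[k] U) = w
    generalize (Coalgebra.comul y : H ⊗[k] H) = z
    induction w using TensorProduct.induction_on with
    | zero => simp
    | add a b ha hb =>
      simp only [TensorProduct.add_tmul, TensorProduct.tmul_add, map_add, add_mul, ha, hb]
    | tmul v₁ v₂ =>
    induction z using TensorProduct.induction_on with
    | zero => simp
    | add a b ha hb =>
      simp only [TensorProduct.add_tmul, TensorProduct.tmul_add, map_add, mul_add, ha, hb]
    | tmul y₁ y₂ => simp [cocycleHom₃_tmul, rMatrixHom₂_tmul]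

/-- Here the coaction δ⁻ arises: R₁F₃ = (R₁⁽¹⁾ ▷ F₃)R₁⁽²⁾, and (Δ ⊗ id)(R) = R₁₃R₂₃ makes one copy
of R into δ⁻(F₃), with its H-component in the third leg, and leaves the other as R₁₃. -/
theorem rMatrixHom₁_mul_cocycleHom (hR : IsUniversalRMatrix R) (f : U ⊗[k] (U ⊗[k] L)) :
    rMatrixHom₁ j ι (leg13 R) * inl₁₂ (cocycleHom U i f) =
      cocycleHom₃ U i (LinearMap.lTensor U (LinearMap.lTensor U
        (LinearMap.rTensor L (ι : H →ₗ[k] U) ∘ₗ coactionMinus L R)) f) *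
          rMatrixHom₁ j ι (leg13 R) := by
  induction f using TensorProduct.induction_on₃ with
  | zero => simp
  | add a b ha hb => simp only [map_add, add_mul, mul_add, ha, hb]
  | tmul u v n =>
    let Θ : (H ⊗[k] H) ⊗[k] H →ₗ[k] (U ⊗[k] A) ⊗[k] ((U ⊗[k] A) ⊗[k] (U ⊗[k] A)) :=
      TensorProduct.map (TensorProduct.mk k U A u ∘ₗ crossMap i j n)
        (TensorProduct.mk k _ _ (v ⊗ₜ 1) ∘ₗ (TensorProduct.mk k U A).flip 1 ∘ₗ
          (ι : H →ₗ[k] U))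
    have h1 : ∀ S : H ⊗[k] H, rMatrixHom₁ j ι (leg13 S) *
        inl₁₂ ((u ⊗ₜ i n) ⊗ₜ (v ⊗ₜ 1)) = Θ (LinearMap.rTensor H Coalgebra.comul S) := by
      intro S
      induction S using TensorProduct.induction_on with
      | zero => simp [leg13_zero]
      | add a b ha hb => simp only [leg13_add, map_add, add_mul, ha, hb]
      | tmul x y =>
        simp [leg13_tmul, rMatrixHom₁_tmul, inl₁₂_tmul, Θ, h.j_mul_i]
    have h2 : ∀ S T : H ⊗[k] H,
        Θ ((TensorProduct.assoc k H H H).symm (leg13 S * leg23 T)) =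
          cocycleHom₃ U i (u ⊗ₜ (v ⊗ₜ LinearMap.rTensor L (ι : H →ₗ[k] U)
            (coactionMinus L S n))) * rMatrixHom₁ j ι (leg13 T) := by
      intro S T
      induction S using TensorProduct.induction_on with
      | zero => simp [leg13_zero, coactionMinus]
      | add a b ha hb =>
        have e : coactionMinus L (a + b) n = coactionMinus L a n + coactionMinus L b n := by
          simp [coactionMinus]
        simp only [leg13_add, e, map_add, add_mul, TensorProduct.tmul_add, ha, hb]
      | tmul x y =>
      induction T using TensorProduct.induction_on with
      | zero => simp [leg23_zero, leg13_zero]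
      | add a b ha hb => simp only [leg13_add, leg23_add, map_add, mul_add, ha, hb]
      | tmul x' y' =>
        simp [Θ, leg13_tmul, leg23_tmul, crossMap_tmul, coactionMinus_tmul, cocycleHom₃_tmul,
          rMatrixHom₁_tmul]
    rw [cocycleHom_tmul, h1, hR.rTensor_comul, h2]
    rfl

theorem cocycleHom₃_mul_mem (f : U ⊗[k] (U ⊗[k] (U ⊗[k] L)))
    {x : (U ⊗[k] A) ⊗[k] ((U ⊗[k] A) ⊗[k] (U ⊗[k] A))}
    (hx : x ∈ balRel₃ (D.tensor U).s (D.tensor U).t) :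
    cocycleHom₃ U i f * x ∈ balRel₃ (D.tensor U).s (D.tensor U).t := by
  have e1 : ∀ l, cocycleHom₃ U i f * inl₁₂ ((D.tensor U).t l ⊗ₜ 1 - 1 ⊗ₜ (D.tensor U).s l) =
      inl₁₂ ((D.tensor U).t l ⊗ₜ 1 - 1 ⊗ₜ (D.tensor U).s l) * cocycleHom₃ U i f := by
    intro l
    induction f using TensorProduct.induction_on with
    | zero => simp
    | add a b ha hb => simp only [map_add, add_mul, mul_add, ha, hb]
    | tmul u g =>
    induction g using TensorProduct.induction_on₃ with
    | zero => simp
    | add a b ha hb => simp only [TensorProduct.tmul_add, map_add, add_mul, mul_add, ha, hb]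
    | tmul v w n =>
      simp [cocycleHom₃_tmul, inl₁₂_tmul, mul_sub, sub_mul, tensor_s, tensor_t, h.t_mul_i]
  have e2 : ∀ l, cocycleHom₃ U i f * inr₂₃ ((D.tensor U).t l ⊗ₜ 1 - 1 ⊗ₜ (D.tensor U).s l) =
      inr₂₃ ((D.tensor U).t l ⊗ₜ 1 - 1 ⊗ₜ (D.tensor U).s l) * cocycleHom₃ U i f := by
    intro l
    clear e1
    induction f using TensorProduct.induction_on with
    | zero => simp
    | add a b ha hb => simp only [map_add, add_mul, mul_add, ha, hb]
    | tmul u g =>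
    induction g using TensorProduct.induction_on₃ with
    | zero => simp
    | add a b ha hb => simp only [TensorProduct.tmul_add, map_add, add_mul, mul_add, ha, hb]
    | tmul v w n =>
      simp [cocycleHom₃_tmul, inr₂₃_apply, TensorProduct.tmul_sub, mul_sub, sub_mul, tensor_s,
        tensor_t]
  refine mul_balRel₃_mem (fun l => ?_) (fun l => ?_) hx
  · rw [e1]
    refine balRel₃_mul_mem ?_ _
    simpa [← Algebra.TensorProduct.one_def] using
      inl₁₂_mem (balRel_gen_mem (D.tensor U).s (D.tensor U).t l) 1
  · rw [e2]
    refine balRel₃_mul_mem ?_ _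
    simpa [← Algebra.TensorProduct.one_def] using
      inr₂₃_mem (balRel_gen_mem (D.tensor U).s (D.tensor U).t l) 1

/-- In F₂₃ the component F₃ sits in the second leg; the relations move it to the first leg as t(F₃)
= (R₂ ▷ F₃)R₁. Together with the copy already present this R forms R₁₃R₁₂ = (id ⊗ Δ)(R), whose
second leg acts on all three components of F, so equivariance carries it to the right of F. -/
theorem rMatrixHom₂_mul_cocycleHom {δ : L →ₗ[k] H ⊗[k] L} (hR : IsUniversalRMatrix R)
    (hF : IsDynamicalCocycle ι δ F) :
    rMatrixHom₂ j ι (LinearMap.lTensor H Coalgebra.comul R) * inr₂₃ (cocycleHom U i F) -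
      cocycleHom₃ U i (1 ⊗ₜ F) * rMatrixHom₂ j ι (LinearMap.lTensor H Coalgebra.comul R) ∈
        balRel₃ (D.tensor U).s (D.tensor U).t := by
  have h1 : ∀ (Q : H ⊗[k] H) (x y : H) (u v : U) (n : L),
      shiftMap i j ι (LinearMap.lTensor H ((leftAct₃ L ι).flip (u ⊗ₜ (v ⊗ₜ n)) ∘ₗ
        (TensorProduct.assoc k H H H).toLinearMap ∘ₗ LinearMap.rTensor H Coalgebra.comul)
        (leg13 Q * leg12 (x ⊗ₜ y))) =
      (1 ⊗ₜ (crossMap i j n (TensorProduct.comm k H H Q) * j x)) ⊗ₜ TensorProduct.map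
        ((TensorProduct.mk k U A).flip 1 ∘ₗ LinearMap.mulRight k u ∘ₗ (ι : H →ₗ[k] U))
        ((TensorProduct.mk k U A).flip 1 ∘ₗ LinearMap.mulRight k v ∘ₗ (ι : H →ₗ[k] U))
        (Coalgebra.comul y) := by
    intro Q x y u v n
    induction Q using TensorProduct.induction_on with
    | zero => simp [leg13_zero]
    | add a b ha hb =>
      simp only [leg13_add, add_mul, map_add, TensorProduct.tmul_add, TensorProduct.add_tmul,
        ha, hb]
    | tmul a b =>
      simp only [leg13_tmul, leg12_tmul, Algebra.TensorProduct.tmul_mul_tmul, one_mul, mul_one,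
        LinearMap.lTensor_tmul, LinearMap.comp_apply, LinearMap.rTensor_tmul]
      generalize (Coalgebra.comul y : H ⊗[k] H) = w
      induction w using TensorProduct.induction_on with
      | zero => simp
      | add c d hc hd => simp only [TensorProduct.add_tmul, TensorProduct.tmul_add, map_add, hc, hd]
      | tmul c d => simp [leftAct₃_tmul, shiftMap_tmul₃, crossMap_tmul, mul_assoc]
  have h2 : ∀ (S : H ⊗[k] H) (f : U ⊗[k] (U ⊗[k] L)),
      rMatrixHom₂ j ι (LinearMap.lTensor H Coalgebra.comul S) * inr₂₃ (cocycleHom U i f) -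
      shiftMap i j ι (LinearMap.lTensor H ((leftAct₃ L ι).flip f ∘ₗ
        (TensorProduct.assoc k H H H).toLinearMap ∘ₗ LinearMap.rTensor H Coalgebra.comul)
        (leg13 R * leg12 S)) ∈ balRel₃ (D.tensor U).s (D.tensor U).t := by
    intro S f
    induction f using TensorProduct.induction_on₃ with
    | zero => simp
    | add a b ha hb =>
      simp only [map_add, mul_add, LinearMap.add_comp, LinearMap.lTensor_add,
        LinearMap.add_apply, add_sub_add_comm]
      exact add_mem ha hb
    | tmul u v n =>
    induction S using TensorProduct.induction_on with
    | zero => simp [leg12_zero]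
    | add a b ha hb =>
      simp only [map_add, add_mul, mul_add, leg12_add, add_sub_add_comm]
      exact add_mem ha hb
    | tmul x y =>
      rw [h1, LinearMap.lTensor_tmul, cocycleHom_tmul]
      generalize (Coalgebra.comul y : H ⊗[k] H) = w
      induction w using TensorProduct.induction_on with
      | zero => simp
      | add c d hc hd =>
        simp only [map_add, TensorProduct.tmul_add, add_mul, add_sub_add_comm]
        exact add_mem hc hd
      | tmul c d =>
        -- Up to sign the difference is a single generator t(n)a ⊗ b - a ⊗ s(n)b in the first two
        -- legs.
        rw [← neg_sub]
        refine neg_mem (Submodule.subset_span (Or.inl ⟨n, 1 ⊗ₜ j x, (ι c * u) ⊗ₜ 1,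
          (ι d * v) ⊗ₜ 1, ?_⟩))
        simp [rMatrixHom₂_tmul, inr₂₃_apply, tensor_s, tensor_t, h.s_eq, h.t_eq]
  rw [← shiftMap_mul_embed₂, ← lTensor_leftAct₃ ι hR hF]
  exact h2 R F

/-- The left side is (Δ ⊗ id ⊗ id)(F) R₁₃R₂₃F₁₂R₁₂. Moving R₂₃ past F₁₂ and then R₁₃ past F₁₂
exposes the left side of the dynamical cocycle equation. After that equation the two sides differ
only in the order of F₂₃ and (id ⊗ Δ)(R), which `rMatrixHom₂_mul_cocycleHom` exchanges modulo
relations. -/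
theorem cocycle (hR : IsUniversalRMatrix R) (hF : IsDynamicalCocycle ι (coactionMinus L R) F) :
    lift₁ (tensorLift U d) (cocycleHom U i F * rMatrixHom j ι R) *
        inl₁₂ (cocycleHom U i F * rMatrixHom j ι R) -
      lift₂ (tensorLift U d) (cocycleHom U i F * rMatrixHom j ι R) *
        inr₂₃ (cocycleHom U i F * rMatrixHom j ι R) ∈
      balRel₃ (D.tensor U).s (D.tensor U).t := by
  have e1 : lift₁ (tensorLift U d) (cocycleHom U i F * rMatrixHom j ι R) *
        inl₁₂ (cocycleHom U i F * rMatrixHom j ι R) =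
      cocycleHom₃ U i (LinearMap.lTensor U (comulFst k U L) F) *
        (cocycleHom₃ U i (1 ⊗ₜ F) *
          rMatrixHom₂ j ι (LinearMap.lTensor H Coalgebra.comul R)) *
            inr₂₃ (rMatrixHom j ι R) := by
    rw [h.lift₁_tensorLift, hR.comul_left, map_mul, map_mul, rMatrixHom₁_leg23, mul_assoc,
      mul_assoc (rMatrixHom₁ j ι (leg13 R)), ← mul_assoc (inr₂₃ _),
      inr₂₃_mul_inl₁₂_cocycleHom, mul_assoc (inl₁₂ _), ← mul_assoc (rMatrixHom₁ j ι (leg13 R)),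
      h.rMatrixHom₁_mul_cocycleHom ι hR, mul_assoc (cocycleHom₃ U i _), ← mul_assoc,
      ← map_mul (cocycleHom₃ U i), hF.cocycle, map_mul (cocycleHom₃ U i), hR.comul_right,
      map_mul (rMatrixHom₂ j ι), rMatrixHom₂_leg12, rMatrixHom₂_leg13,
      ← inl₁₂_mul_inr₂₃_rMatrixHom]
    simp only [mul_assoc]
  rw [e1, h.lift₂_tensorLift, map_mul inr₂₃]
  have := neg_mem (balRel₃_mul_mem (h.cocycleHom₃_mul_mem
    (LinearMap.lTensor U (comulFst k U L) F) (h.rMatrixHom₂_mul_cocycleHom ι hR hF))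
      (inr₂₃ (rMatrixHom j ι R)))
  convert this using 1
  simp only [mul_sub, sub_mul, mul_assoc, neg_sub]

theorem isTwistLift [IsModuleAlgebra k H L] (hR : IsUniversalRMatrix R)
    (hL : IsQuasiCommutative L R) (hF : IsDynamicalCocycle ι (coactionMinus L R) F)
    {P : ((U ⊗[k] A) ⊗[k] (U ⊗[k] A))ˣ} (hP : P.val = cocycleHom U i F * rMatrixHom j ι R) :
    (D.tensor U).IsTwistLift (tensorLift U d) P (sourceMap i ι R) (D.tensor U).t := by
  have hT := h.isLifted.tensor U
  have source : ∀ l, sourceMap i ι R l = TensorProduct.lift (LinearMap.mul k _ ∘ₗ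
      (D.tensor U).s ∘ₗ (D.tensor U).anchor.flip l) P.val := by
    intro l
    rw [hP, h.source, hF.counit_fst, map_one, one_mul]
  have target : ∀ l, (D.tensor U).t l = TensorProduct.lift (LinearMap.mul k _ ∘ₗ
      (D.tensor U).t ∘ₗ (D.tensor U).anchor.flip l).flip P.val := by
    intro l
    rw [hP, h.target, hF.counit_snd, hR.counitRight_eq_one, map_one, map_one, one_mul,
      ← Algebra.TensorProduct.one_def, mul_one]
  have anchor_one : (D.tensor U).anchor.flip 1 = (D.tensor U).ε := by
    ext u a
    simp [anchor_apply, hT.s_one]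
  exact {
    s_one := sourceMap_one i ι hR
    s_mul := sourceMap_mul i ι hR
    t_one := hT.t_one
    t_mul := hT.t_mul
    s_mul_t := by
      intro l m
      have e : ∀ S : H ⊗[k] H, sourceMap i ι S l * (1 ⊗ₜ D.t m) =
          (1 ⊗ₜ D.t m) * sourceMap i ι S l := by
        intro S
        induction S using TensorProduct.induction_on with
        | zero => simp [sourceMap_zero]
        | add a b ha hb => simp only [sourceMap_add, LinearMap.add_apply, add_mul, mul_add, ha, hb]
        | tmul x y => simp [sourceMap_tmul, h.t_mul_i]
      exact e R
    mul_mem := fun l => by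
      rw [← balGen_apply, hP, mul_assoc, h.rMatrixHom_mul_gen ι hR]
      refine mul_balRel_mem (fun m => ?_) (actThrough_mem j ι _ _ _ l R)
      rw [← balGen_apply, h.cocycleHom_mul_balGen]
      exact balRel_mul_mem _ _ (balRel_gen_mem _ _ m) _
    inv_mul_mem := fun l => by
      -- With γ the untwisted and γ' the twisted generators, P·X = γ(l)·P for a combination X of
      -- elements γ'(m) times something. Hence P⁻¹γ(l) = X·P⁻¹ lies in the twisted right ideal.
      obtain ⟨S, hS⟩ := rMatrixHom_mul_actThrough ι hR (h.rMatrixHom_mul_gen ι hR) l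
      have e : P.val * actThrough j ι (balGen (sourceMap i ι R) (D.tensor U).t) 1 l S =
          balGen (D.tensor U).s (D.tensor U).t l * P.val := by
        rw [hP, mul_assoc, hS, ← mul_assoc, h.cocycleHom_mul_balGen, mul_assoc]
      rw [← balGen_apply, ← mul_one (balGen _ _ l), ← P.mul_inv, ← mul_assoc (balGen _ _ l), ← e,
        ← mul_assoc, ← mul_assoc, P.inv_mul, one_mul]
      exact balRel_mul_mem _ _ (actThrough_mem j ι _ _ _ l S) _
    d_s_mul := fun l => by
      rw [hP, h.d_sourceMap_mul ι hR hL hF, sub_self]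
      exact zero_mem _
    d_t_mul := fun l => by
      have := balRel_mul_mem _ _ (hT.d_t l) P.val
      rw [sub_mul, tensor_t, hP, mul_one_tmul] at this
      rw [tensor_t, hP]
      exact this
    cocycle := by
      rw [hP]
      exact h.cocycle ι hR hF
    -- Since a ⊢ 1 = ε(a), the normalisation of P is the formula for s̃ evaluated at 1; likewise for
    -- t̃ below.
    counit_fst := by
      have := source 1
      rw [anchor_one, sourceMap_one i ι hR] at this
      exact this.symm
    counit_snd := by
      have := target 1
      rw [anchor_one, hT.t_one] at this
      exact this.symm
    base := fun l m => by
      rw [hP, h.base, hF.counit_snd, hR.counitRight_eq_one, one_smul]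
      simp [_root_.counitFst, Algebra.TensorProduct.one_def]
    source := source
    target := target
    ε_s_mul := h.ε_sourceMap_mul ι hR
    ε_t_mul := hT.ε_t_mul
    ε_mul_s := h.ε_mul_sourceMap ι hR
    ε_mul_t := fun _ _ => rfl }

end IsSmashBialgebroid

end Twist

/-! ### Identification of the given representative with P, and conclusion -/

section Twist

set_option maxSynthPendingDepth 3

variable {k H U L A : Type*} [CommRing k] [Ring H] [Bialgebra k H] [Ring U] [Bialgebra k U]
  [Ring L] [Algebra k L] [Ring A] [Algebra k A]
  (i : L →ₐ[k] A) (j : H →ₐ[k] A) (ι : H →ₐc[k] U)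

/-- The bilinear map `(f, S) ↦ cocycleHom f * rMatrixHom S`. -/
def twistMap : U ⊗[k] (U ⊗[k] L) →ₗ[k] H ⊗[k] H →ₗ[k] (U ⊗[k] A) ⊗[k] (U ⊗[k] A) :=
  (LinearMap.mul k _).compl₁₂ (cocycleHom U i).toLinearMap (rMatrixHom j ι).toLinearMap

theorem twistMap_apply (f : U ⊗[k] (U ⊗[k] L)) (S : H ⊗[k] H) :
    twistMap i j ι f S = cocycleHom U i f * rMatrixHom j ι S := rfl

theorem twistMap_tmul (u v : U) (l : L) (x y : H) :
    twistMap i j ι (u ⊗ₜ (v ⊗ₜ l)) (x ⊗ₜ y) = (u ⊗ₜ (i l * j x)) ⊗ₜ ((v * ι y) ⊗ₜ 1) := by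
  simp [twistMap_apply, cocycleHom_tmul, rMatrixHom_tmul]

theorem exists_unit_eq_twistMap {f : U ⊗[k] (U ⊗[k] L)} {S : H ⊗[k] H} (hf : IsUnit f)
    (hS : IsUnit S) : ∃ P : ((U ⊗[k] A) ⊗[k] (U ⊗[k] A))ˣ,
      P.val = twistMap i j ι f S :=
  (hf.map (cocycleHom U i)).mul (hS.map (rMatrixHom j ι))

variable [Module H L] [IsScalarTower k H L] [IsModuleAlgebra k H L]

theorem isSmashBialgebroid_smashPlus {R : H ⊗[k] H} (hR : IsUniversalRMatrix R)
    (hL : IsQuasiCommutative L R) :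
    IsSmashBialgebroid (smashPlus L R) (smashComul k H L) R (Smash.inl k H L)
      (Smash.inr k H L) where
  isLifted := Smash.isLiftedBialgebroid_smashPlus hR hL
  s_eq := fun _ => rfl
  t_eq := fun l => Smash.smashTarget_eq R l
  j_mul_i := Smash.inr_mul_inl
  j_mul_t := Smash.inr_mul_target hR
  d_eq := Smash.comul_inl_mul_inr
  ε_eq := fun l x => by rw [← Smash.of_tmul]; exact smashCounit_of l x

theorem twistRep_eq_twistMap (F : U ⊗[k] (U ⊗[k] L)) (R : H ⊗[k] H) :
    twistRep ι F R = twistMap (Smash.inl k H L) (Smash.inr k H L) ι F R := by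
  have e : ∀ (u v : U) (l : L), twistRep ι (u ⊗ₜ (v ⊗ₜ l)) R =
      twistMap (Smash.inl k H L) (Smash.inr k H L) ι (u ⊗ₜ (v ⊗ₜ l)) R := by
    intro u v l
    induction R using TensorProduct.induction_on with
    | zero => simp only [twistRep, map_zero]
    | add a b ha hb =>
      rw [map_add, ← ha, ← hb]
      simp only [twistRep, map_add]
    | tmul x y => rw [twistRep_tmul, twistMap_tmul, Smash.of_tmul]
  induction F using TensorProduct.induction_on₃ with
  | zero => simp only [twistRep, map_zero, LinearMap.zero_apply]
  | add a b ha hb =>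
    rw [map_add, LinearMap.add_apply, ← ha, ← hb]
    simp only [twistRep, map_add, LinearMap.add_apply]
  | tmul u v l => exact e u v l

end Twist

theorem mainTheorem2 {k H U L : Type*} [CommRing k] [Ring H] [HopfAlgebra k H]
    [Ring U] [HopfAlgebra k U] [Ring L] [Algebra k L]
    [Module H L] [IsScalarTower k H L] [IsModuleAlgebra k H L]
    (ι : H →ₐc[k] U)
    (R : H ⊗[k] H) (hR : IsUniversalRMatrix R) (hL : IsQuasiCommutative L R)
    (F : U ⊗[k] (U ⊗[k] L)) (hF : IsDynamicalCocycle ι (coactionMinus L R) F) :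
    (tensorSmash U L R).IsBialgebroid ∧
    (tensorSmash U L R).IsTwistingCocycle (twistElement ι F R) ∧
    ∃ (D' : BialgebroidData k L (U ⊗[k] Smash k H L)) (Φ : Bal D'.s D'.t),
      D'.s = twistedSource ι R ∧
      D'.t = (tensorSmash U L R).t ∧
      D'.ε = (tensorSmash U L R).ε ∧
      (tensorSmash U L R).IsTwist (twistElement ι F R) D' Φ ∧
      D'.IsBialgebroid := by
  have h := isSmashBialgebroid_smashPlus hR hL
  have hT := h.isLifted.tensor U
  obtain ⟨P, hP⟩ := exists_unit_eq_twistMap (Smash.inl k H L) (Smash.inr k H L) ι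
    hF.isUnit hR.isUnit
  have hΨ := h.isTwistLift ι hR hL hF hP
  have e : twistElement ι F R = ((smashPlus L R).tensor U).cls P.val := by
    rw [hP, ← twistRep_eq_twistMap]
    rfl
  rw [e]
  exact ⟨hT.isBialgebroid, hΨ.isTwistingCocycle hT,
    ((smashPlus L R).tensor U).twist (BialgebroidData.tensorLift U (smashComul k H L)) P
      (sourceMap (Smash.inl k H L) ι R) ((smashPlus L R).tensor U).t,
    Bal.mk _ _ P⁻¹.val, rfl, rfl, rfl, hΨ.isTwist hT,
    (hΨ.isLiftedBialgebroid_twist hT).isBialgebroid⟩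

end
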